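/- **Theorem.** Let $n,m\ge 0$ be integers, let $\Omega\subseteq\mathbb R^n$ and $\Upsilon\subseteq\mathbb R^m$ be open, and let $\bar x\in\Omega$; use the max norm. For $\alpha=1,\dots,m$ let $I_\alpha=\{i_1<\dots<i_{p_\alpha}\}\subseteq\{1,\dots,n\}$. Assume: 1. $\mathbf r_1,\dots,\mathbf r_n$ is a $C^1$ frame on $\Omega$ ($C^1$ vector fields that are linearly independent at every point of $\Omega$). 2. For each $\alpha$, $\Xi_\alpha\subseteq\Omega$ is an embedded $C^1$ submanifold containing $\bar x$, with a single chart, that is, a $C^1$-diffeomorphism $\xi_\alpha:\mathcal U_\alpha\to\Xi_\alpha$ from an open neighborhood $\mathcal U_\alpha$ of $0$ in $\mathbb R^{n-p_\alpha}$, with $\xi_\alpha(0)=\bar x$. 3. $\Xi_\alpha$ (of codimension $p_\alpha$) is everywhere transverse to $\operatorname{span}\{\mathbf r_i : i\in I_\alpha\}$. 4. (Stable configuration condition.) Let $W_i^t$ be the flow of $\mathbf r_i$ on $\Omega$ and put $$\psi_\alpha(t_1,\dots,t_n)=W_{i_{p_\alpha}}^{t_{p_\alpha}}\cdots W_{i_1}^{t_1}\,\xi_\alpha(t_{p_\alpha+1},\dots,t_n).$$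 Call an open neighborhood $\Theta\subseteq\mathbb R^n$ of the origin *$p$-accessible* if for every $t\in\Theta$ the piecewise linear path with the successive vertices $(t_1,\dots,t_j,0,\dots,0,t_{p+1},\dots,t_n)$, $j=0,\dots,p$, lies in $\Theta$. For every $\epsilon>0$ there are an open neighborhood $\Omega_\epsilon\subseteq B_\epsilon(\bar x)$ of $\bar x$ and, for every $\alpha$, a $p_\alpha$-accessible $\Theta_{\alpha,\epsilon}$ such that $\psi_\alpha$ is defined on $\Theta_{\alpha,\epsilon}$ and is a $C^1$-diffeomorphism from $\Theta_{\alpha,\epsilon}$ onto $\Omega_\epsilon$. 5. For each $\alpha$, $g_\alpha:\Xi_\alpha\to\mathbb R$ is $C^1$ and bounded, and $(g_1(\bar x),\dots,g_m(\bar x))\in\Upsilon$. 6. For each $\alpha$ and $i\in I_\alpha$, $f_i^\alpha:\Omega\times\Upsilon\to\mathbb R$ is bounded and is Lipschitz in $u\in\Upsilon$ uniformly in $x\in\Omega$. 7. For each $\alpha$ and $i\in I_\alpha$, $f_i^\alpha\in C^1(\Omega\times\Upsilon)$. 8. For each $\alpha$, each $i,j\in I_\alpha$ with $i\ne j$ and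 each $\beta$ with $i\notin I_\beta$: $\partial_{u_\beta}f_j^\alpha=0$ on $\Omega\times\Upsilon$. 9. For each $\alpha$ and $j,k\in I_\alpha$: $[\mathbf r_j,\mathbf r_k]\in\operatorname{span}\{\mathbf r_i : i\in I_\alpha\}$ at every point of $\Omega$. 10. With the structure coefficients $c_{ij}^k$ given by $[\mathbf r_i,\mathbf r_j]=\sum_{k=1}^n c_{ij}^k\mathbf r_k$ on $\Omega$: for each $\alpha$, each $i,j\in I_\alpha$ with $i\neq j$, and all $(x,u)\in\Omega\times\Upsilon$, $$\nabla_xf_j^\alpha\cdot\mathbf r_i+\sum_{\beta:\,i\in I_\beta}\partial_{u_\beta}f_j^\alpha\, f_i^\beta-\nabla_xf_i^\alpha\cdot\mathbf r_j-\sum_{\beta:\,j\in I_\beta}\partial_{u_\beta}f_i^\alpha\, f_j^\beta=\sum_{k\in I_\alpha}c_{ij}^k f_k^\alpha .$$ 11. For each $\alpha$ and $i,j,k\in I_\alpha$, $c_{ij}^k$ is bounded on $\Omega$. Then there is an open neighborhood $\widetilde\Omega\subseteq\Omega$ of $\bar x$ on which there is exactly one $C^1$ function $u:\widetilde\Omega\to\Upsilon$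 with $$\mathbf r_i(u_\alpha)|_x=f_i^\alpha(x,u(x))\quad(1\le\alpha\le m,\ i\in I_\alpha,\ x\in\widetilde\Omega),\qquad u_\alpha(x)=g_\alpha(x)\quad(1\le\alpha\le m,\ x\in\Xi_\alpha\cap\widetilde\Omega).$$ -/

import Mathlib

namespace Darboux

/-- `r` is a `C¹` frame on `Ω ⊆ ℝⁿ`: `C¹` vector fields that form a basis at every point of `Ω`. -/
def IsC1Frame {n : ℕ} (Ω : Set (Fin n → ℝ)) (r : Fin n → (Fin n → ℝ) → (Fin n → ℝ)) : Prop :=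
  (∀ i, ContDiffOn ℝ 1 (r i) Ω) ∧ ∀ x ∈ Ω, LinearIndependent ℝ (fun i => r i x)

/-- The derivative `v(h)|ₓ` of a scalar function `h` along the vector field `v`. -/
noncomputable def dirDeriv {n : ℕ} (v : (Fin n → ℝ) → (Fin n → ℝ)) (h : (Fin n → ℝ) → ℝ)
    (x : Fin n → ℝ) : ℝ :=
  fderiv ℝ h x (v x)

/-- The structure coefficient `c_{ij}^k(x)` of a frame: the `k`-th coordinate of `[r_i, r_j]` at `x`
in the basis `r_1(x), …, r_n(x)` (the matrix that is inverted has the columns `r_l(x)`). -/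
noncomputable def structureCoeff {n : ℕ} (r : Fin n → (Fin n → ℝ) → (Fin n → ℝ))
    (i j k : Fin n) (x : Fin n → ℝ) : ℝ :=
  ((Matrix.of fun a l => r l x a)⁻¹.mulVec (VectorField.lieBracket ℝ (r i) (r j) x)) k

/-- The defining property of the structure coefficients. -/
theorem lieBracket_eq_sum_structureCoeff {n : ℕ} {Ω : Set (Fin n → ℝ)}
    {r : Fin n → (Fin n → ℝ) → (Fin n → ℝ)} (hr : IsC1Frame Ω r) {x : Fin n → ℝ} (hx : x ∈ Ω)
    (i j : Fin n) :
    VectorField.lieBracket ℝ (r i) (r j) x = ∑ k, structureCoeff r i j k x • r k x := by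
  set A : Matrix (Fin n) (Fin n) ℝ := Matrix.of fun a l => r l x a with hA
  have hu : IsUnit A := by
    rw [← Matrix.linearIndependent_cols_iff_isUnit]
    exact hr.2 x hx
  have hdet : IsUnit A.det := (Matrix.isUnit_iff_isUnit_det A).1 hu
  have h : A.mulVec (A⁻¹.mulVec (VectorField.lieBracket ℝ (r i) (r j) x)) =
      VectorField.lieBracket ℝ (r i) (r j) x := by
    rw [Matrix.mulVec_mulVec, Matrix.mul_nonsing_inv A hdet, Matrix.one_mulVec]
  rw [← h]
  ext a
  simp only [structureCoeff, Matrix.mulVec, dotProduct, Finset.sum_apply, Pi.smul_apply,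
    smul_eq_mul]
  exact Finset.sum_congr rfl fun k _ => mul_comm _ _

/-- `ξ : U → Ξ` is a global `C¹` chart, centred at `xbar`, of the embedded `C¹` submanifold `Ξ ⊆ Ω`
of dimension `d`: an immersion of the open set `U ∋ 0` of `ℝᵈ` that is a homeomorphism onto `Ξ`. -/
structure IsC1Chart {n d : ℕ} (Ω Ξ : Set (Fin n → ℝ)) (xbar : Fin n → ℝ)
    (U : Set (Fin d → ℝ)) (ξ : (Fin d → ℝ) → (Fin n → ℝ)) : Prop where
  isOpen : IsOpen U
  zero_mem : (0 : Fin d → ℝ) ∈ U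
  map_zero : ξ 0 = xbar
  contDiffOn : ContDiffOn ℝ 1 ξ U
  immersion : ∀ s ∈ U, Function.Injective (fderiv ℝ ξ s)
  embedding : Topology.IsEmbedding (U.domRestrict ξ)
  image_eq : ξ '' U = Ξ
  subset : Ξ ⊆ Ω

/-- The manifold with the chart `ξ : U → Ξ` is everywhere transverse to the span of the vector
fields `r_i`, `i ∈ I`; the range of the derivative of `ξ` is the tangent space. -/
def IsTransverse {n d : ℕ} (r : Fin n → (Fin n → ℝ) → (Fin n → ℝ)) (I : Finset (Fin n))
    (U : Set (Fin d → ℝ)) (ξ : (Fin d → ℝ) → (Fin n → ℝ)) : Prop :=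
  ∀ s ∈ U, (fderiv ℝ ξ s).range ⊔ Submodule.span ℝ ((fun i => r i (ξ s)) '' (I : Set (Fin n))) = ⊤

/-- `y = W^τ(x)`, where `W` is the flow of the vector field `v` on `Ω`: some integral curve of `v`
in `Ω` is at `x` at time `0` and at `y` at time `τ` (`τ` may be negative). -/
def FlowsTo {n : ℕ} (Ω : Set (Fin n → ℝ)) (v : (Fin n → ℝ) → (Fin n → ℝ)) (τ : ℝ)
    (x y : Fin n → ℝ) : Prop :=
  ∃ γ : ℝ → (Fin n → ℝ), γ 0 = x ∧ γ τ = y ∧ Set.MapsTo γ (Set.uIcc 0 τ) Ω ∧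
    IsIntegralCurveOn γ (fun _ => v) (Set.uIcc 0 τ)

/-- The space `ℝⁿ = ℝᵖ × ℝⁿ⁻ᵖ` of the parameters `t = (t_1, …, t_p; t_{p+1}, …, t_n)`. -/
abbrev Params (n p : ℕ) : Type := (Fin p → ℝ) × (Fin (n - p) → ℝ)

/-- `y = W_{i_p}^{t_p} ⋯ W_{i_1}^{t_1} ξ(t_{p+1}, …, t_n)`, where `i_1 < ⋯ < i_p` are the elements of
`I` and `W_i` is the flow of `r_i` on `Ω` (all the flows being defined at the points in question);
`z j` is the point that is reached after the first `j` flows. -/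
def IsFlowImage {n : ℕ} (Ω : Set (Fin n → ℝ)) (r : Fin n → (Fin n → ℝ) → (Fin n → ℝ))
    (I : Finset (Fin n)) (U : Set (Fin (n - I.card) → ℝ))
    (ξ : (Fin (n - I.card) → ℝ) → (Fin n → ℝ)) (t : Params n I.card) (y : Fin n → ℝ) : Prop :=
  t.2 ∈ U ∧ ∃ z : Fin (I.card + 1) → (Fin n → ℝ), z 0 = ξ t.2 ∧
    (∀ j : Fin I.card, FlowsTo Ω (r (I.orderEmbOfFin rfl j)) (t.1 j) (z j.castSucc) (z j.succ)) ∧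
    z (Fin.last I.card) = y

/-- The vertex `(t_1, …, t_j, 0, …, 0, t_{p+1}, …, t_n)`. -/
noncomputable def vertex {n p : ℕ} (t : Params n p) (j : ℕ) : Params n p :=
  (fun l => if (l : ℕ) < j then t.1 l else 0, t.2)

/-- `Θ` is a `p`-accessible open neighbourhood of the origin. -/
def IsAccessible {n p : ℕ} (Θ : Set (Params n p)) : Prop :=
  IsOpen Θ ∧ (0 : Params n p) ∈ Θ ∧
    ∀ t ∈ Θ, ∀ j < p, segment ℝ (vertex t j) (vertex t (j + 1)) ⊆ Θ

/-- `ψ` restricts to a `C¹` diffeomorphism of the open set `S` onto the open set `T`. -/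
def IsC1Diffeo {E F : Type*} [NormedAddCommGroup E] [NormedSpace ℝ E] [NormedAddCommGroup F]
    [NormedSpace ℝ F] (ψ : E → F) (S : Set E) (T : Set F) : Prop :=
  ContDiffOn ℝ 1 ψ S ∧ Set.MapsTo ψ S T ∧
    ∃ φ : F → E, ContDiffOn ℝ 1 φ T ∧ Set.MapsTo φ T S ∧ Set.InvOn φ ψ S T

/-- The stable configuration condition near `xbar` for the frame `r` and the manifolds with the
charts `ξ α : U α → ℝⁿ`: arbitrarily small neighbourhoods `Ωε` of `xbar` are, for every `α` at once,
diffeomorphic to an accessible neighbourhood of the origin under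
`ψ_α(t) = W_{i_p}^{t_p} ⋯ W_{i_1}^{t_1} ξ_α(t_{p+1}, …, t_n)`. -/
def StableConfiguration {n m : ℕ} (Ω : Set (Fin n → ℝ))
    (r : Fin n → (Fin n → ℝ) → (Fin n → ℝ)) (I : Fin m → Finset (Fin n))
    (U : ∀ α, Set (Fin (n - (I α).card) → ℝ))
    (ξ : ∀ α, (Fin (n - (I α).card) → ℝ) → (Fin n → ℝ)) (xbar : Fin n → ℝ) : Prop :=
  ∀ ε > 0, ∃ Ωε : Set (Fin n → ℝ), IsOpen Ωε ∧ xbar ∈ Ωε ∧ Ωε ⊆ Metric.ball xbar ε ∧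
    ∀ α, ∃ (Θ : Set (Params n (I α).card)) (ψ : Params n (I α).card → (Fin n → ℝ)),
      IsAccessible Θ ∧ (∀ t ∈ Θ, IsFlowImage Ω r (I α) (U α) (ξ α) t (ψ t)) ∧ IsC1Diffeo ψ Θ Ωε

/-- `∂f/∂u_β` at `(x, u)`. -/
noncomputable def partialU {n m : ℕ} (f : (Fin n → ℝ) → (Fin m → ℝ) → ℝ) (β : Fin m)
    (x : Fin n → ℝ) (u : Fin m → ℝ) : ℝ :=
  fderiv ℝ (fun w => f x w) u (Pi.single β 1)

/-- The left-hand side of the integrability condition for `u_α` and the directions `i`, `j`: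
`∇ₓf_j^α · r_i + ∑_{β : i ∈ I_β} (∂f_j^α/∂u_β) f_i^β` minus the same with `i` and `j` exchanged. -/
noncomputable def mixedDefect {n m : ℕ} (r : Fin n → (Fin n → ℝ) → (Fin n → ℝ))
    (I : Fin m → Finset (Fin n)) (f : Fin m → Fin n → (Fin n → ℝ) → (Fin m → ℝ) → ℝ)
    (α : Fin m) (i j : Fin n) (x : Fin n → ℝ) (u : Fin m → ℝ) : ℝ :=
  (dirDeriv (r i) (fun y => f α j y u) x
      + ∑ β with i ∈ I β, partialU (f α j) β x u * f β i x u)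
    - (dirDeriv (r j) (fun y => f α i y u) x
      + ∑ β with j ∈ I β, partialU (f α i) β x u * f β j x u)

/-- `u : D → Υ` is a (`C¹`, pointwise) solution on the open set `D` of the system
`r_i(u_α) = f_i^α(x, u)`, `i ∈ I_α`, with the data `u_α = g_α` on `Ξ_α ∩ D`. -/
structure IsSolution {n m : ℕ} (Υ : Set (Fin m → ℝ)) (r : Fin n → (Fin n → ℝ) → (Fin n → ℝ))
    (I : Fin m → Finset (Fin n)) (f : Fin m → Fin n → (Fin n → ℝ) → (Fin m → ℝ) → ℝ)
    (Ξ : Fin m → Set (Fin n → ℝ)) (g : Fin m → (Fin n → ℝ) → ℝ)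
    (D : Set (Fin n → ℝ)) (u : (Fin n → ℝ) → (Fin m → ℝ)) : Prop where
  contDiffOn : ContDiffOn ℝ 1 u D
  mapsTo : Set.MapsTo u D Υ
  equation : ∀ α, ∀ i ∈ I α, ∀ x ∈ D, dirDeriv (r i) (fun y => u y α) x = f α i x (u x)
  data : ∀ α, ∀ x ∈ Ξ α ∩ D, u x α = g α x

end Darboux

open Set Filter Topology MeasureTheory

namespace Darboux

/-! ### Calculus on lines -/

/-! In the chart `ψ_α` a solution `u_α` is recovered from its data by integrating `f_i^α(x, u(x))`
along the broken path that starts on `Ξ_α` and switches on one flow time after the other. This gives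
a fixed-point equation `picard u = u`. The components `u_α` are coupled, and the operator makes
sense because the stable configuration condition supplies one neighbourhood `D` that is the image of
all the charts.

Existence and uniqueness for the integral equation. On a small `D` the operator halves uniform
distances. It also halves distances of derivatives, up to an error that is small when the functions
are uniformly close, so the iterates converge in `C¹` (`exists_contDiffOn_fixedPoint`,
`PicardSetting.exists_fixedPoint`). Every solution of the system is a fixed point
(`PicardSetting.picard_eq_of_isSolution`), and fixed points are unique
(`PicardSetting.fixedPoint_unique`).

From the fixed point back to the system. A fixed point visibly satisfies the equation for the `j`-th
flow only on the slice where the later flow times vanish. Off the slice one follows the `defect`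
`r_i(u_β) - f_i^β(x, u)` along the later segments. Symmetry of mixed derivatives
(`hasDerivAt_fderiv_apply`, which suits a `u` that is only `C¹`), the transport equation of the
chart derivatives in frame coordinates (`AdaptedChart.hasDerivAt_chartCoeff`) and involutivity
(`AdaptedChart.chartCoeff_eq_zero`) reduce the rate of change to the integrability expression. The
integrability and structural conditions turn that into a combination of defects. Hence on short
paths a common bound for all the defects can be halved (`PicardSetting.abs_defect_le_half`), and the
defects vanish (`eq_zero_of_abs_le_half`).

Uniform geometry. The charts come without estimates. These follow from the smallness of the image:
the parameters are small (`eventually_params_small`), the derivative of `ψ` is close to one fixed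
map (`eventually_norm_fderiv_sub_baseMap_le`) that transversality makes invertible
(`exists_norm_le_baseMap`), and `Ξ_α` meets `D` only in points with vanishing flow times
(`eventually_fst_eq_zero`). -/

/-- Integral curves of a `C¹` vector field in an open set are determined by their initial point. -/
theorem eqOn_of_isIntegralCurveOn {E : Type*} [NormedAddCommGroup E] [NormedSpace ℝ E]
    {Ω : Set E} (hΩ : IsOpen Ω) {v : E → E} (hv : ContDiffOn ℝ 1 v Ω) {γ₁ γ₂ : ℝ → E} {τ : ℝ}
    (h0 : γ₁ 0 = γ₂ 0) (m₁ : MapsTo γ₁ (uIcc 0 τ) Ω) (m₂ : MapsTo γ₂ (uIcc 0 τ) Ω)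
    (i₁ : IsIntegralCurveOn γ₁ (fun _ => v) (uIcc 0 τ))
    (i₂ : IsIntegralCurveOn γ₂ (fun _ => v) (uIcc 0 τ)) : EqOn γ₁ γ₂ (uIcc 0 τ) := by
  -- Uniqueness needs a single Lipschitz constant; it exists on the compact union of the two curves,
  -- where `v` is locally Lipschitz.
  set K : Set E := γ₁ '' uIcc 0 τ ∪ γ₂ '' uIcc 0 τ with hK
  have hKc : IsCompact K :=
    (isCompact_uIcc.image_of_continuousOn i₁.continuousOn).union
      (isCompact_uIcc.image_of_continuousOn i₂.continuousOn)
  have hKΩ : K ⊆ Ω := union_subset m₁.image_subset m₂.image_subset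
  have hlip : LocallyLipschitzOn K v := by
    intro x hx
    obtain ⟨C, t, ht, hC⟩ :=
      ((hv.contDiffAt (hΩ.mem_nhds (hKΩ hx))).exists_lipschitzOnWith)
    exact ⟨C, t, mem_nhdsWithin_of_mem_nhds ht, hC⟩
  obtain ⟨C, hC⟩ := hlip.exists_lipschitzOnWith_of_compact hKc
  have k₁ : ∀ t ∈ uIcc 0 τ, γ₁ t ∈ K := fun t ht => Or.inl (mem_image_of_mem _ ht)
  have k₂ : ∀ t ∈ uIcc 0 τ, γ₂ t ∈ K := fun t ht => Or.inr (mem_image_of_mem _ ht)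
  have c₁ := i₁.continuousOn
  have c₂ := i₂.continuousOn
  rcases le_total 0 τ with hτ | hτ
  · rw [uIcc_of_le hτ] at *
    have key : ∀ t ∈ Ico 0 τ, Icc 0 τ ∈ 𝓝[≥] t := fun t ht => Icc_mem_nhdsGE_of_mem ht
    exact ODE_solution_unique_of_mem_Icc_right (v := fun _ => v) (s := fun _ => K) (K := C)
      (fun _ _ => hC) c₁
      (fun t ht => (i₁ t (Ico_subset_Icc_self ht)).mono_of_mem_nhdsWithin (key t ht))
      (fun t ht => k₁ t (Ico_subset_Icc_self ht)) c₂
      (fun t ht => (i₂ t (Ico_subset_Icc_self ht)).mono_of_mem_nhdsWithin (key t ht))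
      (fun t ht => k₂ t (Ico_subset_Icc_self ht)) h0
  · rw [uIcc_of_ge hτ] at *
    have key : ∀ t ∈ Ioc τ 0, Icc τ 0 ∈ 𝓝[≤] t := fun t ht => Icc_mem_nhdsLE_of_mem ht
    exact ODE_solution_unique_of_mem_Icc_left (v := fun _ => v) (s := fun _ => K) (K := C)
      (fun _ _ => hC) c₁
      (fun t ht => (i₁ t (Ioc_subset_Icc_self ht)).mono_of_mem_nhdsWithin (key t ht))
      (fun t ht => k₁ t (Ioc_subset_Icc_self ht)) c₂
      (fun t ht => (i₂ t (Ioc_subset_Icc_self ht)).mono_of_mem_nhdsWithin (key t ht))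
      (fun t ht => k₂ t (Ioc_subset_Icc_self ht)) h0

/-- Symmetry of mixed derivatives for a function `H` that is only differentiable, but whose
derivative in the direction `w` is the strictly differentiable function `h`. -/
theorem hasDerivAt_fderiv_apply {E F : Type*} [NormedAddCommGroup E] [NormedSpace ℝ E]
    [NormedAddCommGroup F] [NormedSpace ℝ F] {Θ : Set E} (hΘ : IsOpen Θ) {H h : E → F}
    {h' : E →L[ℝ] F} {q v w : E} (hq : q ∈ Θ) (hH : DifferentiableOn ℝ H Θ)
    (hh : HasStrictFDerivAt h h' q)
    (hw : ∀ a b : ℝ, q + a • v + b • w ∈ Θ →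
      fderiv ℝ H (q + a • v + b • w) w = h (q + a • v + b • w)) :
    HasDerivAt (fun b : ℝ => fderiv ℝ H (q + b • w) v) (h' v) 0 := by
  rw [hasDerivAt_iff_isLittleO, Asymptotics.isLittleO_iff]
  intro ε hε
  have hc : 0 < ε / (‖v‖ + 1) := by positivity
  have hstrict := hh.isLittleO.def hc
  obtain ⟨δ, hδ, hδh⟩ := Metric.eventually_nhds_iff_ball.1 hstrict
  rw [← ball_prod_same] at hδh
  have hcont : Continuous fun ab : ℝ × ℝ => q + ab.1 • v + ab.2 • w := by fun_prop
  have hnear : ∀ᶠ ab : ℝ × ℝ in 𝓝 (0, 0), q + ab.1 • v + ab.2 • w ∈ Θ ∩ Metric.ball q δ := by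
    apply hcont.continuousAt.eventually_mem
    simpa using inter_mem (hΘ.mem_nhds hq) (Metric.ball_mem_nhds q hδ)
  obtain ⟨δ₂, hδ₂, hnear⟩ := Metric.eventually_nhds_iff_ball.1 hnear
  rw [← ball_prod_same] at hnear
  filter_upwards [Metric.ball_mem_nhds (0 : ℝ) hδ₂] with b hb
  have hb' : |b| < δ₂ := by simpa using hb
  -- The second difference of `H` is compared with `a b h'(v)`. Its derivative in `b` is `h(q + av +
  -- bw) - h(q + bw)`, which strict differentiability of `h` replaces by `a h'(v)` uniformly in `b`;
  -- the mean value inequality does the rest.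
  have key : ∀ a ∈ Metric.ball (0 : ℝ) δ₂,
      ‖(H (q + a • v + b • w) - H (q + a • v)) - (H (q + b • w) - H q) - (a * b) • h' v‖
        ≤ ε * ‖b‖ * ‖a‖ := by
    intro a ha
    have ha' : |a| < δ₂ := by simpa using ha
    have hin : ∀ β ∈ uIcc 0 b, |β| < δ₂ := by
      intro β hβ
      rcases le_total 0 b with h | h
      · rw [uIcc_of_le h] at hβ
        rw [abs_of_nonneg h] at hb'
        rw [abs_of_nonneg hβ.1]; linarith [hβ.2]
      · rw [uIcc_of_ge h] at hβ
        rw [abs_of_nonpos h] at hb'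
        rw [abs_of_nonpos hβ.2]; linarith [hβ.1]
    have h00 : (0 : ℝ) ∈ Metric.ball (0 : ℝ) δ₂ := Metric.mem_ball_self hδ₂
    have hd : ∀ (c : ℝ) (β : ℝ), c ∈ Metric.ball (0 : ℝ) δ₂ → |β| < δ₂ →
        HasDerivAt (fun β : ℝ => H (q + c • v + β • w)) (h (q + c • v + β • w)) β := by
      intro c β hc hβ
      have hmem := (hnear (c, β) ⟨hc, by simpa using hβ⟩).1
      have h1 : HasDerivAt (fun β : ℝ => q + c • v + β • w) w β := by
        simpa using ((hasDerivAt_id β).smul_const w).const_add (q + c • v)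
      have h2 := ((hH.differentiableAt (hΘ.mem_nhds hmem)).hasFDerivAt).comp_hasDerivAt β h1
      rw [hw c β hmem] at h2
      exact h2
    have hφ : ∀ β ∈ uIcc 0 b, HasDerivWithinAt
        (fun β : ℝ => H (q + a • v + β • w) - H (q + (0 : ℝ) • v + β • w) - β • (a • h' v))
        (h (q + a • v + β • w) - h (q + (0 : ℝ) • v + β • w) - a • h' v) (uIcc 0 b) β := by
      intro β hβ
      have h3 : HasDerivAt (fun β : ℝ => β • (a • h' v)) (a • h' v) β := by
        simpa using (hasDerivAt_id β).smul_const (a • h' v)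
      exact (((hd a β ha (hin β hβ)).sub (hd 0 β h00 (hin β hβ))).sub h3).hasDerivWithinAt
    have hbound : ∀ β ∈ uIcc 0 b,
        ‖h (q + a • v + β • w) - h (q + (0 : ℝ) • v + β • w) - a • h' v‖ ≤ ε * ‖a‖ := by
      intro β hβ
      have hm1 := (hnear (a, β) ⟨ha, by simpa using hin β hβ⟩).2
      have hm2 := (hnear (0, β) ⟨h00, by simpa using hin β hβ⟩).2
      have h4 := hδh (_, _) ⟨hm1, hm2⟩
      simp only at h4
      have h5 : q + a • v + β • w - (q + (0 : ℝ) • v + β • w) = a • v := by simp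
      rw [h5, map_smul, norm_smul] at h4
      refine h4.trans ?_
      have : ε / (‖v‖ + 1) * ‖v‖ ≤ ε := by
        rw [div_mul_eq_mul_div, div_le_iff₀ (by positivity)]
        nlinarith [norm_nonneg v]
      calc ε / (‖v‖ + 1) * (‖a‖ * ‖v‖) = (ε / (‖v‖ + 1) * ‖v‖) * ‖a‖ := by ring
        _ ≤ ε * ‖a‖ := by gcongr
    have hmv := (convex_uIcc (0 : ℝ) b).norm_image_sub_le_of_norm_hasDerivWithin_le hφ hbound
      left_mem_uIcc right_mem_uIcc
    simp only [zero_smul, add_zero, sub_zero] at hmv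
    calc _ = ‖H (q + a • v + b • w) - H (q + b • w) - b • a • h' v - (H (q + a • v) - H q)‖ := by
          congr 1
          rw [mul_comm, mul_smul]
          abel
      _ ≤ ε * ‖a‖ * ‖b‖ := hmv
      _ = _ := by ring
  have hq0 := (hnear (0, b) ⟨Metric.mem_ball_self hδ₂, hb⟩).1
  -- Dividing by `a` and letting `a → 0` turns the bound `ε |a| |b|` into a bound `ε |b|` for the
  -- increment of `b ↦ dH(q + bw) v`.
  have hχ : HasDerivAt (fun a : ℝ =>
      (H (q + a • v + b • w) - H (q + a • v)) - (H (q + b • w) - H q) - (a * b) • h' v)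
      (fderiv ℝ H (q + b • w) v - fderiv ℝ H q v - b • h' v) 0 := by
    have e1 : HasDerivAt (fun a : ℝ => q + a • v + b • w) v 0 := by
      simpa using (((hasDerivAt_id (0 : ℝ)).smul_const v).const_add q).add_const (b • w)
    have e2 : HasDerivAt (fun a : ℝ => q + a • v) v 0 := by
      simpa using ((hasDerivAt_id (0 : ℝ)).smul_const v).const_add q
    have e3 : HasDerivAt (fun a : ℝ => (a * b) • h' v) (b • h' v) 0 := by
      simpa using ((hasDerivAt_id (0 : ℝ)).mul_const b).smul_const (h' v)
    have d1 : HasFDerivAt H (fderiv ℝ H (q + b • w)) (q + (0 : ℝ) • v + b • w) := by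
      have := (hH.differentiableAt (hΘ.mem_nhds hq0)).hasFDerivAt
      simpa using this
    have d2 : HasFDerivAt H (fderiv ℝ H q) (q + (0 : ℝ) • v) := by
      simpa using (hH.differentiableAt (hΘ.mem_nhds hq)).hasFDerivAt
    exact (((d1.comp_hasDerivAt 0 e1).sub (d2.comp_hasDerivAt 0 e2)).sub_const _).sub e3
  have := hχ.le_of_lip' (C := ε * ‖b‖) (by positivity) (by
    filter_upwards [Metric.ball_mem_nhds (0 : ℝ) hδ₂] with a ha
    simpa using key a ha)
  simpa using this

/-- A linear differential inequality on a short time interval. -/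
theorem norm_sub_le_of_norm_deriv_le_mul {E : Type*} [NormedAddCommGroup E] [NormedSpace ℝ E]
    {y y' : ℝ → E} {κ : ℝ} (hκ : 0 ≤ κ) (hκ' : κ ≤ 1 / 2)
    (hy : ∀ s ∈ Icc (0 : ℝ) 1, HasDerivAt y (y' s) s)
    (hb : ∀ s ∈ Icc (0 : ℝ) 1, ‖y' s‖ ≤ κ * ‖y s‖) : ‖y 1 - y 0‖ ≤ 2 * κ * ‖y 0‖ := by
  have hc : ContinuousOn (fun s => ‖y s‖) (Icc (0 : ℝ) 1) :=
    fun s hs => (hy s hs).continuousAt.continuousWithinAt.norm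
  -- At a maximum point `‖y s₀‖ ≤ ‖y 0‖ + κ ‖y s₀‖`, so `κ ≤ 1/2` gives `‖y s₀‖ ≤ 2 ‖y 0‖`. This
  -- replaces Grönwall's exponential.
  obtain ⟨s₀, hs₀, hmax⟩ := isCompact_Icc.exists_isMaxOn (nonempty_Icc.2 zero_le_one) hc
  have hmax' : ∀ s ∈ Icc (0 : ℝ) 1, ‖y s‖ ≤ ‖y s₀‖ := fun s hs => hmax hs
  have hmv := norm_image_sub_le_of_norm_deriv_le_segment' (f' := y') (C := κ * ‖y s₀‖)
    (fun s hs => (hy s hs).hasDerivWithinAt)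
    (fun s hs => (hb s (Ico_subset_Icc_self hs)).trans
      (mul_le_mul_of_nonneg_left (hmax' s (Ico_subset_Icc_self hs)) hκ))
  have h1 := hmv s₀ hs₀
  have h2 := hmv 1 (right_mem_Icc.2 zero_le_one)
  have h3 : ‖y s₀‖ ≤ ‖y 0‖ + ‖y s₀ - y 0‖ := by
    simpa using norm_add_le (y 0) (y s₀ - y 0)
  have h4 : κ * ‖y s₀‖ * (s₀ - 0) ≤ κ * ‖y s₀‖ := by
    have := mul_le_mul_of_nonneg_left hs₀.2 (mul_nonneg hκ (norm_nonneg (y s₀)))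
    linarith
  have h5 : ‖y s₀‖ ≤ 2 * ‖y 0‖ := by nlinarith [norm_nonneg (y s₀), norm_nonneg (y 0)]
  nlinarith [norm_nonneg (y s₀), norm_nonneg (y 0)]

/-! ### Integrals over `[0, 1]` with a parameter -/

/-- Compactness of a closed ball times `[0, 1]` provides the constant dominating function for
continuity and differentiation under the integral. -/
theorem exists_bound_nhds {E F : Type*} [NormedAddCommGroup E] [NormedSpace ℝ E]
    [FiniteDimensional ℝ E] [NormedAddCommGroup F] {Θ : Set E} (hΘ : IsOpen Θ) {G : E → ℝ → F}
    (hG : ContinuousOn (fun z : E × ℝ => G z.1 z.2) (Θ ×ˢ Icc 0 1)) {x₀ : E} (hx₀ : x₀ ∈ Θ) :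
    ∃ C : ℝ, ∃ s ∈ 𝓝 x₀, s ⊆ Θ ∧ ∀ x ∈ s, ∀ τ ∈ Icc (0 : ℝ) 1, ‖G x τ‖ ≤ C := by
  have : ProperSpace E := FiniteDimensional.proper_real E
  obtain ⟨ρ, hρ, hρΘ⟩ := Metric.nhds_basis_closedBall.mem_iff.1 (hΘ.mem_nhds hx₀)
  have hcomp : IsCompact (Metric.closedBall x₀ ρ ×ˢ Icc (0 : ℝ) 1) :=
    (isCompact_closedBall x₀ ρ).prod isCompact_Icc
  obtain ⟨C, hC⟩ := hcomp.exists_bound_of_continuousOn (hG.mono (prod_mono hρΘ subset_rfl))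
  exact ⟨C, _, Metric.closedBall_mem_nhds x₀ hρ, hρΘ, fun x hx τ hτ => hC (x, τ) ⟨hx, hτ⟩⟩

theorem continuousOn_slice {E F : Type*} [TopologicalSpace E] [TopologicalSpace F]
    {Θ : Set E} {G : E → ℝ → F}
    (hG : ContinuousOn (fun z : E × ℝ => G z.1 z.2) (Θ ×ˢ Icc 0 1)) {x : E} (hx : x ∈ Θ) :
    ContinuousOn (G x) (Icc 0 1) :=
  hG.comp (f := fun τ : ℝ => (x, τ)) (by fun_prop) fun _ hτ => ⟨hx, hτ⟩

theorem aestronglyMeasurable_slice {E F : Type*} [TopologicalSpace E]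
    [NormedAddCommGroup F] {Θ : Set E} {G : E → ℝ → F}
    (hG : ContinuousOn (fun z : E × ℝ => G z.1 z.2) (Θ ×ˢ Icc 0 1)) {x : E} (hx : x ∈ Θ) :
    AEStronglyMeasurable (G x) (volume.restrict (uIoc (0 : ℝ) 1)) := by
  rw [uIoc_of_le zero_le_one]
  exact ((continuousOn_slice hG hx).mono Ioc_subset_Icc_self).aestronglyMeasurable
    measurableSet_Ioc

theorem continuousOn_integral_param {E F : Type*} [NormedAddCommGroup E] [NormedSpace ℝ E]
    [FiniteDimensional ℝ E] [NormedAddCommGroup F] [NormedSpace ℝ F] {Θ : Set E}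
    (hΘ : IsOpen Θ) {G : E → ℝ → F}
    (hG : ContinuousOn (fun z : E × ℝ => G z.1 z.2) (Θ ×ˢ Icc 0 1)) :
    ContinuousOn (fun x => ∫ τ in (0 : ℝ)..1, G x τ) Θ := by
  intro x₀ hx₀
  obtain ⟨C, s, hs, hsΘ, hC⟩ := exists_bound_nhds hΘ hG hx₀
  apply ContinuousAt.continuousWithinAt
  apply intervalIntegral.continuousAt_of_dominated_interval (bound := fun _ => C)
  · filter_upwards [hs] with x hx
    exact aestronglyMeasurable_slice hG (hsΘ hx)
  · filter_upwards [hs] with x hx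
    refine Eventually.of_forall fun τ hτ => hC x hx τ ?_
    rw [uIoc_of_le zero_le_one] at hτ
    exact Ioc_subset_Icc_self hτ
  · simp
  · refine Eventually.of_forall fun τ hτ => ?_
    rw [uIoc_of_le zero_le_one] at hτ
    exact (hG.comp (f := fun x : E => (x, τ)) (by fun_prop)
      (fun x hx => ⟨hx, Ioc_subset_Icc_self hτ⟩)).continuousAt (hΘ.mem_nhds hx₀)

theorem hasFDerivAt_integral_param {E F : Type*} [NormedAddCommGroup E] [NormedSpace ℝ E]
    [FiniteDimensional ℝ E] [NormedAddCommGroup F] [NormedSpace ℝ F] {Θ : Set E}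
    (hΘ : IsOpen Θ) {G : E → ℝ → F} {G' : E → ℝ → E →L[ℝ] F}
    (hG : ContinuousOn (fun z : E × ℝ => G z.1 z.2) (Θ ×ˢ Icc 0 1))
    (hG' : ContinuousOn (fun z : E × ℝ => G' z.1 z.2) (Θ ×ˢ Icc 0 1))
    (hd : ∀ x ∈ Θ, ∀ τ ∈ Icc (0 : ℝ) 1, HasFDerivAt (fun x => G x τ) (G' x τ) x)
    {x₀ : E} (hx₀ : x₀ ∈ Θ) :
    HasFDerivAt (fun x => ∫ τ in (0 : ℝ)..1, G x τ) (∫ τ in (0 : ℝ)..1, G' x₀ τ) x₀ := by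
  obtain ⟨C, s, hs, hsΘ, hC⟩ := exists_bound_nhds hΘ hG' hx₀
  have hI : ∀ τ ∈ uIoc (0 : ℝ) 1, τ ∈ Icc (0 : ℝ) 1 := by
    intro τ hτ
    rw [uIoc_of_le zero_le_one] at hτ
    exact Ioc_subset_Icc_self hτ
  apply intervalIntegral.hasFDerivAt_integral_of_dominated_of_fderiv_le (bound := fun _ => C) hs
  · filter_upwards [hs] with x hx
    exact aestronglyMeasurable_slice hG (hsΘ hx)
  · apply ContinuousOn.intervalIntegrable
    rw [uIcc_of_le zero_le_one]
    exact continuousOn_slice hG hx₀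
  · exact aestronglyMeasurable_slice hG' hx₀
  · exact Eventually.of_forall fun τ hτ x hx => hC x hx τ (hI τ hτ)
  · simp
  · exact Eventually.of_forall fun τ hτ x hx => hd x (hsΘ hx) τ (hI τ hτ)

/-! ### Paths in the parameter space -/

section Params

variable {n p : ℕ}

/-- The unit vector in the direction of the `j`-th flow time. -/
def axis (n : ℕ) {p : ℕ} (j : Fin p) : Params n p := (Pi.single j 1, 0)

/-- The `j`-th flow time, as a linear functional. -/
noncomputable def coord (n : ℕ) {p : ℕ} (j : Fin p) : Params n p →L[ℝ] ℝ :=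
  (ContinuousLinearMap.proj j).comp (ContinuousLinearMap.fst ℝ (Fin p → ℝ) (Fin (n - p) → ℝ))

@[simp] theorem coord_apply (j : Fin p) (t : Params n p) : coord n j t = t.1 j := rfl

/-- `t ↦ vertex t j` as a continuous linear map. -/
noncomputable def vertexMap (n : ℕ) {p : ℕ} (j : ℕ) : Params n p →L[ℝ] Params n p :=
  LinearMap.toContinuousLinearMap
    { toFun := fun t => vertex t j
      map_add' := fun t t' => by
        refine Prod.ext (funext fun l => ?_) rfl
        by_cases h : (l : ℕ) < j <;> simp [vertex, h]
      map_smul' := fun c t => by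
        refine Prod.ext (funext fun l => ?_) rfl
        by_cases h : (l : ℕ) < j <;> simp [vertex, h] }

@[simp] theorem vertexMap_apply (j : ℕ) (t : Params n p) : vertexMap n j t = vertex t j := rfl

/-- `seg n j s t = (t_1, …, t_{j-1}, s t_j, 0, …, 0; t_{p+1}, …, t_n)` runs from `vertex t j` to
`vertex t (j + 1)` as `s` runs through `[0, 1]`. -/
noncomputable def seg (n : ℕ) {p : ℕ} (j : Fin p) (s : ℝ) : Params n p →L[ℝ] Params n p :=
  vertexMap n j + s • (coord n j).smulRight (axis n j)

theorem seg_apply (j : Fin p) (s : ℝ) (t : Params n p) :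
    seg n j s t = vertex t j + (s * t.1 j) • axis n j := by
  simp [seg, smul_smul]

theorem seg_eq_add (j : Fin p) (s s₀ : ℝ) (t : Params n p) :
    seg n j s t = seg n j s₀ t + (s - s₀) • (t.1 j • axis n j) := by
  rw [seg_apply, seg_apply, smul_smul, add_assoc, ← add_smul]
  ring_nf

theorem seg_zero (j : Fin p) (t : Params n p) : seg n j 0 t = vertex t j := by
  simp [seg_apply]

theorem seg_snd (j : Fin p) (s : ℝ) (t : Params n p) : (seg n j s t).2 = t.2 := by
  simp [seg_apply, axis, vertex]

theorem seg_fst (j : Fin p) (s : ℝ) (t : Params n p) (l : Fin p) :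
    (seg n j s t).1 l = if l < j then t.1 l else if l = j then s * t.1 j else 0 := by
  rcases lt_trichotomy l j with h | h | h
  · simp [seg_apply, axis, vertex, h, h.ne]
  · subst h; simp [seg_apply, axis, vertex]
  · simp [seg_apply, axis, vertex, not_lt.2 h.le, h.ne']

theorem seg_fst_of_gt {j l : Fin p} (h : j < l) (s : ℝ) (t : Params n p) :
    (seg n j s t).1 l = 0 := by
  simp [seg_fst, not_lt.2 h.le, h.ne']

theorem seg_one (j : Fin p) (t : Params n p) : seg n j 1 t = vertex t (j + 1) := by
  refine Prod.ext (funext fun l => ?_) (by simp [seg_snd, vertex])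
  rw [seg_fst]
  rcases lt_trichotomy l j with h | h | h
  · simp only [vertex, if_pos h, if_pos (Nat.lt_succ_of_lt (Fin.lt_def.1 h))]
  · subst h; simp [vertex]
  · have : ¬ (l : ℕ) < j + 1 := by have := Fin.lt_def.1 h; omega
    simp only [vertex, if_neg this, if_neg (not_lt.2 h.le), if_neg h.ne']

theorem vertex_eq_self {t : Params n p} {j : ℕ} (h : ∀ l : Fin p, j ≤ l → t.1 l = 0) :
    vertex t j = t := by
  refine Prod.ext (funext fun l => ?_) rfl
  by_cases hl : (l : ℕ) < j
  · simp [vertex, hl]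
  · simp [vertex, hl, h l (not_lt.1 hl)]

theorem vertex_last (t : Params n p) : vertex t p = t :=
  vertex_eq_self fun l hl => absurd l.2 (not_lt.2 hl)

theorem vertex_fst_of_le (t : Params n p) {j : ℕ} {l : Fin p} (h : j ≤ l) :
    (vertex t j).1 l = 0 := by
  simp [vertex, not_lt.2 h]

theorem vertex_zero_fst (t : Params n p) : (vertex t 0).1 = 0 := by
  ext l; simp [vertex]

theorem vertex_seg (j : Fin p) (s : ℝ) (t : Params n p) :
    vertex (seg n j s t) (j + 1) = seg n j s t :=
  vertex_eq_self fun l hl => seg_fst_of_gt (Fin.lt_def.2 (by omega)) s t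

theorem seg_one_of_eq_zero {j : Fin p} {t : Params n p} (h : ∀ l, j < l → t.1 l = 0) :
    seg n j 1 t = t := by
  rw [seg_one]
  exact vertex_eq_self fun l hl => h l (Fin.lt_def.2 (by omega))

theorem seg_axis_self (j : Fin p) (s : ℝ) : seg n j s (axis n j) = s • axis n j := by
  rw [seg_apply]
  have : vertex (axis n j) j = 0 := by
    refine Prod.ext (funext fun l => ?_) rfl
    by_cases h : (l : ℕ) < j
    · simp [vertex, axis, (Fin.lt_def.2 h).ne]
    · simp only [vertex, if_neg h]; rfl
  rw [this]
  simp [axis]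

/-- The `l`-th segment of the path depends on the flow times up to the `l`-th only, so a later flow
time does not move it. -/
theorem seg_axis_of_lt {l j : Fin p} (h : l < j) (s : ℝ) : seg n l s (axis n j) = 0 := by
  refine Prod.ext (funext fun k => ?_) (by simp [seg_snd, axis])
  rw [seg_fst]
  by_cases hk : k < l
  · simp [hk, axis, (hk.trans h).ne]
  · by_cases hk' : k = l
    · rw [if_neg hk, if_pos hk']
      simp [axis, h.ne]
    · simp [hk, hk']

/-- Specific to the max norm: each coordinate is kept, multiplied by `s` or erased. -/
theorem norm_seg_le (j : Fin p) {s : ℝ} (hs : s ∈ Icc (0 : ℝ) 1) : ‖seg n j s‖ ≤ 1 := by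
  refine ContinuousLinearMap.opNorm_le_bound _ zero_le_one fun t => ?_
  rw [one_mul, Prod.norm_def, seg_snd]
  refine max_le ((pi_norm_le_iff_of_nonneg (norm_nonneg _)).2 fun l => ?_) (norm_snd_le t)
  have hl : ‖t.1 l‖ ≤ ‖t‖ := (norm_le_pi_norm t.1 l).trans (norm_fst_le t)
  rw [seg_fst]
  split_ifs with h1 h2
  · exact hl
  · subst h2
    rw [norm_mul, Real.norm_of_nonneg hs.1]
    nlinarith [norm_nonneg (t.1 l), hs.2]
  · simp

theorem continuous_seg (j : Fin p) : Continuous fun s : ℝ => seg n j s := by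
  unfold seg; fun_prop

theorem hasDerivAt_seg (j : Fin p) (t : Params n p) (s : ℝ) :
    HasDerivAt (fun s : ℝ => seg n j s t) (t.1 j • axis n j) s := by
  have h : (fun s : ℝ => seg n j s t) = fun s => vertex t j + s • (t.1 j • axis n j) := by
    ext1 s; rw [seg_apply, smul_smul]
  rw [h]
  simpa using ((hasDerivAt_id s).smul_const (t.1 j • axis n j)).const_add (vertex t j)

theorem IsAccessible.seg_mem {Θ : Set (Params n p)} (h : IsAccessible Θ) {t : Params n p}
    (ht : t ∈ Θ) (j : Fin p) {s : ℝ} (hs : s ∈ Icc (0 : ℝ) 1) : seg n j s t ∈ Θ := by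
  apply h.2.2 t ht j j.2
  rw [← seg_zero, ← seg_one, segment_eq_image']
  refine ⟨s, hs, ?_⟩
  simp only
  rw [seg_eq_add j s 0, seg_eq_add j 1 0 t]
  simp

theorem IsAccessible.vertex_mem {Θ : Set (Params n p)} (h : IsAccessible Θ) {t : Params n p}
    (ht : t ∈ Θ) {j : ℕ} (hj : j ≤ p) : vertex t j ∈ Θ := by
  rcases hj.eq_or_lt with rfl | hj
  · rwa [vertex_last]
  · have := h.seg_mem ht ⟨j, hj⟩ (left_mem_Icc.2 zero_le_one)
    rwa [seg_zero] at this

end Params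

/-! ### Charts adapted to a family of flows -/

/-- `ψ : Θ → D` is a `C¹` diffeomorphism with inverse `φ`, it restricts to `ξ` on the vectors with
vanishing flow times, and `∂ψ/∂t_j = X_j ∘ ψ` where the later flow times vanish. -/
structure AdaptedChart {n p : ℕ} (X : Fin p → (Fin n → ℝ) → (Fin n → ℝ))
    (U : Set (Fin (n - p) → ℝ)) (ξ : (Fin (n - p) → ℝ) → (Fin n → ℝ))
    (Θ : Set (Params n p)) (D : Set (Fin n → ℝ))
    (ψ : Params n p → (Fin n → ℝ)) (φ : (Fin n → ℝ) → Params n p) : Prop where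
  accessible : IsAccessible Θ
  isOpen_image : IsOpen D
  contDiffOn : ContDiffOn ℝ 1 ψ Θ
  mapsTo : MapsTo ψ Θ D
  contDiffOn_inv : ContDiffOn ℝ 1 φ D
  mapsTo_inv : MapsTo φ D Θ
  invOn : InvOn φ ψ Θ D
  base : ∀ t ∈ Θ, t.1 = 0 → t.2 ∈ U ∧ ψ t = ξ t.2
  flow : ∀ t ∈ Θ, ∀ j, (∀ l, j < l → t.1 l = 0) → fderiv ℝ ψ t (axis n j) = X j (ψ t)

section Flow

variable {n : ℕ} {Ω : Set (Fin n → ℝ)}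

theorem FlowsTo.eq_of_zero {v : (Fin n → ℝ) → (Fin n → ℝ)} {τ : ℝ} {x y : Fin n → ℝ}
    (h : FlowsTo Ω v τ x y) (hτ : τ = 0) : x = y := by
  obtain ⟨γ, h0, h1, -⟩ := h
  rw [← h0, ← h1, hτ]

theorem flowsTo_zero {v : (Fin n → ℝ) → (Fin n → ℝ)} {x : Fin n → ℝ} (hx : x ∈ Ω) :
    FlowsTo Ω v 0 x x := by
  refine ⟨fun _ => x, rfl, rfl, fun _ _ => hx, ?_⟩
  intro t ht
  rw [uIcc_self] at ht ⊢
  rw [mem_singleton_iff.1 ht]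
  -- Within the single point `uIcc 0 0` every vector is a derivative, so the constant curve
  -- qualifies whatever `v x` is.
  exact HasFDerivWithinAt.of_subsingleton subsingleton_singleton

theorem FlowsTo.unique (hΩ : IsOpen Ω) {v : (Fin n → ℝ) → (Fin n → ℝ)}
    (hv : ContDiffOn ℝ 1 v Ω) {τ : ℝ} {x y y' : Fin n → ℝ}
    (h : FlowsTo Ω v τ x y) (h' : FlowsTo Ω v τ x y') : y = y' := by
  obtain ⟨γ, h0, h1, h2, h3⟩ := h
  obtain ⟨γ', h0', h1', h2', h3'⟩ := h'
  rw [← h1, ← h1']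
  exact eqOn_of_isIntegralCurveOn hΩ hv (h0.trans h0'.symm) h2 h2' h3 h3' right_mem_uIcc

theorem IsFlowImage.unique (hΩ : IsOpen Ω) {r : Fin n → (Fin n → ℝ) → (Fin n → ℝ)}
    (hr : ∀ i, ContDiffOn ℝ 1 (r i) Ω) {I : Finset (Fin n)} {U : Set (Fin (n - I.card) → ℝ)}
    {ξ : (Fin (n - I.card) → ℝ) → (Fin n → ℝ)} {t : Params n I.card} {y y' : Fin n → ℝ}
    (h : IsFlowImage Ω r I U ξ t y) (h' : IsFlowImage Ω r I U ξ t y') : y = y' := by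
  obtain ⟨-, z, h0, h1, h2⟩ := h
  obtain ⟨-, z', h0', h1', h2'⟩ := h'
  have : ∀ j, z j = z' j := by
    intro j
    induction j using Fin.induction with
    | zero => rw [h0, h0']
    | succ j ih =>
      have h := h1 j
      rw [ih] at h
      exact h.unique hΩ (hr _) (h1' j)
  rw [← h2, ← h2', this]

/-- The point that is reached does not change after the last non-zero flow time. -/
theorem eq_of_flowsTo_of_eq_zero {p : ℕ} {v : Fin p → (Fin n → ℝ) → (Fin n → ℝ)}
    {τ : Fin p → ℝ} {z : Fin (p + 1) → (Fin n → ℝ)}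
    (hz : ∀ j : Fin p, FlowsTo Ω (v j) (τ j) (z j.castSucc) (z j.succ)) {k : Fin (p + 1)}
    (hτ : ∀ l : Fin p, (k : ℕ) ≤ l → τ l = 0) : ∀ j, k ≤ j → z j = z k := by
  intro j
  induction j using Fin.induction with
  | zero => intro h; rw [Fin.le_zero_iff.1 h]
  | succ j ih =>
    intro h
    rcases h.eq_or_lt with h | h
    · rw [h]
    · have hk : k ≤ j.castSucc := Fin.le_castSucc_iff.2 h
      rw [← ih hk]
      exact ((hz j).eq_of_zero (hτ j (by simpa [Fin.le_def] using hk))).symm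

theorem isFlowImage_base {r : Fin n → (Fin n → ℝ) → (Fin n → ℝ)} {I : Finset (Fin n)}
    {U : Set (Fin (n - I.card) → ℝ)} {ξ : (Fin (n - I.card) → ℝ) → (Fin n → ℝ)}
    {t : Params n I.card} {y : Fin n → ℝ} (h : IsFlowImage Ω r I U ξ t y) (ht : t.1 = 0) :
    t.2 ∈ U ∧ y = ξ t.2 := by
  obtain ⟨hU, z, h0, h1, h2⟩ := h
  refine ⟨hU, ?_⟩
  rw [← h2, ← h0]
  exact eq_of_flowsTo_of_eq_zero h1 (k := 0) (fun l _ => by simp [ht]) _ (Fin.zero_le _)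

/-- By uniqueness of flows, `ψ` follows the integral curve of the `j`-th field along the segment,
reparametrized by `s ↦ s t_j`. The chain rule gives the claim multiplied by `t_j`, hence the
assumption that `t_j` is non-zero. -/
theorem fderiv_flowImage (hΩ : IsOpen Ω) {r : Fin n → (Fin n → ℝ) → (Fin n → ℝ)}
    (hr : ∀ i, ContDiffOn ℝ 1 (r i) Ω) {I : Finset (Fin n)} {U : Set (Fin (n - I.card) → ℝ)}
    {ξ : (Fin (n - I.card) → ℝ) → (Fin n → ℝ)} {Θ : Set (Params n I.card)}
    (hΘ : IsAccessible Θ) {ψ : Params n I.card → (Fin n → ℝ)} (hψ : ContDiffOn ℝ 1 ψ Θ)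
    (h : ∀ t ∈ Θ, IsFlowImage Ω r I U ξ t (ψ t)) {t : Params n I.card} (ht : t ∈ Θ)
    {j : Fin I.card} (hj : ∀ l, j < l → t.1 l = 0) (hj0 : t.1 j ≠ 0) :
    ψ t ∈ Ω ∧ fderiv ℝ ψ t (axis n j) = r (I.orderEmbOfFin rfl j) (ψ t) := by
  obtain ⟨hU, z, h0, h1, h2⟩ := h t ht
  have hlast : ∀ l, j.succ ≤ l → z l = z j.succ :=
    eq_of_flowsTo_of_eq_zero h1 fun l hl => hj l (Fin.lt_def.2 (by simpa using hl))
  obtain ⟨γ, γ0, γ1, γΩ, γd⟩ := h1 j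
  have hγψ : ∀ s ∈ Icc (0 : ℝ) 1, ψ (seg n j s t) = γ (s * t.1 j) := by
    intro s hs
    have hmem := hΘ.seg_mem ht j hs
    refine (h _ hmem).unique hΩ hr ⟨by rwa [seg_snd], ?_⟩
    have hsub : uIcc 0 (s * t.1 j) ⊆ uIcc 0 (t.1 j) := by
      apply uIcc_subset_uIcc left_mem_uIcc
      rcases le_total 0 (t.1 j) with h | h
      · rw [uIcc_of_le h]
        exact ⟨mul_nonneg hs.1 h, mul_le_of_le_one_left h hs.2⟩
      · rw [uIcc_of_ge h]
        exact ⟨by nlinarith [hs.2], mul_nonpos_of_nonneg_of_nonpos hs.1 h⟩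
    -- The first flows are those of `t`, the `j`-th is stopped at time `s t_j`, and the later ones
    -- have time zero and stay there.
    refine ⟨fun l => if l ≤ j.castSucc then z l else γ (s * t.1 j), ?_, ?_, ?_⟩
    · simp [seg_snd, h0]
    · intro l
      rw [seg_fst]
      rcases lt_trichotomy l j with hl | hl | hl
      · have e1 : l.castSucc ≤ j.castSucc := Fin.castSucc_le_castSucc_iff.2 hl.le
        have e2 : l.succ ≤ j.castSucc := by
          rw [Fin.le_def]; simpa using Fin.lt_def.1 hl
        simp only [e1, e2, if_true, hl]
        exact h1 l
      · subst hl
        have e2 : ¬ l.succ ≤ l.castSucc := by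
          rw [Fin.le_def]; simp
        simp only [le_refl, e2, if_true, if_false, lt_irrefl]
        exact ⟨γ, γ0, rfl, γΩ.mono_left hsub, γd.mono hsub⟩
      · have e1 : ¬ l.castSucc ≤ j.castSucc := by
          rw [Fin.castSucc_le_castSucc_iff]; exact not_le.2 hl
        have e2 : ¬ l.succ ≤ j.castSucc := by
          have := Fin.lt_def.1 hl
          rw [Fin.le_def]; simp; omega
        simp only [e1, e2, if_false, not_lt.2 hl.le, hl.ne']
        exact flowsTo_zero (γΩ (hsub right_mem_uIcc))
    · have : ¬ Fin.last I.card ≤ j.castSucc := by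
        rw [Fin.le_def]; simp
      simp [this]
  have ht1 : seg n j 1 t = t := seg_one_of_eq_zero hj
  have hψt : ψ t = γ (t.1 j) := by
    have := hγψ 1 (right_mem_Icc.2 zero_le_one)
    rwa [ht1, one_mul] at this
  refine ⟨hψt ▸ γΩ right_mem_uIcc, ?_⟩
  -- The integral curve is available only on `uIcc 0 (t.1 j)`, so the two derivatives at the end
  -- point `s = 1` are compared within `[0, 1]`.
  have d1 : HasDerivWithinAt (fun s : ℝ => ψ (seg n j s t)) (fderiv ℝ ψ t (t.1 j • axis n j))
      (Icc 0 1) 1 := by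
    have hd : HasFDerivAt ψ (fderiv ℝ ψ t) (seg n j 1 t) := by
      rw [ht1]
      exact ((hψ.differentiableOn one_ne_zero).differentiableAt (hΘ.1.mem_nhds ht)).hasFDerivAt
    exact (hd.comp_hasDerivAt (1 : ℝ) (hasDerivAt_seg j t 1)).hasDerivWithinAt
  have d2 : HasDerivWithinAt (fun s : ℝ => γ (s * t.1 j))
      (t.1 j • r (I.orderEmbOfFin rfl j) (ψ t)) (Icc 0 1) 1 := by
    have hγ := γd (1 * t.1 j) (by simp)
    have hm : HasDerivWithinAt (fun s : ℝ => s * t.1 j) (t.1 j) (Icc 0 1) 1 := by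
      simpa using ((hasDerivAt_id (1 : ℝ)).mul_const (t.1 j)).hasDerivWithinAt
    have := HasDerivWithinAt.scomp (1 : ℝ) hγ hm (by
      intro s hs
      rcases le_total 0 (t.1 j) with h | h
      · rw [uIcc_of_le h]
        exact ⟨mul_nonneg hs.1 h, mul_le_of_le_one_left h hs.2⟩
      · rw [uIcc_of_ge h]
        exact ⟨by nlinarith [hs.2], mul_nonpos_of_nonneg_of_nonpos hs.1 h⟩)
    rw [one_mul, ← hψt] at this
    exact this
  have d3 := d2.congr (fun s hs => hγψ s hs) (hγψ 1 (right_mem_Icc.2 zero_le_one))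
  have hu := (uniqueDiffOn_Icc (zero_lt_one' ℝ)) 1 (right_mem_Icc.2 zero_le_one)
  have := hu.eq_deriv _ d1 d3
  rw [map_smul] at this
  exact smul_right_injective _ hj0 this

/-- The parametrization by flows is an adapted chart. -/
theorem adaptedChart_of_isFlowImage (hΩ : IsOpen Ω)
    {r : Fin n → (Fin n → ℝ) → (Fin n → ℝ)} (hr : ∀ i, ContDiffOn ℝ 1 (r i) Ω)
    {I : Finset (Fin n)} {U : Set (Fin (n - I.card) → ℝ)}
    {ξ : (Fin (n - I.card) → ℝ) → (Fin n → ℝ)} {Θ : Set (Params n I.card)}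
    (hΘ : IsAccessible Θ) {ψ : Params n I.card → (Fin n → ℝ)} {D : Set (Fin n → ℝ)}
    (hD : IsOpen D) (hDΩ : D ⊆ Ω) (h : ∀ t ∈ Θ, IsFlowImage Ω r I U ξ t (ψ t))
    (hψ : IsC1Diffeo ψ Θ D) :
    ∃ φ, AdaptedChart (fun j => r (I.orderEmbOfFin rfl j)) U ξ Θ D ψ φ := by
  obtain ⟨h1, h2, φ, h3, h4, h5⟩ := hψ
  refine ⟨φ, hΘ, hD, h1, h2, h3, h4, h5, fun t ht h0 => isFlowImage_base (h t ht) h0, ?_⟩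
  intro t ht j hj
  -- When `t_j = 0` both sides are limits of their values at `t + s e_j`, `s ≠ 0`, where the other
  -- case applies.
  by_cases hj0 : t.1 j = 0
  · have hc1 : ContinuousAt (fun s : ℝ => fderiv ℝ ψ (t + s • axis n j) (axis n j)) 0 := by
      have hf : ContinuousAt (fderiv ℝ ψ) (t + (0 : ℝ) • axis n j) := by
        simpa using (h1.continuousOn_fderiv_of_isOpen hΘ.1 le_rfl).continuousAt (hΘ.1.mem_nhds ht)
      have hl : ContinuousAt (fun s : ℝ => t + s • axis n j) 0 := by fun_prop
      exact (ContinuousAt.comp (f := fun s : ℝ => t + s • axis n j) hf hl).clm_apply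
        continuousAt_const
    have hc2 : ContinuousAt (fun s : ℝ => r (I.orderEmbOfFin rfl j) (ψ (t + s • axis n j))) 0 := by
      have hl : ContinuousAt (fun s : ℝ => t + s • axis n j) 0 := by fun_prop
      have hf : ContinuousAt ψ (t + (0 : ℝ) • axis n j) := by
        simpa using h1.continuousOn.continuousAt (hΘ.1.mem_nhds ht)
      have hg : ContinuousAt (r (I.orderEmbOfFin rfl j)) (ψ (t + (0 : ℝ) • axis n j)) := by
        simpa using (hr _).continuousOn.continuousAt (hΩ.mem_nhds (hDΩ (h2 ht)))
      exact ContinuousAt.comp (f := fun s : ℝ => ψ (t + s • axis n j)) hg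
        (ContinuousAt.comp (f := fun s : ℝ => t + s • axis n j) hf hl)
    have hev : ∀ᶠ s : ℝ in 𝓝[≠] 0, fderiv ℝ ψ (t + s • axis n j) (axis n j)
        = r (I.orderEmbOfFin rfl j) (ψ (t + s • axis n j)) := by
      have hl : ContinuousAt (fun s : ℝ => t + s • axis n j) 0 := by fun_prop
      have hmem : ∀ᶠ s : ℝ in 𝓝 0, t + s • axis n j ∈ Θ :=
        hl.eventually_mem (by simpa using hΘ.1.mem_nhds ht)
      filter_upwards [nhdsWithin_le_nhds hmem, self_mem_nhdsWithin] with s hs hs0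
      refine (fderiv_flowImage hΩ hr hΘ h1 h hs (j := j) (fun l hl => ?_) ?_).2
      · simp [axis, hj l hl, hl.ne']
      · simpa [axis, hj0] using hs0
    have l1 := hc1.tendsto.mono_left (nhdsWithin_le_nhds (s := {0}ᶜ))
    have l2 := hc2.tendsto.mono_left (nhdsWithin_le_nhds (s := {0}ᶜ))
    have := tendsto_nhds_unique_of_eventuallyEq l1 l2 hev
    simpa using this
  · exact (fderiv_flowImage hΩ hr hΘ h1 h ht hj hj0).2

end Flow

/-! ### Small adapted charts -/

section Small

variable {n p : ℕ}

theorem params_eq_sum (t : Params n p) :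
    t = ∑ j, t.1 j • axis n j + ((0 : Fin p → ℝ), t.2) := by
  refine Prod.ext (funext fun l => ?_) ?_
  · simp [axis, Prod.fst_sum, Finset.sum_apply, Pi.single_apply]
  · simp [axis, Prod.snd_sum]

theorem opNorm_params_le {F : Type*} [NormedAddCommGroup F] [NormedSpace ℝ F]
    (A : Params n p →L[ℝ] F) {c : ℝ} (hc : 0 ≤ c) (h1 : ∀ j, ‖A (axis n j)‖ ≤ c)
    (h2 : ∀ b : Fin (n - p) → ℝ, ‖A ((0 : Fin p → ℝ), b)‖ ≤ c * ‖b‖) : ‖A‖ ≤ (p + 1) * c := by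
  refine A.opNorm_le_bound (by positivity) fun t => ?_
  conv_lhs => rw [params_eq_sum t]
  rw [map_add, map_sum]
  have hb : ‖t.2‖ ≤ ‖t‖ := norm_snd_le t
  have h3 : ‖∑ j, A (t.1 j • axis n j)‖ ≤ ∑ _j : Fin p, c * ‖t‖ := by
    refine norm_sum_le_of_le _ fun j _ => ?_
    rw [map_smul, norm_smul, mul_comm]
    have : ‖t.1 j‖ ≤ ‖t‖ := (norm_le_pi_norm t.1 j).trans (norm_fst_le t)
    exact mul_le_mul (h1 j) this (norm_nonneg _) hc
  simp only [Finset.sum_const, Finset.card_univ, Fintype.card_fin, nsmul_eq_mul] at h3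
  calc _ ≤ p * (c * ‖t‖) + c * ‖t‖ :=
        (norm_add_le _ _).trans (add_le_add h3 ((h2 t.2).trans (by gcongr)))
    _ = _ := by ring

/-- Smallness of the image is handled throughout as a property of all small radii, so that finitely
many requirements can simply be intersected. -/
theorem eventually_forall_mem_ball {E : Type*} [PseudoMetricSpace E] {x : E} {P : E → Prop}
    (h : ∀ᶠ y in 𝓝 x, P y) : ∀ᶠ ε in 𝓝[>] (0 : ℝ), ∀ y ∈ Metric.ball x ε, P y := by
  obtain ⟨ε₀, hε₀, h⟩ := Metric.eventually_nhds_iff_ball.1 h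
  filter_upwards [Ioo_mem_nhdsGT hε₀] with ε hε y hy
  exact h y (Metric.ball_subset_ball hε.2.le hy)

theorem exists_pos_le_of_continuousAt {f : ℝ → ℝ} (hf : ContinuousAt f 0) {δ : ℝ}
    (h : f 0 < δ) : ∃ η > 0, f η ≤ δ := by
  have hev : ∀ᶠ η in 𝓝[>] (0 : ℝ), f η < δ :=
    nhdsWithin_le_nhds (hf.eventually_lt continuousAt_const h)
  obtain ⟨η, h1, h2⟩ := (hev.and self_mem_nhdsWithin).exists
  exact ⟨η, h2, h1.le⟩

/-- Along the `j`-th segment the derivative of `H` in a direction tangent to the slice changes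
at the rate given by the derivative of `h = ∂H/∂t_j`. -/
theorem hasDerivAt_fderiv_seg {F : Type*} [NormedAddCommGroup F] [NormedSpace ℝ F]
    {Θ : Set (Params n p)} (hΘ : IsAccessible Θ) {H h : Params n p → F}
    (hH : DifferentiableOn ℝ H Θ) (hh : ContDiffOn ℝ 1 h Θ) {j : Fin p}
    (hw : ∀ t ∈ Θ, (∀ l, j < l → t.1 l = 0) → fderiv ℝ H t (axis n j) = h t)
    {v : Params n p} (hv : ∀ l, j < l → v.1 l = 0) {t : Params n p} (ht : t ∈ Θ) {s : ℝ}
    (hs : s ∈ Icc (0 : ℝ) 1) :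
    HasDerivAt (fun s => fderiv ℝ H (seg n j s t) v) (t.1 j • fderiv ℝ h (seg n j s t) v) s := by
  have hq := hΘ.seg_mem ht j hs
  have hstrict : HasStrictFDerivAt (fun y => t.1 j • h y) (t.1 j • fderiv ℝ h (seg n j s t))
      (seg n j s t) :=
    ((hh.contDiffAt (hΘ.1.mem_nhds hq)).hasStrictFDerivAt one_ne_zero).const_smul _
  -- As `v` has no components beyond `j`, the plane through the point spanned by `v` and the `j`-th
  -- axis stays in the slice on which `∂H/∂t_j = h` is known.
  have key := hasDerivAt_fderiv_apply (w := t.1 j • axis n j) (v := v) hΘ.1 hq hH hstrict (by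
    intro a b hab
    rw [map_smul, hw _ hab]
    intro l hl
    simp [seg_fst_of_gt hl, hv l hl, axis, hl.ne'])
  rw [← sub_self s] at key
  have := HasDerivAt.comp_sub_const s s key
  refine (this.congr_of_eventuallyEq (Eventually.of_forall fun σ => ?_))
  simp only
  rw [seg_eq_add j σ s t]

/-- The derivative at the origin of a chart adapted to the vector fields `X_j` and to `ξ`. -/
noncomputable def baseMap (X : Fin p → (Fin n → ℝ) → (Fin n → ℝ))
    (ξ : (Fin (n - p) → ℝ) → (Fin n → ℝ)) (xbar : Fin n → ℝ) : Params n p →L[ℝ] (Fin n → ℝ) :=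
  ∑ j, (coord n j).smulRight (X j xbar)
    + (fderiv ℝ ξ 0).comp (ContinuousLinearMap.snd ℝ (Fin p → ℝ) (Fin (n - p) → ℝ))

theorem baseMap_apply (X : Fin p → (Fin n → ℝ) → (Fin n → ℝ))
    (ξ : (Fin (n - p) → ℝ) → (Fin n → ℝ)) (xbar : Fin n → ℝ) (t : Params n p) :
    baseMap X ξ xbar t = ∑ j, t.1 j • X j xbar + fderiv ℝ ξ 0 t.2 := by
  simp [baseMap]

theorem baseMap_axis (X : Fin p → (Fin n → ℝ) → (Fin n → ℝ))
    (ξ : (Fin (n - p) → ℝ) → (Fin n → ℝ)) (xbar : Fin n → ℝ) (k : Fin p) :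
    baseMap X ξ xbar (axis n k) = X k xbar := by
  simp [baseMap_apply, axis, Pi.single_apply]

variable {X : Fin p → (Fin n → ℝ) → (Fin n → ℝ)} {U : Set (Fin (n - p) → ℝ)}
  {ξ : (Fin (n - p) → ℝ) → (Fin n → ℝ)} {Θ : Set (Params n p)} {D Ω Ξ : Set (Fin n → ℝ)}
  {ψ : Params n p → (Fin n → ℝ)} {φ : (Fin n → ℝ) → Params n p} {xbar : Fin n → ℝ}

theorem AdaptedChart.differentiableAt (h : AdaptedChart X U ξ Θ D ψ φ) {t : Params n p}
    (ht : t ∈ Θ) : DifferentiableAt ℝ ψ t :=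
  (h.contDiffOn.differentiableOn one_ne_zero).differentiableAt (h.accessible.1.mem_nhds ht)

theorem AdaptedChart.hasDerivAt_seg (h : AdaptedChart X U ξ Θ D ψ φ) {t : Params n p}
    (ht : t ∈ Θ) (j : Fin p) {s : ℝ} (hs : s ∈ Icc (0 : ℝ) 1) :
    HasDerivAt (fun s => ψ (seg n j s t)) (t.1 j • X j (ψ (seg n j s t))) s := by
  have hm := h.accessible.seg_mem ht j hs
  have := (h.differentiableAt hm).hasFDerivAt.comp_hasDerivAt s (Darboux.hasDerivAt_seg j t s)
  rwa [map_smul, h.flow _ hm j fun l hl => seg_fst_of_gt hl s t] at this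

theorem AdaptedChart.base_mem (h : AdaptedChart X U ξ Θ D ψ φ) {t : Params n p} (ht : t ∈ Θ) :
    t.2 ∈ U ∧ ψ (vertex t 0) = ξ t.2 :=
  h.base (vertex t 0) (h.accessible.vertex_mem ht (Nat.zero_le p)) (vertex_zero_fst t)

/-- The velocity along the segment is `t_j X_j`, hence nearly `t_j c`. No bound on `t` enters, so
this can be used to derive one. -/
theorem AdaptedChart.norm_displacement_le (h : AdaptedChart X U ξ Θ D ψ φ) {j : Fin p} {η : ℝ}
    {c : Fin n → ℝ} (hX : ∀ x ∈ D, ‖X j x - c‖ ≤ η) {t : Params n p} (ht : t ∈ Θ) :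
    ‖ψ (vertex t (j + 1)) - ψ (vertex t j) - t.1 j • c‖ ≤ η * ‖t.1 j‖ := by
  have hd : ∀ s ∈ Icc (0 : ℝ) 1, HasDerivWithinAt (fun s : ℝ => ψ (seg n j s t) - s • (t.1 j • c))
      (t.1 j • X j (ψ (seg n j s t)) - t.1 j • c) (Icc 0 1) s := by
    intro s hs
    have h2 : HasDerivAt (fun s : ℝ => s • (t.1 j • c)) (t.1 j • c) s := by
      simpa using (hasDerivAt_id s).smul_const (t.1 j • c)
    exact ((h.hasDerivAt_seg ht j hs).sub h2).hasDerivWithinAt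
  have := norm_image_sub_le_of_norm_deriv_le_segment_01' hd (C := η * ‖t.1 j‖) (by
    intro s hs
    rw [← smul_sub, norm_smul, mul_comm]
    gcongr
    exact hX _ (h.mapsTo (h.accessible.seg_mem ht j (Ico_subset_Icc_self hs))))
  simp only [seg_zero, seg_one, one_smul, zero_smul, sub_zero] at this
  rwa [sub_right_comm] at this

/-- Since `ξ` is a homeomorphism onto its image, `Ξ` cannot come back to `xbar` from far away in
`U`; an injective immersion could. -/
theorem IsC1Chart.eventually_norm_le (hξ : IsC1Chart Ω Ξ xbar U ξ) {δ : ℝ} (hδ : 0 < δ) :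
    ∀ᶠ ε in 𝓝[>] (0 : ℝ), ∀ s ∈ U, ξ s ∈ Metric.ball xbar ε → ‖s‖ ≤ δ := by
  have h0 : {s : U | ‖(s : Fin (n - p) → ℝ)‖ < δ} ∈ 𝓝 (⟨0, hξ.zero_mem⟩ : U) := by
    apply IsOpen.mem_nhds
    · exact isOpen_lt (by fun_prop) continuous_const
    · simpa using hδ
  rw [hξ.embedding.nhds_eq_comap, mem_comap] at h0
  obtain ⟨V, hV, hVs⟩ := h0
  have hV' : V ∈ 𝓝 xbar := by simpa [hξ.map_zero] using hV
  filter_upwards [eventually_forall_mem_ball (P := fun y => y ∈ V) hV'] with ε hε s hs hsb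
  have : (⟨s, hs⟩ : U) ∈ {s : U | ‖(s : Fin (n - p) → ℝ)‖ < δ} := hVs (hε _ hsb)
  exact le_of_lt this

/-- The parameter domain of an adapted chart with a small image is small. -/
theorem eventually_params_small (hX : ∀ j, ContinuousAt (X j) xbar) (hX0 : ∀ j, X j xbar ≠ 0)
    (hξ : IsC1Chart Ω Ξ xbar U ξ) {δ : ℝ} (hδ : 0 < δ) :
    ∀ᶠ ε in 𝓝[>] (0 : ℝ), ∀ Θ D ψ φ, AdaptedChart X U ξ Θ D ψ φ → D ⊆ Metric.ball xbar ε →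
      ∀ t ∈ Θ, ‖t‖ ≤ δ := by
  have hX1 : ∀ᶠ ε in 𝓝[>] (0 : ℝ), ∀ y ∈ Metric.ball xbar ε, ∀ j,
      ‖X j y - X j xbar‖ ≤ ‖X j xbar‖ / 2 := by
    refine eventually_forall_mem_ball (eventually_all.2 fun j => ?_)
    have := (hX j).eventually (Metric.closedBall_mem_nhds (X j xbar)
      (half_pos (norm_pos_iff.2 (hX0 j))))
    filter_upwards [this] with y hy
    simpa [dist_eq_norm] using hy
  -- The ends of the `j`-th segment are mapped into a ball of radius `ε`, and the displacement is
  -- `t_j X_j(xbar)` up to half its length. So `|t_j| ‖X_j(xbar)‖ / 2 ≤ 2 ε`.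
  have hX2 : ∀ᶠ ε in 𝓝[>] (0 : ℝ), ∀ j, 4 * ε ≤ δ * ‖X j xbar‖ := by
    refine eventually_all.2 fun j => ?_
    have hpos : 0 < δ * ‖X j xbar‖ / 4 := by have := norm_pos_iff.2 (hX0 j); positivity
    filter_upwards [Ioo_mem_nhdsGT hpos] with ε hε
    linarith [hε.2]
  filter_upwards [hX1, hX2, hξ.eventually_norm_le hδ] with ε h1 h2 h3 Θ D ψ φ h hD t ht
  rw [Prod.norm_def]
  refine max_le ((pi_norm_le_iff_of_nonneg hδ.le).2 fun j => ?_) ?_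
  · have hd := h.norm_displacement_le (j := j) (fun x hx => h1 x (hD hx) j) ht
    have m1 := hD (h.mapsTo (h.accessible.vertex_mem ht (j := j + 1) j.2))
    have m2 := hD (h.mapsTo (h.accessible.vertex_mem ht (j := j) j.2.le))
    rw [mem_ball_iff_norm] at m1 m2
    have h4 : ‖t.1 j • X j xbar‖ ≤ ‖ψ (vertex t (j + 1)) - xbar‖ + ‖ψ (vertex t j) - xbar‖
        + ‖ψ (vertex t (j + 1)) - ψ (vertex t j) - t.1 j • X j xbar‖ := by
      have e : t.1 j • X j xbar = (ψ (vertex t (j + 1)) - xbar) - (ψ (vertex t j) - xbar)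
        - (ψ (vertex t (j + 1)) - ψ (vertex t j) - t.1 j • X j xbar) := by abel
      conv_lhs => rw [e]
      exact (norm_sub_le _ _).trans (add_le_add_left (norm_sub_le _ _) _)
    rw [norm_smul] at h4
    have h5 := h2 j
    have h6 := norm_pos_iff.2 (hX0 j)
    by_contra! hlt
    nlinarith
  · exact h3 t.2 (h.base_mem ht).1 (by
      rw [← (h.base_mem ht).2]
      exact hD (h.mapsTo (h.accessible.vertex_mem ht (Nat.zero_le _))))

theorem AdaptedChart.contDiffOn_comp (h : AdaptedChart X U ξ Θ D ψ φ) {F : Type*}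
    [NormedAddCommGroup F] [NormedSpace ℝ F] {Y : (Fin n → ℝ) → F} (hY : ContDiffOn ℝ 1 Y D) :
    ContDiffOn ℝ 1 (fun t => Y (ψ t)) Θ :=
  hY.comp h.contDiffOn h.mapsTo

theorem AdaptedChart.fderiv_comp (h : AdaptedChart X U ξ Θ D ψ φ) {F : Type*}
    [NormedAddCommGroup F] [NormedSpace ℝ F] {Y : (Fin n → ℝ) → F} (hY : ContDiffOn ℝ 1 Y D)
    {t : Params n p} (ht : t ∈ Θ) :
    fderiv ℝ (fun t => Y (ψ t)) t = (fderiv ℝ Y (ψ t)).comp (fderiv ℝ ψ t) :=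
  fderiv_fun_comp t ((hY.differentiableOn one_ne_zero).differentiableAt
    (h.isOpen_image.mem_nhds (h.mapsTo ht))) (h.differentiableAt ht)

/-- Along the `j`-th segment, `∂ψ` solves the linearized equation of the flow of `X_j`. -/
theorem AdaptedChart.hasDerivAt_fderiv (h : AdaptedChart X U ξ Θ D ψ φ) {j : Fin p}
    (hX : ContDiffOn ℝ 1 (X j) D) {v : Params n p} (hv : ∀ l, j < l → v.1 l = 0)
    {t : Params n p} (ht : t ∈ Θ) {s : ℝ} (hs : s ∈ Icc (0 : ℝ) 1) :
    HasDerivAt (fun s => fderiv ℝ ψ (seg n j s t) v)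
      (t.1 j • fderiv ℝ (X j) (ψ (seg n j s t)) (fderiv ℝ ψ (seg n j s t) v)) s := by
  have := hasDerivAt_fderiv_seg h.accessible (h.contDiffOn.differentiableOn one_ne_zero)
    (h.contDiffOn_comp hX) (fun t ht hl => h.flow t ht j hl) hv ht hs
  rwa [h.fderiv_comp hX (h.accessible.seg_mem ht j hs)] at this

/-- Relative changes of at most `η` per step compound. The exponent `i` instead of `i - i₀` is
wasteful but saves a subtraction. -/
theorem norm_sub_le_of_chain {F : Type*} [NormedAddCommGroup F] {y : ℕ → F} {η : ℝ} (hη : 0 ≤ η)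
    {i₀ q : ℕ} (hy : ∀ i, i₀ ≤ i → i < q → ‖y (i + 1) - y i‖ ≤ η * ‖y i‖) :
    ∀ i, i₀ ≤ i → i ≤ q → ‖y i - y i₀‖ ≤ ((1 + η) ^ i - 1) * ‖y i₀‖ := by
  intro i hi
  induction i, hi using Nat.le_induction with
  | base =>
    intro _
    have : 1 ≤ (1 + η) ^ i₀ := one_le_pow₀ (by linarith)
    rw [sub_self, norm_zero]
    exact mul_nonneg (by linarith) (norm_nonneg _)
  | succ i hi ih =>
    intro hq
    have h1 := ih (by omega)
    have h2 := hy i hi (by omega)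
    have h3 : ‖y i‖ ≤ ‖y i - y i₀‖ + ‖y i₀‖ := by
      simpa using norm_add_le (y i - y i₀) (y i₀)
    have h4 : ‖y (i + 1) - y i₀‖ ≤ ‖y (i + 1) - y i‖ + ‖y i - y i₀‖ := by
      simpa using norm_add_le (y (i + 1) - y i) (y i - y i₀)
    rw [pow_succ]
    nlinarith [norm_nonneg (y i₀)]

/-- In a small adapted chart, the derivative of `ψ` hardly changes along the later segments. -/
theorem eventually_norm_fderiv_sub_le (hΩ : IsOpen Ω) (hxbar : xbar ∈ Ω)
    (hX : ∀ j, ContDiffOn ℝ 1 (X j) Ω) (hX0 : ∀ j, X j xbar ≠ 0)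
    (hξ : IsC1Chart Ω Ξ xbar U ξ) {δ : ℝ} (hδ : 0 < δ) :
    ∀ᶠ ε in 𝓝[>] (0 : ℝ), ∀ Θ D ψ φ, AdaptedChart X U ξ Θ D ψ φ → D ⊆ Metric.ball xbar ε →
      ∀ t ∈ Θ, ∀ i ≤ p, ∀ v : Params n p, (∀ l : Fin p, i ≤ l → v.1 l = 0) →
        ‖fderiv ℝ ψ t v - fderiv ℝ ψ (vertex t i) v‖ ≤ δ * ‖fderiv ℝ ψ (vertex t i) v‖ := by
  obtain ⟨K, hK0, hK⟩ : ∃ K : ℝ, 0 < K ∧ ∀ j, ‖fderiv ℝ (X j) xbar‖ < K := by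
    refine ⟨∑ j, ‖fderiv ℝ (X j) xbar‖ + 1, by positivity, fun j => ?_⟩
    have := Finset.single_le_sum (f := fun j => ‖fderiv ℝ (X j) xbar‖)
      (fun i _ => norm_nonneg _) (Finset.mem_univ j)
    linarith
  obtain ⟨η, hη0, hη⟩ : ∃ η > 0, (1 + η) ^ p - 1 ≤ δ := by
    have hc : ContinuousAt (fun η : ℝ => (1 + η) ^ p - 1) 0 := by fun_prop
    exact exists_pos_le_of_continuousAt hc (by simpa using hδ)
  -- For flow times below this bound, `κ = K |t_k|` satisfies `κ ≤ 1/2`, as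
  -- `norm_sub_le_of_norm_deriv_le_mul` requires, and `2 κ ≤ η`.
  have hT : 0 < min (η / (2 * K)) (1 / (2 * K)) := by positivity
  have hΩball : ∀ᶠ ε in 𝓝[>] (0 : ℝ), ∀ y ∈ Metric.ball xbar ε, y ∈ Ω :=
    eventually_forall_mem_ball (hΩ.mem_nhds hxbar)
  have hXK : ∀ᶠ ε in 𝓝[>] (0 : ℝ), ∀ y ∈ Metric.ball xbar ε, ∀ j, ‖fderiv ℝ (X j) y‖ < K := by
    refine eventually_forall_mem_ball (eventually_all.2 fun j => ?_)
    have hc : ContinuousAt (fun y => ‖fderiv ℝ (X j) y‖) xbar :=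
      (((hX j).continuousOn_fderiv_of_isOpen hΩ le_rfl).continuousAt (hΩ.mem_nhds hxbar)).norm
    exact hc.eventually_lt continuousAt_const (hK j)
  filter_upwards [hΩball, hXK, eventually_params_small
    (fun j => (hX j).continuousOn.continuousAt (hΩ.mem_nhds hxbar)) hX0 hξ hT] with
    ε h1 h2 h3 Θ D ψ φ h hD t ht i hi v hv
  have hDΩ : D ⊆ Ω := fun x hx => h1 x (hD hx)
  have hstep : ∀ k, i ≤ k → k < p → ‖fderiv ℝ ψ (vertex t (k + 1)) v - fderiv ℝ ψ (vertex t k) v‖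
      ≤ η * ‖fderiv ℝ ψ (vertex t k) v‖ := by
    intro k hik hkp
    have htk : ‖t.1 ⟨k, hkp⟩‖ ≤ min (η / (2 * K)) (1 / (2 * K)) :=
      ((norm_le_pi_norm t.1 _).trans (norm_fst_le t)).trans (h3 Θ D ψ φ h hD t ht)
    have htk1 : K * ‖t.1 ⟨k, hkp⟩‖ ≤ η / 2 := by
      have := htk.trans (min_le_left _ _)
      rw [le_div_iff₀ (by positivity)] at this
      linarith
    have htk2 : K * ‖t.1 ⟨k, hkp⟩‖ ≤ 1 / 2 := by
      have := htk.trans (min_le_right _ _)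
      rw [le_div_iff₀ (by positivity)] at this
      linarith
    have := norm_sub_le_of_norm_deriv_le_mul (κ := K * ‖t.1 ⟨k, hkp⟩‖) (by positivity) htk2
      (fun s hs => h.hasDerivAt_fderiv (j := ⟨k, hkp⟩) ((hX _).mono hDΩ) (v := v)
        (fun l hl => hv l (hik.trans (Fin.lt_def.1 hl).le)) ht hs) (fun s hs => by
          rw [norm_smul]
          have hb := h2 _ (hD (h.mapsTo (h.accessible.seg_mem ht ⟨k, hkp⟩ hs))) ⟨k, hkp⟩
          have := (fderiv ℝ (X ⟨k, hkp⟩) (ψ (seg n ⟨k, hkp⟩ s t))).le_of_opNorm_le hb.le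
            (fderiv ℝ ψ (seg n ⟨k, hkp⟩ s t) v)
          calc _ ≤ ‖t.1 ⟨k, hkp⟩‖ * (K * ‖fderiv ℝ ψ (seg n ⟨k, hkp⟩ s t) v‖) := by gcongr
            _ = _ := by ring)
    rw [seg_one, seg_zero] at this
    refine this.trans ?_
    gcongr
    linarith
  have := norm_sub_le_of_chain (y := fun k => fderiv ℝ ψ (vertex t k) v) hη0.le hstep p hi le_rfl
  rw [vertex_last] at this
  exact this.trans (by gcongr)

/-- The derivative of `ψ` in the directions of the parameters of `ξ`. -/
theorem AdaptedChart.fderiv_base (h : AdaptedChart X U ξ Θ D ψ φ)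
    {t : Params n p} (ht : t ∈ Θ) (b : Fin (n - p) → ℝ) :
    fderiv ℝ ψ (vertex t 0) ((0 : Fin p → ℝ), b) = fderiv ℝ ξ t.2 b := by
  have hm := h.accessible.vertex_mem ht (Nat.zero_le p)
  have hv : vertex t 0 = ((0 : Fin p → ℝ), t.2) := Prod.ext (vertex_zero_fst t) rfl
  rw [hv] at hm ⊢
  have hd : HasFDerivAt (fun c : Fin (n - p) → ℝ => ψ ((0 : Fin p → ℝ), c))
      ((fderiv ℝ ψ (0, t.2)).comp (ContinuousLinearMap.inr ℝ (Fin p → ℝ) (Fin (n - p) → ℝ))) t.2 :=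
    (h.differentiableAt hm).hasFDerivAt.comp t.2 (hasFDerivAt_prodMk_right 0 t.2)
  have hev : (fun c : Fin (n - p) → ℝ => ψ ((0 : Fin p → ℝ), c)) =ᶠ[𝓝 t.2] ξ := by
    have hc : ContinuousAt (fun c : Fin (n - p) → ℝ => ((0 : Fin p → ℝ), c)) t.2 := by fun_prop
    filter_upwards [hc.eventually_mem (h.accessible.1.mem_nhds hm)] with c hc
    exact (h.base _ hc rfl).2
  have := (hd.congr_of_eventuallyEq hev.symm).fderiv
  rw [this]
  rfl

/-- In a small adapted chart, the derivative of `ψ` is close to that at the origin. -/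
theorem eventually_norm_fderiv_sub_baseMap_le (hΩ : IsOpen Ω) (hxbar : xbar ∈ Ω)
    (hX : ∀ j, ContDiffOn ℝ 1 (X j) Ω) (hX0 : ∀ j, X j xbar ≠ 0)
    (hξ : IsC1Chart Ω Ξ xbar U ξ) {δ : ℝ} (hδ : 0 < δ) :
    ∀ᶠ ε in 𝓝[>] (0 : ℝ), ∀ Θ D ψ φ, AdaptedChart X U ξ Θ D ψ φ → D ⊆ Metric.ball xbar ε →
      ∀ t ∈ Θ, ‖fderiv ℝ ψ t - baseMap X ξ xbar‖ ≤ δ := by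
  obtain ⟨C, hC0, hC, hC'⟩ : ∃ C : ℝ, 0 < C ∧ (∀ j, ‖X j xbar‖ ≤ C) ∧ ‖fderiv ℝ ξ 0‖ ≤ C := by
    refine ⟨∑ j, ‖X j xbar‖ + ‖fderiv ℝ ξ 0‖ + 1, by positivity, fun j => ?_, ?_⟩
    · have := Finset.single_le_sum (f := fun j => ‖X j xbar‖)
        (fun i _ => norm_nonneg _) (Finset.mem_univ j)
      linarith [norm_nonneg (fderiv ℝ ξ 0)]
    · have : 0 ≤ ∑ j, ‖X j xbar‖ := by positivity
      linarith
  -- In each direction the error is `μ` at the vertex where the derivative is known, plus a relative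
  -- change `μ` of a vector of norm at most `C + μ` on the later segments. The factor `p + 1` counts
  -- the axes and the block of base directions.
  obtain ⟨μ, hμ0, hμ⟩ : ∃ μ > 0, (p + 1) * (μ * (C + μ) + μ) ≤ δ := by
    have hc : ContinuousAt (fun μ : ℝ => (p + 1) * (μ * (C + μ) + μ)) 0 := by fun_prop
    exact exists_pos_le_of_continuousAt hc (by simpa using hδ)
  have hX1 : ∀ᶠ ε in 𝓝[>] (0 : ℝ), ∀ y ∈ Metric.ball xbar ε, ∀ j, ‖X j y - X j xbar‖ ≤ μ := by
    refine eventually_forall_mem_ball (eventually_all.2 fun j => ?_)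
    filter_upwards [((hX j).continuousOn.continuousAt (hΩ.mem_nhds hxbar)).eventually
      (Metric.closedBall_mem_nhds (X j xbar) hμ0)] with y hy
    simpa [dist_eq_norm] using hy
  obtain ⟨ρ, hρ0, hρ⟩ : ∃ ρ > 0, ∀ s : Fin (n - p) → ℝ, ‖s‖ ≤ ρ →
      ‖fderiv ℝ ξ s - fderiv ℝ ξ 0‖ ≤ μ := by
    have hc := (hξ.contDiffOn.continuousOn_fderiv_of_isOpen hξ.isOpen le_rfl).continuousAt
      (hξ.isOpen.mem_nhds hξ.zero_mem)
    obtain ⟨ρ, hρ, h⟩ := Metric.eventually_nhds_iff_ball.1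
      (hc.eventually (Metric.closedBall_mem_nhds _ hμ0))
    refine ⟨ρ / 2, half_pos hρ, fun s hs => ?_⟩
    have := h s (by simpa using hs.trans_lt (half_lt_self hρ))
    simpa [dist_eq_norm] using this
  filter_upwards [hX1, eventually_norm_fderiv_sub_le hΩ hxbar hX hX0 hξ hμ0,
    hξ.eventually_norm_le hρ0] with ε h1 h2 h3 Θ D ψ φ h hD t ht
  refine le_trans (opNorm_params_le _ (c := μ * (C + μ) + μ) (by positivity) ?_ ?_) hμ
  · intro k
    have hm := h.accessible.vertex_mem ht (j := k + 1) k.2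
    -- At `vertex t (k + 1)` the flow equation gives `∂ψ/∂t_k = X_k` exactly; only the segments
    -- after the `k`-th change it.
    have e1 := h2 Θ D ψ φ h hD t ht (k + 1) k.2 (axis n k) (by
      intro l hl
      have : l ≠ k := by rintro rfl; omega
      simp [axis, this])
    rw [h.flow _ hm k fun l hl => vertex_fst_of_le t (by simpa using Fin.lt_def.1 hl)] at e1
    have e2 := h1 _ (hD (h.mapsTo hm)) k
    have e3 : ‖X k (ψ (vertex t (k + 1)))‖ ≤ C + μ := by
      have := norm_add_le (X k xbar) (X k (ψ (vertex t (k + 1))) - X k xbar)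
      rw [add_sub_cancel] at this
      linarith [hC k]
    rw [_root_.sub_apply, baseMap_axis]
    have e4 := norm_sub_le_norm_sub_add_norm_sub (fderiv ℝ ψ t (axis n k))
      (X k (ψ (vertex t (k + 1)))) (X k xbar)
    nlinarith
  · intro b
    have e1 := h2 Θ D ψ φ h hD t ht 0 (Nat.zero_le _) ((0 : Fin p → ℝ), b) (fun _ _ => rfl)
    rw [h.fderiv_base ht] at e1
    have hs : ‖t.2‖ ≤ ρ := h3 t.2 (h.base_mem ht).1 (by
      rw [← (h.base_mem ht).2]
      exact hD (h.mapsTo (h.accessible.vertex_mem ht (Nat.zero_le _))))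
    have e2 := (fderiv ℝ ξ t.2 - fderiv ℝ ξ 0).le_of_opNorm_le (hρ t.2 hs) b
    have e3 := (fderiv ℝ ξ 0).le_of_opNorm_le hC' b
    rw [_root_.sub_apply] at e2
    have e4 : ‖fderiv ℝ ξ t.2 b‖ ≤ (C + μ) * ‖b‖ := by
      have := norm_add_le (fderiv ℝ ξ 0 b) (fderiv ℝ ξ t.2 b - fderiv ℝ ξ 0 b)
      rw [add_sub_cancel] at this
      linarith
    have e5 := norm_sub_le_norm_sub_add_norm_sub (fderiv ℝ ψ t ((0 : Fin p → ℝ), b))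
      (fderiv ℝ ξ t.2 b) (fderiv ℝ ξ 0 b)
    have e6 : baseMap X ξ xbar ((0 : Fin p → ℝ), b) = fderiv ℝ ξ 0 b := by
      simp [baseMap_apply]
    rw [_root_.sub_apply, e6]
    have e7 : μ * ‖fderiv ℝ ξ t.2 b‖ ≤ μ * ((C + μ) * ‖b‖) := by gcongr
    linarith

/-- A small adapted chart maps no point with a non-zero flow time into the data manifold. -/
theorem eventually_fst_eq_zero (hΩ : IsOpen Ω) (hxbar : xbar ∈ Ω)
    (hX : ∀ j, ContDiffOn ℝ 1 (X j) Ω) (hξ : IsC1Chart Ω Ξ xbar U ξ) {c : ℝ} (hc : 0 < c)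
    (hL : ∀ t, ‖t‖ ≤ c * ‖baseMap X ξ xbar t‖) :
    ∀ᶠ ε in 𝓝[>] (0 : ℝ), ∀ Θ D ψ φ, AdaptedChart X U ξ Θ D ψ φ → D ⊆ Metric.ball xbar ε →
      ∀ x ∈ Ξ ∩ D, (φ x).1 = 0 := by
  obtain ⟨μ, hμ0, hμ⟩ : ∃ μ > 0, c * ((p + 1) * μ) < 1 := by
    refine ⟨1 / (2 * (c * (p + 1))), by positivity, ?_⟩
    rw [← mul_assoc, mul_one_div, div_lt_one (by positivity)]
    have : 0 < c * (p + 1) := by positivity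
    linarith
  have hX1 : ∀ᶠ ε in 𝓝[>] (0 : ℝ), ∀ y ∈ Metric.ball xbar ε, ∀ j, ‖X j y - X j xbar‖ ≤ μ := by
    refine eventually_forall_mem_ball (eventually_all.2 fun j => ?_)
    filter_upwards [((hX j).continuousOn.continuousAt (hΩ.mem_nhds hxbar)).eventually
      (Metric.closedBall_mem_nhds (X j xbar) hμ0)] with y hy
    simpa [dist_eq_norm] using hy
  obtain ⟨ρ, hρ0, hρ⟩ : ∃ ρ > 0, ∀ a b : Fin (n - p) → ℝ, ‖a‖ ≤ ρ → ‖b‖ ≤ ρ →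
      ‖ξ a - ξ b - fderiv ℝ ξ 0 (a - b)‖ ≤ μ * ‖a - b‖ := by
    have hs := ((hξ.contDiffOn.contDiffAt (hξ.isOpen.mem_nhds hξ.zero_mem)).hasStrictFDerivAt
      one_ne_zero).isLittleO.def hμ0
    obtain ⟨ρ, hρ, h⟩ := Metric.eventually_nhds_iff_ball.1 hs
    refine ⟨ρ / 2, half_pos hρ, fun a b ha hb => ?_⟩
    rw [← ball_prod_same] at h
    exact h (a, b) ⟨by simpa using ha.trans_lt (half_lt_self hρ),
      by simpa using hb.trans_lt (half_lt_self hρ)⟩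
  filter_upwards [hX1, hξ.eventually_norm_le hρ0] with ε h1 h2 Θ D ψ φ h hD x hx
  obtain ⟨hxΞ, hxD⟩ := hx
  rw [← hξ.image_eq] at hxΞ
  obtain ⟨s, hsU, rfl⟩ := hxΞ
  set t := φ (ξ s) with ht'
  have ht : t ∈ Θ := h.mapsTo_inv hxD
  have hψt : ψ t = ξ s := h.invOn.2 hxD
  have hs : ‖s‖ ≤ ρ := h2 s hsU (hD hxD)
  have ht2 : ‖t.2‖ ≤ ρ := h2 t.2 (h.base_mem ht).1 (by
    rw [← (h.base_mem ht).2]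
    exact hD (h.mapsTo (h.accessible.vertex_mem ht (Nat.zero_le _))))
  have htel : ψ t - ξ t.2 = ∑ j : Fin p, (ψ (vertex t (j + 1)) - ψ (vertex t j)) := by
    rw [Fin.sum_univ_eq_sum_range (fun j => ψ (vertex t (j + 1)) - ψ (vertex t j)) p,
      Finset.sum_range_sub (fun j => ψ (vertex t j)), vertex_last, (h.base_mem ht).2]
  -- `d` is the difference of the parameters `t` and `(0, s)` of the same point. Hence `baseMap`
  -- sends `d` to a sum of linearization errors, of norm at most `(p + 1) μ ‖d‖`. By the choice of
  -- `μ` this contradicts the lower bound `hL` unless `d = 0`.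
  set d : Params n p := (t.1, t.2 - s) with hd
  have hkey : baseMap X ξ xbar d = -(ξ t.2 - ξ s - fderiv ℝ ξ 0 (t.2 - s))
      - ∑ j : Fin p, (ψ (vertex t (j + 1)) - ψ (vertex t j) - t.1 j • X j xbar) := by
    rw [Finset.sum_sub_distrib, ← htel, hψt, baseMap_apply]
    simp only [hd]
    abel
  have hnorm : ‖baseMap X ξ xbar d‖ ≤ (p + 1) * μ * ‖d‖ := by
    rw [hkey]
    refine (norm_sub_le _ _).trans ?_
    rw [norm_neg]
    have e1 : ‖ξ t.2 - ξ s - fderiv ℝ ξ 0 (t.2 - s)‖ ≤ μ * ‖d‖ :=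
      (hρ _ _ ht2 hs).trans (by gcongr; exact norm_snd_le d)
    have e2 : ‖∑ j : Fin p, (ψ (vertex t (j + 1)) - ψ (vertex t j) - t.1 j • X j xbar)‖
        ≤ ∑ _j : Fin p, μ * ‖d‖ := by
      refine norm_sum_le_of_le _ fun j _ => ?_
      refine (h.norm_displacement_le (fun y hy => h1 y (hD hy) j) ht).trans ?_
      gcongr
      exact (norm_le_pi_norm d.1 j).trans (norm_fst_le d)
    simp only [Finset.sum_const, Finset.card_univ, Fintype.card_fin, nsmul_eq_mul] at e2
    linarith
  have hd0 : ‖d‖ = 0 := by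
    have := hL d
    have h6 : c * ‖baseMap X ξ xbar d‖ ≤ c * ((p + 1) * μ * ‖d‖) := by gcongr
    by_contra hne
    have hpos : 0 < ‖d‖ := lt_of_le_of_ne (norm_nonneg _) (Ne.symm hne)
    nlinarith
  have := norm_eq_zero.1 hd0
  exact congrArg Prod.fst this

/-- Transversality makes the derivative at the origin an isomorphism. -/
theorem exists_norm_le_baseMap {r : Fin n → (Fin n → ℝ) → (Fin n → ℝ)} {I : Finset (Fin n)}
    {U : Set (Fin (n - I.card) → ℝ)} {ξ : (Fin (n - I.card) → ℝ) → (Fin n → ℝ)}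
    (hξ : IsC1Chart Ω Ξ xbar U ξ) (htrans : IsTransverse r I U ξ) :
    ∃ c > 0, ∀ t, ‖t‖ ≤ c * ‖baseMap (fun j => r (I.orderEmbOfFin rfl j)) ξ xbar t‖ := by
  set L := baseMap (fun j => r (I.orderEmbOfFin rfl j)) ξ xbar with hL
  have hsurj : Function.Surjective L := by
    have htop := htrans 0 hξ.zero_mem
    have hle : (⊤ : Submodule ℝ (Fin n → ℝ)) ≤ LinearMap.range (L : Params n I.card →ₗ[ℝ] _) := by
      rw [← htop]
      refine sup_le ?_ (Submodule.span_le.2 ?_)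
      · rintro _ ⟨b, rfl⟩
        refine ⟨((0 : Fin I.card → ℝ), b), ?_⟩
        simp [hL, baseMap_apply]
      · rintro _ ⟨i, hi, rfl⟩
        obtain ⟨j, rfl⟩ : ∃ j, I.orderEmbOfFin rfl j = i := by
          have := I.range_orderEmbOfFin rfl
          rw [← this] at hi
          exact hi
        refine ⟨axis n j, ?_⟩
        have := baseMap_axis (fun j => r (I.orderEmbOfFin rfl j)) ξ xbar j
        simpa [hL, hξ.map_zero] using this
    intro y
    obtain ⟨x, hx⟩ := hle (Submodule.mem_top (x := y))
    exact ⟨x, hx⟩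
  -- Transversality only yields surjectivity. Injectivity is a dimension count, in which `p + (n -
  -- p) = n` needs `p ≤ n` because the subtraction is truncated.
  have hcard : I.card ≤ n := by simpa using Finset.card_le_univ I
  have hdim : Module.finrank ℝ (Params n I.card) = Module.finrank ℝ (Fin n → ℝ) := by
    simp [Params]; omega
  have hinj : Function.Injective (L : Params n I.card →ₗ[ℝ] (Fin n → ℝ)) :=
    (LinearMap.injective_iff_surjective_of_finrank_eq_finrank hdim).2 hsurj
  obtain ⟨K, hK, hanti⟩ := (L : Params n I.card →ₗ[ℝ] (Fin n → ℝ)).exists_antilipschitzWith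
    (LinearMap.ker_eq_bot.2 hinj)
  refine ⟨K, hK, fun t => ?_⟩
  have := hanti.le_mul_dist t 0
  simpa using this

end Small

/-! ### Integrals along the segments -/

section PathIntegral

variable {n p : ℕ}

/-- The integral of `h` along the `j`-th segment of the path to `t`, with respect to the `j`-th
flow time. -/
noncomputable def pathInt (j : Fin p) (h : Params n p → ℝ) (t : Params n p) : ℝ :=
  ∫ s in (0 : ℝ)..1, t.1 j * h (seg n j s t)

variable {Θ : Set (Params n p)} {h h₁ h₂ : Params n p → ℝ}

theorem continuous_seg_uncurry (j : Fin p) :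
    Continuous fun z : Params n p × ℝ => seg n j z.2 z.1 :=
  ((continuous_seg j).comp continuous_snd).clm_apply continuous_fst

theorem continuousOn_pathInt_integrand (hΘ : IsAccessible Θ) (hh : ContinuousOn h Θ) (j : Fin p) :
    ContinuousOn (fun z : Params n p × ℝ => z.1.1 j * h (seg n j z.2 z.1)) (Θ ×ˢ Icc 0 1) :=
  (by fun_prop : Continuous fun z : Params n p × ℝ => z.1.1 j).continuousOn.mul
    (hh.comp (continuous_seg_uncurry j).continuousOn fun z hz => hΘ.seg_mem hz.1 j hz.2)

theorem intervalIntegrable_pathInt (hΘ : IsAccessible Θ) (hh : ContinuousOn h Θ) (j : Fin p)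
    {t : Params n p} (ht : t ∈ Θ) :
    IntervalIntegrable (fun s => t.1 j * h (seg n j s t)) volume 0 1 := by
  apply ContinuousOn.intervalIntegrable
  rw [uIcc_of_le zero_le_one]
  exact continuousOn_slice (G := fun t s => t.1 j * h (seg n j s t))
    (continuousOn_pathInt_integrand hΘ hh j) ht

theorem pathInt_of_eq_zero {j : Fin p} {t : Params n p} (h0 : t.1 j = 0) : pathInt j h t = 0 := by
  simp [pathInt, h0]

theorem abs_pathInt_le (hΘ : IsAccessible Θ) {M : ℝ} (hh : ∀ t ∈ Θ, |h t| ≤ M) (j : Fin p)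
    {t : Params n p} (ht : t ∈ Θ) : |pathInt j h t| ≤ |t.1 j| * M := by
  have := intervalIntegral.norm_integral_le_of_norm_le_const (a := (0 : ℝ)) (b := 1)
    (f := fun s => t.1 j * h (seg n j s t)) (C := |t.1 j| * M) (by
      intro s hs
      rw [uIoc_of_le zero_le_one] at hs
      rw [norm_mul, Real.norm_eq_abs, Real.norm_eq_abs]
      gcongr
      exact hh _ (hΘ.seg_mem ht j (Ioc_subset_Icc_self hs)))
  simpa [pathInt] using this

theorem pathInt_sub (hΘ : IsAccessible Θ) (h₁c : ContinuousOn h₁ Θ) (h₂c : ContinuousOn h₂ Θ)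
    (j : Fin p) {t : Params n p} (ht : t ∈ Θ) :
    pathInt j (fun t => h₁ t - h₂ t) t = pathInt j h₁ t - pathInt j h₂ t := by
  unfold pathInt
  rw [← intervalIntegral.integral_sub (intervalIntegrable_pathInt hΘ h₁c j ht)
    (intervalIntegrable_pathInt hΘ h₂c j ht)]
  simp only [mul_sub]

/-- The derivative of the integrand of `pathInt`. -/
noncomputable def pathIntDeriv (j : Fin p) (h : Params n p → ℝ) (t : Params n p) (s : ℝ) :
    Params n p →L[ℝ] ℝ :=
  t.1 j • (fderiv ℝ h (seg n j s t)).comp (seg n j s) + h (seg n j s t) • coord n j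

theorem continuousOn_pathIntDeriv (hΘ : IsAccessible Θ) (hh : ContDiffOn ℝ 1 h Θ) (j : Fin p) :
    ContinuousOn (fun z : Params n p × ℝ => pathIntDeriv j h z.1 z.2) (Θ ×ˢ Icc 0 1) := by
  have hm : MapsTo (fun z : Params n p × ℝ => seg n j z.2 z.1) (Θ ×ˢ Icc 0 1) Θ :=
    fun z hz => hΘ.seg_mem hz.1 j hz.2
  have hc := (continuous_seg_uncurry (n := n) j).continuousOn (s := Θ ×ˢ Icc (0 : ℝ) 1)
  have h1 := hh.continuousOn.comp hc hm
  have h2 := (hh.continuousOn_fderiv_of_isOpen hΘ.1 le_rfl).comp hc hm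
  have h3 : Continuous fun z : Params n p × ℝ => seg n j z.2 := (continuous_seg j).comp continuous_snd
  have h4 : Continuous fun z : Params n p × ℝ => z.1.1 j := by fun_prop
  exact (h4.continuousOn.smul (h2.clm_comp h3.continuousOn)).add
    (h1.smul (continuousOn_const (c := coord n j)))

theorem hasFDerivAt_pathInt (hΘ : IsAccessible Θ) (hh : ContDiffOn ℝ 1 h Θ) (j : Fin p)
    {t : Params n p} (ht : t ∈ Θ) :
    HasFDerivAt (pathInt j h) (∫ s in (0 : ℝ)..1, pathIntDeriv j h t s) t := by
  refine hasFDerivAt_integral_param hΘ.1 (G := fun t s => t.1 j * h (seg n j s t))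
    (continuousOn_pathInt_integrand hΘ hh.continuousOn j) (continuousOn_pathIntDeriv hΘ hh j)
    (fun x hx s hs => ?_) ht
  have d1 : HasFDerivAt (fun t => h (seg n j s t)) ((fderiv ℝ h (seg n j s x)).comp (seg n j s)) x :=
    ((hh.differentiableOn one_ne_zero).differentiableAt
      (hΘ.1.mem_nhds (hΘ.seg_mem hx j hs))).hasFDerivAt.comp x (seg n j s).hasFDerivAt
  exact (coord n j).hasFDerivAt.mul d1

theorem contDiffOn_pathInt (hΘ : IsAccessible Θ) (hh : ContDiffOn ℝ 1 h Θ) (j : Fin p) :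
    ContDiffOn ℝ 1 (pathInt j h) Θ := by
  rw [← zero_add (1 : WithTop ℕ∞), contDiffOn_succ_iff_fderiv_of_isOpen hΘ.1]
  refine ⟨fun t ht => (hasFDerivAt_pathInt hΘ hh j ht).differentiableAt.differentiableWithinAt,
    by simp, contDiffOn_zero.2 ?_⟩
  exact (continuousOn_integral_param hΘ.1 (continuousOn_pathIntDeriv hΘ hh j)).congr
    fun t ht => (hasFDerivAt_pathInt hΘ hh j ht).fderiv

/-- The term in which the derivative of `h` occurs carries the small factor `t_j`; the other one
comes from differentiating that factor. -/
theorem norm_fderiv_pathInt_le (hΘ : IsAccessible Θ) (hh : ContDiffOn ℝ 1 h Θ) (j : Fin p)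
    {M M' : ℝ} (hM : ∀ t ∈ Θ, |h t| ≤ M) (hM' : ∀ t ∈ Θ, ‖fderiv ℝ h t‖ ≤ M')
    {t : Params n p} (ht : t ∈ Θ) : ‖fderiv ℝ (pathInt j h) t‖ ≤ M + |t.1 j| * M' := by
  rw [(hasFDerivAt_pathInt hΘ hh j ht).fderiv]
  have hM'0 : 0 ≤ M' := (norm_nonneg _).trans (hM' t ht)
  have := intervalIntegral.norm_integral_le_of_norm_le_const (a := (0 : ℝ)) (b := 1)
    (f := pathIntDeriv j h t) (C := M + |t.1 j| * M') (by
      intro s hs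
      rw [uIoc_of_le zero_le_one] at hs
      have hs' := Ioc_subset_Icc_self hs
      have hm := hΘ.seg_mem ht j hs'
      have hcoord : ‖coord n j‖ ≤ 1 := ContinuousLinearMap.opNorm_le_bound _ zero_le_one fun t => by
        rw [one_mul]; exact (norm_le_pi_norm t.1 j).trans (norm_fst_le t)
      have h1 : ‖(fderiv ℝ h (seg n j s t)).comp (seg n j s)‖ ≤ M' * 1 :=
        (ContinuousLinearMap.opNorm_comp_le _ _).trans
          (mul_le_mul (hM' _ hm) (norm_seg_le j hs') (norm_nonneg _) hM'0)
      have h2 : ‖h (seg n j s t) • coord n j‖ ≤ M * 1 := by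
        rw [norm_smul]
        exact mul_le_mul (hM _ hm) hcoord (norm_nonneg _) ((abs_nonneg _).trans (hM _ hm))
      refine (norm_add_le _ _).trans ?_
      rw [norm_smul, Real.norm_eq_abs]
      have h3 := mul_le_mul_of_nonneg_left h1 (abs_nonneg (t.1 j))
      linarith)
  simpa using this

theorem fderiv_pathInt_apply (hΘ : IsAccessible Θ) (hh : ContDiffOn ℝ 1 h Θ) (j : Fin p)
    {t : Params n p} (ht : t ∈ Θ) (v : Params n p) :
    fderiv ℝ (pathInt j h) t v = ∫ s in (0 : ℝ)..1,
      (t.1 j * fderiv ℝ h (seg n j s t) (seg n j s v) + h (seg n j s t) * v.1 j) := by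
  rw [(hasFDerivAt_pathInt hΘ hh j ht).fderiv, ContinuousLinearMap.intervalIntegral_apply]
  · rfl
  · apply ContinuousOn.intervalIntegrable
    rw [uIcc_of_le zero_le_one]
    exact continuousOn_slice (continuousOn_pathIntDeriv hΘ hh j) ht

/-- As `seg n j s` multiplies the `j`-th axis by `s`, the differentiated integrand is the total
derivative of `s ↦ s h(seg n j s t)`. -/
theorem fderiv_pathInt_axis_self (hΘ : IsAccessible Θ) (hh : ContDiffOn ℝ 1 h Θ) {j : Fin p}
    {t : Params n p} (ht : t ∈ Θ) (h0 : ∀ l, j < l → t.1 l = 0) :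
    fderiv ℝ (pathInt j h) t (axis n j) = h t := by
  rw [fderiv_pathInt_apply hΘ hh j ht]
  have hd : ∀ s ∈ uIcc (0 : ℝ) 1, HasDerivAt (fun s => s * h (seg n j s t))
      (t.1 j * fderiv ℝ h (seg n j s t) (seg n j s (axis n j))
        + h (seg n j s t) * (axis n j).1 j) s := by
    intro s hs
    rw [uIcc_of_le zero_le_one] at hs
    have h1 := ((hh.differentiableOn one_ne_zero).differentiableAt
      (hΘ.1.mem_nhds (hΘ.seg_mem ht j hs))).hasFDerivAt.comp_hasDerivAt s (hasDerivAt_seg j t s)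
    have h2 := (hasDerivAt_id s).mul h1
    refine h2.congr_deriv ?_
    have h3 : (axis n j).1 j = 1 := by simp [axis]
    rw [seg_axis_self, map_smul, map_smul, h3]
    simp only [Function.comp_apply, id_eq, smul_eq_mul]
    ring
  rw [intervalIntegral.integral_eq_sub_of_hasDerivAt hd]
  · rw [seg_one_of_eq_zero h0]; simp
  · apply ContinuousOn.intervalIntegrable
    rw [uIcc_of_le zero_le_one]
    exact (continuousOn_slice (continuousOn_pathIntDeriv hΘ hh j) ht).clm_apply
      (continuousOn_const (c := axis n j))

theorem fderiv_pathInt_axis_of_lt (hΘ : IsAccessible Θ) (hh : ContDiffOn ℝ 1 h Θ) {j l : Fin p}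
    (hl : l < j) {t : Params n p} (ht : t ∈ Θ) :
    fderiv ℝ (pathInt l h) t (axis n j) = 0 := by
  rw [fderiv_pathInt_apply hΘ hh l ht]
  have h1 : (axis n j).1 l = 0 := by simp [axis, hl.ne]
  simp [seg_axis_of_lt hl, h1]

/-- The prefactor `t_l` vanishes, and it is not differentiated in this direction. -/
theorem fderiv_pathInt_axis_of_gt (hΘ : IsAccessible Θ) (hh : ContDiffOn ℝ 1 h Θ) {j l : Fin p}
    (hl : j < l) {t : Params n p} (ht : t ∈ Θ) (h0 : t.1 l = 0) :
    fderiv ℝ (pathInt l h) t (axis n j) = 0 := by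
  rw [fderiv_pathInt_apply hΘ hh l ht]
  simp [h0, axis, hl.ne']

theorem pathInt_eq_sub (hΘ : IsAccessible Θ) {H : Params n p → ℝ} (hH : DifferentiableOn ℝ H Θ)
    (hh : ContinuousOn h Θ) {j : Fin p}
    (hw : ∀ t ∈ Θ, (∀ l, j < l → t.1 l = 0) → fderiv ℝ H t (axis n j) = h t)
    {t : Params n p} (ht : t ∈ Θ) :
    pathInt j h t = H (vertex t (j + 1)) - H (vertex t j) := by
  rw [← seg_zero, ← seg_one]
  apply intervalIntegral.integral_eq_sub_of_hasDerivAt (f := fun s => H (seg n j s t))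
  · intro s hs
    rw [uIcc_of_le zero_le_one] at hs
    have hm := hΘ.seg_mem ht j hs
    have := (hH.differentiableAt (hΘ.1.mem_nhds hm)).hasFDerivAt.comp_hasDerivAt s
      (hasDerivAt_seg j t s)
    rwa [map_smul, hw _ hm fun l hl => seg_fst_of_gt hl s t] at this
  · exact intervalIntegrable_pathInt hΘ hh j ht

end PathIntegral

/-! ### The scalar integral operator -/

section PicardScalar

variable {n p : ℕ}

/-- The value at `t` that is obtained from the data `G` by integrating `h_1, …, h_p` along the
segments of the path to `t`. -/
noncomputable def picardScalar (G : (Fin (n - p) → ℝ) → ℝ) (h : Fin p → Params n p → ℝ)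
    (t : Params n p) : ℝ :=
  G t.2 + ∑ j, pathInt j (h j) t

variable {Θ : Set (Params n p)} {U : Set (Fin (n - p) → ℝ)} {G : (Fin (n - p) → ℝ) → ℝ}
  {h h₁ h₂ : Fin p → Params n p → ℝ} {T : ℝ}

theorem picardScalar_of_fst_eq_zero {t : Params n p} (h0 : t.1 = 0) :
    picardScalar G h t = G t.2 := by
  simp [picardScalar, pathInt_of_eq_zero, h0]

theorem abs_picardScalar_sub_le (hΘ : IsAccessible Θ) (hT : ∀ t ∈ Θ, ‖t‖ ≤ T) {M : ℝ}
    (hh : ∀ j, ∀ t ∈ Θ, |h j t| ≤ M) {t : Params n p} (ht : t ∈ Θ) :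
    |picardScalar G h t - G t.2| ≤ p * (T * M) := by
  have : |∑ j, pathInt j (h j) t| ≤ ∑ _j : Fin p, T * M := by
    refine (Finset.abs_sum_le_sum_abs _ _).trans (Finset.sum_le_sum fun j _ => ?_)
    refine (abs_pathInt_le hΘ (hh j) j ht).trans ?_
    have h1 : |t.1 j| ≤ T := ((norm_le_pi_norm t.1 j).trans (norm_fst_le t)).trans (hT t ht)
    have h2 : 0 ≤ M := (abs_nonneg _).trans (hh j t ht)
    gcongr
  simpa [picardScalar] using this

theorem picardScalar_sub (hΘ : IsAccessible Θ) (h₁c : ∀ j, ContinuousOn (h₁ j) Θ)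
    (h₂c : ∀ j, ContinuousOn (h₂ j) Θ) {t : Params n p} (ht : t ∈ Θ) :
    picardScalar G h₁ t - picardScalar G h₂ t
      = picardScalar (fun _ => 0) (fun j t => h₁ j t - h₂ j t) t := by
  simp only [picardScalar, zero_add, add_sub_add_left_eq_sub, ← Finset.sum_sub_distrib]
  exact Finset.sum_congr rfl fun j _ => (pathInt_sub hΘ (h₁c j) (h₂c j) j ht).symm

theorem abs_picardScalar_sub_picardScalar_le (hΘ : IsAccessible Θ) (hT : ∀ t ∈ Θ, ‖t‖ ≤ T)
    (h₁c : ∀ j, ContinuousOn (h₁ j) Θ) (h₂c : ∀ j, ContinuousOn (h₂ j) Θ) {d : ℝ}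
    (hd : ∀ j, ∀ t ∈ Θ, |h₁ j t - h₂ j t| ≤ d) {t : Params n p} (ht : t ∈ Θ) :
    |picardScalar G h₁ t - picardScalar G h₂ t| ≤ p * (T * d) := by
  rw [picardScalar_sub hΘ h₁c h₂c ht]
  simpa using abs_picardScalar_sub_le (G := fun _ => 0) hΘ hT hd ht

theorem contDiffOn_picardScalar (hΘ : IsAccessible Θ) (hG : ContDiffOn ℝ 1 G U)
    (hΘU : ∀ t ∈ Θ, t.2 ∈ U) (hh : ∀ j, ContDiffOn ℝ 1 (h j) Θ) :
    ContDiffOn ℝ 1 (picardScalar G h) Θ :=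
  (hG.comp contDiff_snd.contDiffOn hΘU).add
    (ContDiffOn.sum fun j _ => contDiffOn_pathInt hΘ (hh j) j)

theorem fderiv_picardScalar (hΘ : IsAccessible Θ) (hU : IsOpen U) (hG : ContDiffOn ℝ 1 G U)
    (hΘU : ∀ t ∈ Θ, t.2 ∈ U) (hh : ∀ j, ContDiffOn ℝ 1 (h j) Θ) {t : Params n p} (ht : t ∈ Θ) :
    fderiv ℝ (picardScalar G h) t
      = (fderiv ℝ G t.2).comp (ContinuousLinearMap.snd ℝ (Fin p → ℝ) (Fin (n - p) → ℝ))
        + ∑ j, fderiv ℝ (pathInt j (h j)) t := by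
  have h1 : HasFDerivAt (fun t : Params n p => G t.2)
      ((fderiv ℝ G t.2).comp (ContinuousLinearMap.snd ℝ (Fin p → ℝ) (Fin (n - p) → ℝ))) t :=
    ((hG.differentiableOn one_ne_zero).differentiableAt
      (hU.mem_nhds (hΘU t ht))).hasFDerivAt.comp t hasFDerivAt_snd
  have h2 : HasFDerivAt (fun t : Params n p => ∑ j, pathInt j (h j) t)
      (∑ j, fderiv ℝ (pathInt j (h j)) t) t :=
    HasFDerivAt.fun_sum fun j _ => (hasFDerivAt_pathInt hΘ (hh j) j ht).differentiableAt.hasFDerivAt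
  exact (h1.add h2).fderiv

theorem norm_sum_fderiv_pathInt_le (hΘ : IsAccessible Θ) (hT : ∀ t ∈ Θ, ‖t‖ ≤ T)
    (hh : ∀ j, ContDiffOn ℝ 1 (h j) Θ) {M M' : ℝ} (hM : ∀ j, ∀ t ∈ Θ, |h j t| ≤ M)
    (hM' : ∀ j, ∀ t ∈ Θ, ‖fderiv ℝ (h j) t‖ ≤ M') {t : Params n p} (ht : t ∈ Θ) :
    ‖∑ j, fderiv ℝ (pathInt j (h j)) t‖ ≤ p * (M + T * M') := by
  have : ‖∑ j, fderiv ℝ (pathInt j (h j)) t‖ ≤ ∑ _j : Fin p, (M + T * M') := by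
    refine norm_sum_le_of_le _ fun j _ => ?_
    refine (norm_fderiv_pathInt_le hΘ (hh j) j (hM j) (hM' j) ht).trans ?_
    have h1 : |t.1 j| ≤ T := ((norm_le_pi_norm t.1 j).trans (norm_fst_le t)).trans (hT t ht)
    have h2 : 0 ≤ M' := (norm_nonneg _).trans (hM' j t ht)
    gcongr
  rwa [Finset.sum_const, Finset.card_univ, Fintype.card_fin, nsmul_eq_mul] at this

theorem norm_fderiv_picardScalar_le (hΘ : IsAccessible Θ) (hU : IsOpen U)
    (hG : ContDiffOn ℝ 1 G U) (hΘU : ∀ t ∈ Θ, t.2 ∈ U) (hT : ∀ t ∈ Θ, ‖t‖ ≤ T)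
    (hh : ∀ j, ContDiffOn ℝ 1 (h j) Θ) {C M M' : ℝ} (hC : ∀ t ∈ Θ, ‖fderiv ℝ G t.2‖ ≤ C)
    (hM : ∀ j, ∀ t ∈ Θ, |h j t| ≤ M) (hM' : ∀ j, ∀ t ∈ Θ, ‖fderiv ℝ (h j) t‖ ≤ M')
    {t : Params n p} (ht : t ∈ Θ) :
    ‖fderiv ℝ (picardScalar G h) t‖ ≤ C + p * (M + T * M') := by
  rw [fderiv_picardScalar hΘ hU hG hΘU hh ht]
  refine (norm_add_le _ _).trans (add_le_add ?_ (norm_sum_fderiv_pathInt_le hΘ hT hh hM hM' ht))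
  refine (ContinuousLinearMap.opNorm_comp_le _ _).trans ?_
  have h1 := ContinuousLinearMap.norm_snd_le ℝ (Fin p → ℝ) (Fin (n - p) → ℝ)
  calc _ ≤ ‖fderiv ℝ G t.2‖ * 1 := by gcongr
    _ ≤ C := by rw [mul_one]; exact hC t ht

/-- The data cancel. Only `d'` is multiplied by the small `T`, while `d` enters without it;
therefore derivatives are contracted only up to an error controlled by the uniform distance. -/
theorem norm_fderiv_picardScalar_sub_le (hΘ : IsAccessible Θ) (hU : IsOpen U)
    (hG : ContDiffOn ℝ 1 G U) (hΘU : ∀ t ∈ Θ, t.2 ∈ U) (hT : ∀ t ∈ Θ, ‖t‖ ≤ T)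
    (hh₁ : ∀ j, ContDiffOn ℝ 1 (h₁ j) Θ) (hh₂ : ∀ j, ContDiffOn ℝ 1 (h₂ j) Θ) {d d' : ℝ}
    (hd : ∀ j, ∀ t ∈ Θ, |h₁ j t - h₂ j t| ≤ d)
    (hd' : ∀ j, ∀ t ∈ Θ, ‖fderiv ℝ (h₁ j) t - fderiv ℝ (h₂ j) t‖ ≤ d')
    {t : Params n p} (ht : t ∈ Θ) :
    ‖fderiv ℝ (picardScalar G h₁) t - fderiv ℝ (picardScalar G h₂) t‖ ≤ p * (d + T * d') := by
  have hdiff : ∀ {h : Fin p → Params n p → ℝ}, (∀ j, ContDiffOn ℝ 1 (h j) Θ) → ∀ j, ∀ t ∈ Θ,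
      DifferentiableAt ℝ (h j) t := fun hh j t ht =>
    ((hh j).differentiableOn one_ne_zero).differentiableAt (hΘ.1.mem_nhds ht)
  have hsub : ∀ j, ContDiffOn ℝ 1 (fun t => h₁ j t - h₂ j t) Θ := fun j => (hh₁ j).sub (hh₂ j)
  have key : ∀ j, fderiv ℝ (pathInt j fun t => h₁ j t - h₂ j t) t
      = fderiv ℝ (pathInt j (h₁ j)) t - fderiv ℝ (pathInt j (h₂ j)) t := by
    intro j
    have hev : (pathInt j fun t => h₁ j t - h₂ j t) =ᶠ[𝓝 t]
        fun t => pathInt j (h₁ j) t - pathInt j (h₂ j) t := by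
      filter_upwards [hΘ.1.mem_nhds ht] with t ht
      exact pathInt_sub hΘ (hh₁ j).continuousOn (hh₂ j).continuousOn j ht
    rw [hev.fderiv_eq]
    exact fderiv_fun_sub (hasFDerivAt_pathInt hΘ (hh₁ j) j ht).differentiableAt
      (hasFDerivAt_pathInt hΘ (hh₂ j) j ht).differentiableAt
  rw [fderiv_picardScalar hΘ hU hG hΘU hh₁ ht, fderiv_picardScalar hΘ hU hG hΘU hh₂ ht,
    add_sub_add_left_eq_sub, ← Finset.sum_sub_distrib, ← Finset.sum_congr rfl fun j _ => key j]
  refine norm_sum_fderiv_pathInt_le hΘ hT hsub hd (fun j t ht => ?_) ht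
  rw [fderiv_fun_sub (hdiff hh₁ j t ht) (hdiff hh₂ j t ht)]
  exact hd' j t ht

/-- On the slice, the earlier integrals do not see `t_j` and the later ones vanish to the relevant
order with their own flow times. Only the `j`-th remains, and it contributes its integrand. -/
theorem fderiv_picardScalar_axis (hΘ : IsAccessible Θ) (hU : IsOpen U)
    (hG : ContDiffOn ℝ 1 G U) (hΘU : ∀ t ∈ Θ, t.2 ∈ U)
    (hh : ∀ j, ContDiffOn ℝ 1 (h j) Θ) {t : Params n p} (ht : t ∈ Θ) {j : Fin p}
    (h0 : ∀ l, j < l → t.1 l = 0) : fderiv ℝ (picardScalar G h) t (axis n j) = h j t := by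
  rw [fderiv_picardScalar hΘ hU hG hΘU hh ht]
  have : ∀ l, l ≠ j → fderiv ℝ (pathInt l (h l)) t (axis n j) = 0 := by
    intro l hl
    rcases lt_or_gt_of_ne hl with hl | hl
    · exact fderiv_pathInt_axis_of_lt hΘ (hh l) hl ht
    · exact fderiv_pathInt_axis_of_gt hΘ (hh l) hl ht (h0 l hl)
  simp only [_root_.add_apply, ContinuousLinearMap.comp_apply, _root_.sum_apply]
  rw [Finset.sum_eq_single j (fun l _ hl => this l hl) (by simp),
    fderiv_pathInt_axis_self hΘ (hh j) ht h0]
  simp [axis]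

/-- Each path integral is the increment of `H` between consecutive vertices, and the increments
telescope. -/
theorem picardScalar_eq (hΘ : IsAccessible Θ) {H : Params n p → ℝ} (hH : DifferentiableOn ℝ H Θ)
    (hh : ∀ j, ContinuousOn (h j) Θ)
    (hw : ∀ j, ∀ t ∈ Θ, (∀ l, j < l → t.1 l = 0) → fderiv ℝ H t (axis n j) = h j t)
    {t : Params n p} (ht : t ∈ Θ) (h0 : H (vertex t 0) = G t.2) : picardScalar G h t = H t := by
  unfold picardScalar
  rw [Finset.sum_congr rfl fun j _ => pathInt_eq_sub hΘ hH (hh j) (hw j) ht,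
    Fin.sum_univ_eq_sum_range (fun j => H (vertex t (j + 1)) - H (vertex t j)) p,
    Finset.sum_range_sub (fun j => H (vertex t j)), vertex_last, h0]
  ring

end PicardScalar

/-! ### A contraction principle for `C¹` functions -/

/-- Let `Φ` preserve the `C¹` functions `u : D → B` with derivative bounded by `K`, let it be a
contraction in the uniform norm, and let it contract the distance of the derivatives of `u` and `v`
up to an error that is small when `u` and `v` are uniformly close. Then `Φ` has a `C¹` fixed
point. -/
theorem exists_contDiffOn_fixedPoint {E F : Type*} [NormedAddCommGroup E] [NormedSpace ℝ E]
    [NormedAddCommGroup F] [NormedSpace ℝ F] [CompleteSpace F] {D : Set E} (hD : IsOpen D)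
    {B : Set F} (hB : IsClosed B) {R K : ℝ} (hR : ∀ x ∈ B, ∀ y ∈ B, ‖x - y‖ ≤ R)
    {Φ : (E → F) → (E → F)} {S : (E → F) → Prop}
    (hS : ∀ u, S u ↔ ContDiffOn ℝ 1 u D ∧ MapsTo u D B ∧ ∀ x ∈ D, ‖fderiv ℝ u x‖ ≤ K)
    (hΦ : ∀ u, S u → S (Φ u))
    (hcontr : ∀ u v, S u → S v → ∀ d, (∀ x ∈ D, ‖u x - v x‖ ≤ d) →
      ∀ x ∈ D, ‖Φ u x - Φ v x‖ ≤ d / 2)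
    (hcontr' : ∀ η > 0, ∃ d > 0, ∀ u v, S u → S v → (∀ x ∈ D, ‖u x - v x‖ ≤ d) →
      ∀ d', (∀ x ∈ D, ‖fderiv ℝ u x - fderiv ℝ v x‖ ≤ d') →
        ∀ x ∈ D, ‖fderiv ℝ (Φ u) x - fderiv ℝ (Φ v) x‖ ≤ η + d' / 2)
    {u₀ : E → F} (hu₀ : S u₀) :
    ∃ u, S u ∧ ∀ x ∈ D, Φ u x = u x := by
  set f : ℕ → E → F := fun k => Φ^[k] u₀ with hf
  have hfs : ∀ k, f (k + 1) = Φ (f k) := fun k => Function.iterate_succ_apply' Φ k u₀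
  have hfS : ∀ k, S (f k) := by
    intro k
    induction k with
    | zero => exact hu₀
    | succ k ih => rw [hfs]; exact hΦ _ ih
  have hfS' := fun k => (hS _).1 (hfS k)
  have hdist : ∀ i k l, i ≤ k → i ≤ l → ∀ x ∈ D, ‖f k x - f l x‖ ≤ R / 2 ^ i := by
    intro i
    induction i with
    | zero =>
      intro k l _ _ x hx
      simpa using hR _ ((hfS' k).2.1 hx) _ ((hfS' l).2.1 hx)
    | succ i ih =>
      intro k l hk hl x hx
      obtain ⟨k, rfl⟩ := Nat.exists_eq_succ_of_ne_zero (by omega : k ≠ 0)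
      obtain ⟨l, rfl⟩ := Nat.exists_eq_succ_of_ne_zero (by omega : l ≠ 0)
      have := hcontr _ _ (hfS k) (hfS l) _ (ih k l (by omega) (by omega)) x hx
      rw [Nat.succ_eq_add_one, Nat.succ_eq_add_one, hfs, hfs]
      calc _ ≤ R / 2 ^ i / 2 := this
        _ = _ := by rw [pow_succ, div_div]
  have hsmall : ∀ (c : ℝ), ∀ ε > 0, ∃ i : ℕ, c / 2 ^ i < ε := by
    intro c ε hε
    have : Tendsto (fun i : ℕ => c * (1 / 2 : ℝ) ^ i) atTop (𝓝 (c * 0)) :=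
      (tendsto_pow_atTop_nhds_zero_of_lt_one (by norm_num) (by norm_num)).const_mul c
    rw [mul_zero] at this
    obtain ⟨i, hi⟩ := (this.eventually_lt_const hε).exists
    exact ⟨i, by simpa [div_eq_mul_inv] using hi⟩
  have hcauchy : UniformCauchySeqOn f atTop D := by
    rw [Metric.uniformCauchySeqOn_iff]
    intro ε hε
    obtain ⟨i, hi⟩ := hsmall R ε hε
    exact ⟨i, fun k hk l hl x hx => by
      rw [dist_eq_norm]; exact (hdist i k l hk hl x hx).trans_lt hi⟩
  have hcauchy' : UniformCauchySeqOn (fun k => fderiv ℝ (f k)) atTop D := by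
    rw [Metric.uniformCauchySeqOn_iff]
    intro ε hε
    obtain ⟨d, hd, hdc⟩ := hcontr' (ε / 4) (by positivity)
    obtain ⟨N, hN⟩ := hsmall R d hd
    -- After `N` iterations the functions are `d`-close. From then on each step sends a bound `b` to
    -- `ε/4 + b/2`, whose fixed point is `ε/2`; the excess starts below `2 K` and is halved each
    -- time.
    have key : ∀ i k l, N + i ≤ k → N + i ≤ l → ∀ x ∈ D,
        ‖fderiv ℝ (f k) x - fderiv ℝ (f l) x‖ ≤ ε / 2 + 2 * K / 2 ^ i := by
      intro i
      induction i with
      | zero =>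
        intro k l _ _ x hx
        have h1 := (hfS' k).2.2 x hx
        have h2 := (hfS' l).2.2 x hx
        have h3 := norm_sub_le (fderiv ℝ (f k) x) (fderiv ℝ (f l) x)
        simp only [pow_zero, div_one]
        linarith
      | succ i ih =>
        intro k l hk hl x hx
        obtain ⟨k, rfl⟩ := Nat.exists_eq_succ_of_ne_zero (by omega : k ≠ 0)
        obtain ⟨l, rfl⟩ := Nat.exists_eq_succ_of_ne_zero (by omega : l ≠ 0)
        have := hdc _ _ (hfS k) (hfS l)
          (fun y hy => (hdist N k l (by omega) (by omega) y hy).trans hN.le) _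
          (ih k l (by omega) (by omega)) x hx
        rw [Nat.succ_eq_add_one, Nat.succ_eq_add_one, hfs, hfs]
        calc _ ≤ ε / 4 + (ε / 2 + 2 * K / 2 ^ i) / 2 := this
          _ = _ := by rw [pow_succ]; ring
    obtain ⟨i, hi⟩ := hsmall (2 * K) (ε / 2) (by positivity)
    exact ⟨N + i, fun k hk l hl x hx => by
      rw [dist_eq_norm]; linarith [key i k l hk hl x hx]⟩
  have hlim : ∀ x, ∃ y, x ∈ D → Tendsto (fun k => f k x) atTop (𝓝 y) := by
    intro x
    by_cases hx : x ∈ D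
    · obtain ⟨y, hy⟩ := cauchySeq_tendsto_of_complete (hcauchy.cauchySeq hx)
      exact ⟨y, fun _ => hy⟩
    · exact ⟨0, fun h => absurd h hx⟩
  have hlim' : ∀ x, ∃ A, x ∈ D → Tendsto (fun k => fderiv ℝ (f k) x) atTop (𝓝 A) := by
    intro x
    by_cases hx : x ∈ D
    · obtain ⟨y, hy⟩ := cauchySeq_tendsto_of_complete (hcauchy'.cauchySeq hx)
      exact ⟨y, fun _ => hy⟩
    · exact ⟨0, fun h => absurd h hx⟩
  choose u hu using hlim
  choose A hA using hlim'
  have hunif' : TendstoUniformlyOn (fun k => fderiv ℝ (f k)) A atTop D :=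
    hcauchy'.tendstoUniformlyOn_of_tendsto fun x hx => hA x hx
  have hdf : ∀ k x, x ∈ D → HasFDerivAt (f k) (fderiv ℝ (f k) x) x := fun k x hx =>
    (((hfS' k).1.differentiableOn one_ne_zero).differentiableAt (hD.mem_nhds hx)).hasFDerivAt
  have hder : ∀ x ∈ D, HasFDerivAt u (A x) x := fun x hx =>
    hasFDerivAt_of_tendstoUniformlyOn hD hunif' hdf hu hx
  have hAc : ContinuousOn A D := hunif'.continuousOn (Frequently.of_forall fun k =>
    (hfS' k).1.continuousOn_fderiv_of_isOpen hD le_rfl)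
  have huS : S u := by
    rw [hS]
    refine ⟨?_, fun x hx => ?_, fun x hx => ?_⟩
    · rw [← zero_add (1 : WithTop ℕ∞), contDiffOn_succ_iff_fderiv_of_isOpen hD]
      exact ⟨fun x hx => (hder x hx).differentiableAt.differentiableWithinAt, by simp,
        contDiffOn_zero.2 (hAc.congr fun x hx => (hder x hx).fderiv)⟩
    · exact hB.mem_of_tendsto (hu x hx) (Eventually.of_forall fun k => (hfS' k).2.1 hx)
    · rw [(hder x hx).fderiv]
      exact le_of_tendsto (hA x hx).norm (Eventually.of_forall fun k => (hfS' k).2.2 x hx)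
  refine ⟨u, huS, fun x hx => ?_⟩
  have hulim : ∀ i, ∀ y ∈ D, ‖f i y - u y‖ ≤ R / 2 ^ i := fun i y hy =>
    le_of_tendsto ((tendsto_const_nhds.sub (hu y hy)).norm)
      ((eventually_ge_atTop i).mono fun l hl => hdist i i l le_rfl hl y hy)
  have hΦlim : Tendsto (fun k => f (k + 1) x) atTop (𝓝 (Φ u x)) := by
    rw [tendsto_iff_norm_sub_tendsto_zero]
    have h0 : Tendsto (fun i : ℕ => R * (1 / 2 : ℝ) ^ i / 2) atTop (𝓝 (R * 0 / 2)) :=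
      ((tendsto_pow_atTop_nhds_zero_of_lt_one (by norm_num) (by norm_num)).const_mul R).div_const 2
    rw [mul_zero, zero_div] at h0
    refine squeeze_zero (fun k => norm_nonneg _) (fun k => ?_) h0
    rw [hfs]
    have := hcontr _ _ (hfS k) huS _ (hulim k) x hx
    simpa [div_eq_mul_inv] using this
  exact tendsto_nhds_unique hΦlim ((hu x hx).comp (tendsto_add_atTop_nat 1))

/-! ### The integral operator of the system -/

/-- The integral operator whose fixed points are the solutions of the system. -/
noncomputable def picard {n m : ℕ} {p : Fin m → ℕ} (ψ : ∀ α, Params n (p α) → (Fin n → ℝ))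
    (φ : ∀ α, (Fin n → ℝ) → Params n (p α)) (G : ∀ α, (Fin (n - p α) → ℝ) → ℝ)
    (F : ∀ α, Fin (p α) → (Fin n → ℝ) × (Fin m → ℝ) → ℝ) (u : (Fin n → ℝ) → (Fin m → ℝ))
    (x : Fin n → ℝ) : Fin m → ℝ :=
  fun α => picardScalar (G α) (fun j t => F α j (ψ α t, u (ψ α t))) (φ α x)

/-- Adapted charts with a common small image `D`, together with data and right-hand sides that
obey the estimates that make the integral operator a contraction. -/
structure PicardSetting {n m : ℕ} {p : Fin m → ℕ}
    (X : ∀ α, Fin (p α) → (Fin n → ℝ) → (Fin n → ℝ)) (U : ∀ α, Set (Fin (n - p α) → ℝ))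
    (ξ : ∀ α, (Fin (n - p α) → ℝ) → (Fin n → ℝ)) (Θ : ∀ α, Set (Params n (p α)))
    (D : Set (Fin n → ℝ)) (ψ : ∀ α, Params n (p α) → (Fin n → ℝ))
    (φ : ∀ α, (Fin n → ℝ) → Params n (p α)) (G : ∀ α, (Fin (n - p α) → ℝ) → ℝ)
    (F : ∀ α, Fin (p α) → (Fin n → ℝ) × (Fin m → ℝ) → ℝ) (Υ : Set (Fin m → ℝ))
    (c : Fin m → ℝ) (ρ P T M L C : ℝ) : Prop where
  chart : ∀ α, AdaptedChart (X α) (U α) (ξ α) (Θ α) D (ψ α) (φ α)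
  isOpen_U : ∀ α, IsOpen (U α)
  isOpen_Υ : IsOpen Υ
  contDiffOn_G : ∀ α, ContDiffOn ℝ 1 (G α) (U α)
  contDiffOn_F : ∀ α j, ContDiffOn ℝ 1 (F α j) (D ×ˢ Υ)
  closedBall_subset : Metric.closedBall c ρ ⊆ Υ
  abs_F_le : ∀ α j, ∀ x ∈ D, ∀ w ∈ Υ, |F α j (x, w)| ≤ M
  abs_F_sub_le : ∀ α j, ∀ x ∈ D, ∀ w ∈ Υ, ∀ w' ∈ Υ, |F α j (x, w) - F α j (x, w')| ≤ L * ‖w - w'‖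
  norm_fderiv_F_le : ∀ α j, ∀ x ∈ D, ∀ w ∈ Metric.closedBall c ρ, ‖fderiv ℝ (F α j) (x, w)‖ ≤ C
  modulus : ∀ η > 0, ∃ d > 0, ∀ α j, ∀ x ∈ D, ∀ w ∈ Metric.closedBall c ρ,
    ∀ w' ∈ Metric.closedBall c ρ, ‖w - w'‖ ≤ d →
      ‖fderiv ℝ (F α j) (x, w) - fderiv ℝ (F α j) (x, w')‖ ≤ η
  norm_le : ∀ α, ∀ t ∈ Θ α, ‖t‖ ≤ T
  norm_fderiv_ψ_le : ∀ α, ∀ t ∈ Θ α, ‖fderiv ℝ (ψ α) t‖ ≤ C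
  norm_fderiv_φ_le : ∀ α, ∀ x ∈ D, ‖fderiv ℝ (φ α) x‖ ≤ C
  norm_fderiv_G_le : ∀ α, ∀ t ∈ Θ α, ‖fderiv ℝ (G α) t.2‖ ≤ C
  abs_G_sub_le : ∀ α, ∀ t ∈ Θ α, |G α t.2 - c α| ≤ ρ / 2
  le_P : ∀ α, (p α : ℝ) ≤ P
  pos_P : 0 < P
  pos_ρ : 0 < ρ
  pos_T : 0 < T
  pos_M : 0 < M
  pos_L : 0 < L
  pos_C : 0 < C
  -- The three smallness conditions keep the values in the closed ball, contract the uniform norm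
  -- and contract the derivatives. In the third, the factors `C` come from the derivatives of `F`,
  -- `ψ` and `φ`.
  small_M : P * (T * M) ≤ ρ / 2
  small_L : P * (T * L) ≤ 1 / 2
  small_C : P * (T * (C * C)) * C ≤ 1 / 2

section Picard

variable {n m : ℕ} {p : Fin m → ℕ}
  {X : ∀ α, Fin (p α) → (Fin n → ℝ) → (Fin n → ℝ)} {U : ∀ α, Set (Fin (n - p α) → ℝ)}
  {ξ : ∀ α, (Fin (n - p α) → ℝ) → (Fin n → ℝ)} {Θ : ∀ α, Set (Params n (p α))}
  {D : Set (Fin n → ℝ)} {ψ : ∀ α, Params n (p α) → (Fin n → ℝ)}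
  {φ : ∀ α, (Fin n → ℝ) → Params n (p α)} {G : ∀ α, (Fin (n - p α) → ℝ) → ℝ}
  {F : ∀ α, Fin (p α) → (Fin n → ℝ) × (Fin m → ℝ) → ℝ} {Υ : Set (Fin m → ℝ)}
  {c : Fin m → ℝ} {ρ P T M L C : ℝ} {u v : (Fin n → ℝ) → (Fin m → ℝ)}

theorem PicardSetting.continuousOn_integrand (S : PicardSetting X U ξ Θ D ψ φ G F Υ c ρ P T M L C)
    (hu : ContinuousOn u D) (hu' : MapsTo u D Υ) (α : Fin m) (j : Fin (p α)) :
    ContinuousOn (fun t => F α j (ψ α t, u (ψ α t))) (Θ α) :=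
  (S.contDiffOn_F α j).continuousOn.comp
    ((S.chart α).contDiffOn.continuousOn.prodMk
      (hu.comp (S.chart α).contDiffOn.continuousOn (S.chart α).mapsTo))
    fun _ ht => ⟨(S.chart α).mapsTo ht, hu' ((S.chart α).mapsTo ht)⟩

theorem PicardSetting.contDiffOn_integrand (S : PicardSetting X U ξ Θ D ψ φ G F Υ c ρ P T M L C)
    (hu : ContDiffOn ℝ 1 u D) (hu' : MapsTo u D Υ) (α : Fin m) (j : Fin (p α)) :
    ContDiffOn ℝ 1 (fun t => F α j (ψ α t, u (ψ α t))) (Θ α) :=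
  (S.contDiffOn_F α j).comp
    ((S.chart α).contDiffOn.prodMk (hu.comp (S.chart α).contDiffOn (S.chart α).mapsTo))
    fun _ ht => ⟨(S.chart α).mapsTo ht, hu' ((S.chart α).mapsTo ht)⟩

theorem PicardSetting.fderiv_integrand (S : PicardSetting X U ξ Θ D ψ φ G F Υ c ρ P T M L C)
    (hu : ContDiffOn ℝ 1 u D) (hu' : MapsTo u D Υ) (α : Fin m) (j : Fin (p α))
    {t : Params n (p α)} (ht : t ∈ Θ α) :
    fderiv ℝ (fun t => F α j (ψ α t, u (ψ α t))) t
      = (fderiv ℝ (F α j) (ψ α t, u (ψ α t))).comp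
        ((fderiv ℝ (ψ α) t).prod ((fderiv ℝ u (ψ α t)).comp (fderiv ℝ (ψ α) t))) := by
  have hm := (S.chart α).mapsTo ht
  have hopen : IsOpen (D ×ˢ Υ) := (S.chart α).isOpen_image.prod S.isOpen_Υ
  have h1 : HasFDerivAt (F α j) (fderiv ℝ (F α j) (ψ α t, u (ψ α t))) (ψ α t, u (ψ α t)) :=
    (((S.contDiffOn_F α j).differentiableOn one_ne_zero).differentiableAt
      (hopen.mem_nhds ⟨hm, hu' hm⟩)).hasFDerivAt
  have h2 := ((S.chart α).differentiableAt ht).hasFDerivAt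
  have h3 : HasFDerivAt u (fderiv ℝ u (ψ α t)) (ψ α t) :=
    ((hu.differentiableOn one_ne_zero).differentiableAt
      ((S.chart α).isOpen_image.mem_nhds hm)).hasFDerivAt
  exact (h1.comp t (h2.prodMk (h3.comp t h2))).fderiv

theorem PicardSetting.norm_prod_le (S : PicardSetting X U ξ Θ D ψ φ G F Υ c ρ P T M L C)
    {α : Fin m} {t : Params n (p α)} (ht : t ∈ Θ α) {A : (Fin n → ℝ) →L[ℝ] (Fin m → ℝ)} {K : ℝ}
    (hA : ‖A‖ ≤ K) : ‖(fderiv ℝ (ψ α) t).prod (A.comp (fderiv ℝ (ψ α) t))‖ ≤ (1 + K) * C := by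
  have hC := S.norm_fderiv_ψ_le α t ht
  have hK : 0 ≤ K := (norm_nonneg _).trans hA
  have hC0 := S.pos_C
  rw [ContinuousLinearMap.opNorm_prod, Prod.norm_def]
  refine max_le (hC.trans (by nlinarith)) ?_
  refine (ContinuousLinearMap.opNorm_comp_le _ _).trans ?_
  calc ‖A‖ * ‖fderiv ℝ (ψ α) t‖ ≤ K * C := by gcongr
    _ ≤ _ := by nlinarith

/-- It suffices that `u` is `Υ`-valued. Hence every `Υ`-valued fixed point automatically lies in the
ball, which makes uniqueness hold without a bound on the competitor. -/
theorem PicardSetting.picard_mem (S : PicardSetting X U ξ Θ D ψ φ G F Υ c ρ P T M L C)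
    (hu' : MapsTo u D Υ) {x : Fin n → ℝ} (hx : x ∈ D) :
    picard ψ φ G F u x ∈ Metric.closedBall c ρ := by
  rw [mem_closedBall_iff_norm, pi_norm_le_iff_of_nonneg S.pos_ρ.le]
  intro α
  have ht := (S.chart α).mapsTo_inv hx
  have h1 := abs_picardScalar_sub_le (G := G α) (S.chart α).accessible (S.norm_le α)
    (h := fun j t => F α j (ψ α t, u (ψ α t)))
    (fun j t ht => S.abs_F_le α j _ ((S.chart α).mapsTo ht) _ (hu' ((S.chart α).mapsTo ht))) ht
  have h2 := S.abs_G_sub_le α _ ht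
  have h3 : (p α : ℝ) * (T * M) ≤ ρ / 2 := by
    have := mul_le_mul_of_nonneg_right (S.le_P α) (mul_pos S.pos_T S.pos_M).le
    linarith [S.small_M]
  have h4 := abs_sub_le (picard ψ φ G F u x α) (G α (φ α x).2) (c α)
  rw [Real.norm_eq_abs, Pi.sub_apply]
  change |picard ψ φ G F u x α - _| ≤ _ at h1
  linarith

theorem PicardSetting.norm_picard_sub_le (S : PicardSetting X U ξ Θ D ψ φ G F Υ c ρ P T M L C)
    (hu : ContinuousOn u D) (hu' : MapsTo u D Υ) (hv : ContinuousOn v D) (hv' : MapsTo v D Υ)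
    {d : ℝ} (hd : ∀ x ∈ D, ‖u x - v x‖ ≤ d) {x : Fin n → ℝ} (hx : x ∈ D) :
    ‖picard ψ φ G F u x - picard ψ φ G F v x‖ ≤ d / 2 := by
  have hd0 : 0 ≤ d := (norm_nonneg _).trans (hd x hx)
  rw [pi_norm_le_iff_of_nonneg (by positivity)]
  intro α
  have h1 := abs_picardScalar_sub_picardScalar_le (G := G α) (S.chart α).accessible (S.norm_le α)
    (S.continuousOn_integrand hu hu' α) (S.continuousOn_integrand hv hv' α) (d := L * d)
    (fun j t ht => (S.abs_F_sub_le α j _ ((S.chart α).mapsTo ht) _ (hu' ((S.chart α).mapsTo ht)) _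
      (hv' ((S.chart α).mapsTo ht))).trans
        (mul_le_mul_of_nonneg_left (hd _ ((S.chart α).mapsTo ht)) S.pos_L.le))
    ((S.chart α).mapsTo_inv hx)
  have h3 : (p α : ℝ) * (T * L) ≤ 1 / 2 := by
    have := mul_le_mul_of_nonneg_right (S.le_P α) (mul_pos S.pos_T S.pos_L).le
    linarith [S.small_L]
  rw [Real.norm_eq_abs, Pi.sub_apply]
  refine h1.trans ?_
  have := mul_le_mul_of_nonneg_right h3 hd0
  linarith

theorem PicardSetting.hasFDerivAt_picard (S : PicardSetting X U ξ Θ D ψ φ G F Υ c ρ P T M L C)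
    (hu : ContDiffOn ℝ 1 u D) (hu' : MapsTo u D Υ) {x : Fin n → ℝ} (hx : x ∈ D) :
    HasFDerivAt (picard ψ φ G F u) (ContinuousLinearMap.pi fun α =>
      (fderiv ℝ (picardScalar (G α) fun j t => F α j (ψ α t, u (ψ α t))) (φ α x)).comp
        (fderiv ℝ (φ α) x)) x := by
  refine hasFDerivAt_pi.2 fun α => ?_
  have ht := (S.chart α).mapsTo_inv hx
  have h1 := ((contDiffOn_picardScalar (S.chart α).accessible (S.contDiffOn_G α)
    (fun t ht => ((S.chart α).base_mem ht).1)
    (S.contDiffOn_integrand hu hu' α)).differentiableOn one_ne_zero).differentiableAt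
      ((S.chart α).accessible.1.mem_nhds ht)
  have h2 := ((S.chart α).contDiffOn_inv.differentiableOn one_ne_zero).differentiableAt
    ((S.chart α).isOpen_image.mem_nhds hx)
  exact h1.hasFDerivAt.comp x h2.hasFDerivAt

theorem PicardSetting.contDiffOn_picard (S : PicardSetting X U ξ Θ D ψ φ G F Υ c ρ P T M L C)
    (hu : ContDiffOn ℝ 1 u D) (hu' : MapsTo u D Υ) : ContDiffOn ℝ 1 (picard ψ φ G F u) D := by
  refine contDiffOn_pi.2 fun α => ?_
  exact (contDiffOn_picardScalar (S.chart α).accessible (S.contDiffOn_G α)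
    (fun t ht => ((S.chart α).base_mem ht).1) (S.contDiffOn_integrand hu hu' α)).comp
      (S.chart α).contDiffOn_inv (S.chart α).mapsTo_inv

theorem opNorm_pi_le {E : Type*} [NormedAddCommGroup E] [NormedSpace ℝ E] {m : ℕ}
    {A : Fin m → E →L[ℝ] ℝ} {K : ℝ} (hK : 0 ≤ K) (hA : ∀ α, ‖A α‖ ≤ K) :
    ‖ContinuousLinearMap.pi A‖ ≤ K :=
  ContinuousLinearMap.opNorm_le_bound _ hK fun x =>
    (pi_norm_le_iff_of_nonneg (by positivity)).2 fun α => (A α).le_of_opNorm_le (hA α) x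

/-- By `small_C`, a bound `K` for the derivative becomes `(C + P M) C + (1 + K) / 2`, and this is at
most `K` for the stated `K`. -/
theorem PicardSetting.norm_fderiv_picard_le
    (S : PicardSetting X U ξ Θ D ψ φ G F Υ c ρ P T M L C) (hu : ContDiffOn ℝ 1 u D)
    (hu' : MapsTo u D (Metric.closedBall c ρ)) {K : ℝ} (hK : 2 * ((C + P * M) * C) + 1 ≤ K)
    (huK : ∀ x ∈ D, ‖fderiv ℝ u x‖ ≤ K) {x : Fin n → ℝ} (hx : x ∈ D) :
    ‖fderiv ℝ (picard ψ φ G F u) x‖ ≤ K := by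
  have huΥ : MapsTo u D Υ := hu'.mono_right S.closedBall_subset
  have hC0 := S.pos_C
  have hT0 := S.pos_T
  have hM0 := S.pos_M
  have hP0 := S.pos_P
  have hK0 : 0 ≤ K := (norm_nonneg _).trans (huK x hx)
  rw [(S.hasFDerivAt_picard hu huΥ hx).fderiv]
  refine opNorm_pi_le hK0 fun α => ?_
  have h1 := norm_fderiv_picardScalar_le (S.chart α).accessible (S.isOpen_U α) (S.contDiffOn_G α)
    (fun t ht => ((S.chart α).base_mem ht).1) (S.norm_le α) (S.contDiffOn_integrand hu huΥ α)
    (S.norm_fderiv_G_le α) (M := M) (M' := C * ((1 + K) * C))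
    (fun j t ht => S.abs_F_le α j _ ((S.chart α).mapsTo ht) _ (huΥ ((S.chart α).mapsTo ht)))
    (fun j t ht => by
      rw [S.fderiv_integrand hu huΥ α j ht]
      refine (ContinuousLinearMap.opNorm_comp_le _ _).trans ?_
      have hm := (S.chart α).mapsTo ht
      exact mul_le_mul (S.norm_fderiv_F_le α j _ hm _ (hu' hm)) (S.norm_prod_le ht (huK _ hm))
        (norm_nonneg _) hC0.le) ((S.chart α).mapsTo_inv hx)
  refine (ContinuousLinearMap.opNorm_comp_le _ _).trans ?_
  have h2 := S.norm_fderiv_φ_le α x hx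
  have h3 : (p α : ℝ) * (M + T * (C * ((1 + K) * C))) ≤ P * (M + T * (C * ((1 + K) * C))) := by
    gcongr
    exact S.le_P α
  calc _ ≤ (C + P * (M + T * (C * ((1 + K) * C)))) * C :=
        mul_le_mul (h1.trans (by linarith)) h2 (norm_nonneg _) (by positivity)
    _ = (C + P * M) * C + (P * (T * (C * C)) * C) * (1 + K) := by ring
    _ ≤ (C + P * M) * C + 1 / 2 * (1 + K) := by gcongr; exact S.small_C
    _ ≤ K := by linarith

/-- The chain rule gives products, split as `A₁B₁ - A₂B₂ = (A₁ - A₂)B₁ + A₂(B₁ - B₂)`. The first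
part is small by the modulus of continuity of `dF`, which need not be Lipschitz; the second is
contracted by `small_C`. -/
theorem PicardSetting.norm_fderiv_picard_sub_le
    (S : PicardSetting X U ξ Θ D ψ φ G F Υ c ρ P T M L C) (hu : ContDiffOn ℝ 1 u D)
    (hu' : MapsTo u D (Metric.closedBall c ρ)) (hv : ContDiffOn ℝ 1 v D)
    (hv' : MapsTo v D (Metric.closedBall c ρ)) {K : ℝ} (huK : ∀ x ∈ D, ‖fderiv ℝ u x‖ ≤ K)
    {d d' η : ℝ} (hη0 : 0 ≤ η) (hd : ∀ x ∈ D, ‖u x - v x‖ ≤ d)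
    (hd' : ∀ x ∈ D, ‖fderiv ℝ u x - fderiv ℝ v x‖ ≤ d')
    (hη : ∀ α j, ∀ x ∈ D, ∀ w ∈ Metric.closedBall c ρ, ∀ w' ∈ Metric.closedBall c ρ,
      ‖w - w'‖ ≤ d → ‖fderiv ℝ (F α j) (x, w) - fderiv ℝ (F α j) (x, w')‖ ≤ η)
    {x : Fin n → ℝ} (hx : x ∈ D) :
    ‖fderiv ℝ (picard ψ φ G F u) x - fderiv ℝ (picard ψ φ G F v) x‖
      ≤ P * (L * d + T * (η * ((1 + K) * C))) * C + d' / 2 := by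
  have huΥ : MapsTo u D Υ := hu'.mono_right S.closedBall_subset
  have hvΥ : MapsTo v D Υ := hv'.mono_right S.closedBall_subset
  have hC0 := S.pos_C
  have hT0 := S.pos_T
  have hL0 := S.pos_L
  have hP0 := S.pos_P
  have hK0 : 0 ≤ K := (norm_nonneg _).trans (huK x hx)
  have hd0 : 0 ≤ d := (norm_nonneg _).trans (hd x hx)
  have hd'0 : 0 ≤ d' := (norm_nonneg _).trans (hd' x hx)
  rw [(S.hasFDerivAt_picard hu huΥ hx).fderiv, (S.hasFDerivAt_picard hv hvΥ hx).fderiv]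
  have hpi : ∀ A B : Fin m → (Fin n → ℝ) →L[ℝ] ℝ, ContinuousLinearMap.pi A
      - ContinuousLinearMap.pi B = ContinuousLinearMap.pi fun α => A α - B α := fun _ _ => rfl
  rw [hpi]
  refine opNorm_pi_le (by positivity) fun α => ?_
  rw [← ContinuousLinearMap.sub_comp]
  have h1 := norm_fderiv_picardScalar_sub_le (S.chart α).accessible (S.isOpen_U α)
    (S.contDiffOn_G α) (fun t ht => ((S.chart α).base_mem ht).1) (S.norm_le α)
    (S.contDiffOn_integrand hu huΥ α) (S.contDiffOn_integrand hv hvΥ α) (d := L * d)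
    (d' := η * ((1 + K) * C) + C * (d' * C))
    (fun j t ht => (S.abs_F_sub_le α j _ ((S.chart α).mapsTo ht) _ (huΥ ((S.chart α).mapsTo ht)) _
      (hvΥ ((S.chart α).mapsTo ht))).trans
        (mul_le_mul_of_nonneg_left (hd _ ((S.chart α).mapsTo ht)) S.pos_L.le))
    (fun j t ht => by
      have hm := (S.chart α).mapsTo ht
      rw [S.fderiv_integrand hu huΥ α j ht, S.fderiv_integrand hv hvΥ α j ht]
      set A₁ := fderiv ℝ (F α j) (ψ α t, u (ψ α t)) with hA₁
      set A₂ := fderiv ℝ (F α j) (ψ α t, v (ψ α t)) with hA₂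
      set J := fderiv ℝ (ψ α) t with hJ
      have e : A₁.comp (J.prod ((fderiv ℝ u (ψ α t)).comp J))
          - A₂.comp (J.prod ((fderiv ℝ v (ψ α t)).comp J))
          = (A₁ - A₂).comp (J.prod ((fderiv ℝ u (ψ α t)).comp J))
            + A₂.comp ((0 : Params n (p α) →L[ℝ] (Fin n → ℝ)).prod
              ((fderiv ℝ u (ψ α t) - fderiv ℝ v (ψ α t)).comp J)) := by
        refine ContinuousLinearMap.ext fun y => ?_
        have e1 : (J y, fderiv ℝ u (ψ α t) (J y)) = (J y, fderiv ℝ v (ψ α t) (J y))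
            + ((0 : Fin n → ℝ), fderiv ℝ u (ψ α t) (J y) - fderiv ℝ v (ψ α t) (J y)) := by
          simp
        simp only [_root_.sub_apply, _root_.add_apply, ContinuousLinearMap.comp_apply,
          ContinuousLinearMap.prod_apply, _root_.zero_apply]
        rw [e1, map_add, map_add]
        ring
      rw [e]
      refine (norm_add_le _ _).trans (add_le_add ?_ ?_)
      · refine (ContinuousLinearMap.opNorm_comp_le _ _).trans ?_
        exact mul_le_mul (hη α j _ hm _ (hu' hm) _ (hv' hm) (hd _ hm))
          (S.norm_prod_le ht (huK _ hm)) (norm_nonneg _) hη0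
      · refine (ContinuousLinearMap.opNorm_comp_le _ _).trans ?_
        refine mul_le_mul (S.norm_fderiv_F_le α j _ hm _ (hv' hm)) ?_ (norm_nonneg _) hC0.le
        rw [ContinuousLinearMap.opNorm_prod, Prod.norm_def]
        refine max_le (by simp only [norm_zero]; positivity) ?_
        refine (ContinuousLinearMap.opNorm_comp_le _ _).trans ?_
        exact mul_le_mul (hd' _ hm) (S.norm_fderiv_ψ_le α t ht) (norm_nonneg _) hd'0)
    ((S.chart α).mapsTo_inv hx)
  refine (ContinuousLinearMap.opNorm_comp_le _ _).trans ?_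
  have h2 := S.norm_fderiv_φ_le α x hx
  have h3 : (p α : ℝ) * (L * d + T * (η * ((1 + K) * C) + C * (d' * C)))
      ≤ P * (L * d + T * (η * ((1 + K) * C) + C * (d' * C))) := by
    gcongr
    exact S.le_P α
  calc _ ≤ (P * (L * d + T * (η * ((1 + K) * C) + C * (d' * C)))) * C :=
        mul_le_mul (h1.trans h3) h2 (norm_nonneg _) (by positivity)
    _ = P * (L * d + T * (η * ((1 + K) * C))) * C + (P * (T * (C * C)) * C) * d' := by ring
    _ ≤ P * (L * d + T * (η * ((1 + K) * C))) * C + 1 / 2 * d' := by gcongr; exact S.small_C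
    _ = _ := by ring

/-- The integral operator has a `C¹` fixed point with a bounded derivative. -/
theorem PicardSetting.exists_fixedPoint (S : PicardSetting X U ξ Θ D ψ φ G F Υ c ρ P T M L C)
    (hD : IsOpen D) :
    ∃ u, ContDiffOn ℝ 1 u D ∧ MapsTo u D (Metric.closedBall c ρ) ∧
      (∃ K, ∀ x ∈ D, ‖fderiv ℝ u x‖ ≤ K) ∧ ∀ x ∈ D, picard ψ φ G F u x = u x := by
  have hC0 := S.pos_C
  have hT0 := S.pos_T
  have hL0 := S.pos_L
  have hP0 := S.pos_P
  have hM0 := S.pos_M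
  set K : ℝ := 2 * ((C + P * M) * C) + 1 with hK
  have hK0 : 0 < K := by positivity
  obtain ⟨u, ⟨h1, h2, h3⟩, h4⟩ := exists_contDiffOn_fixedPoint hD
    (B := Metric.closedBall c ρ) Metric.isClosed_closedBall (R := ρ + ρ) (K := K)
    (fun x hx y hy => by
      rw [← dist_eq_norm]
      exact (dist_triangle_right x y c).trans (add_le_add hx hy))
    (Φ := picard ψ φ G F) (fun _ => Iff.rfl)
    (fun u hu => ⟨S.contDiffOn_picard hu.1 (hu.2.1.mono_right S.closedBall_subset),
      fun x hx => S.picard_mem (hu.2.1.mono_right S.closedBall_subset) hx,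
      fun x hx => S.norm_fderiv_picard_le hu.1 hu.2.1 le_rfl hu.2.2 hx⟩)
    (fun u v hu hv d hd x hx => S.norm_picard_sub_le hu.1.continuousOn
      (hu.2.1.mono_right S.closedBall_subset) hv.1.continuousOn
      (hv.2.1.mono_right S.closedBall_subset) hd hx)
    (fun η hη => by
      obtain ⟨μ, hμ0, hμ⟩ : ∃ μ > 0, P * (L * μ + T * (μ * ((1 + K) * C))) * C ≤ η :=
        exists_pos_le_of_continuousAt
          (f := fun μ => P * (L * μ + T * (μ * ((1 + K) * C))) * C) (by fun_prop) (by simpa using hη)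
      obtain ⟨d, hd0, hd⟩ := S.modulus μ hμ0
      refine ⟨min d μ, lt_min hd0 hμ0, fun u v hu hv huv d' hd' x hx => ?_⟩
      have := S.norm_fderiv_picard_sub_le hu.1 hu.2.1 hv.1 hv.2.1 hu.2.2 hμ0.le huv hd'
        (fun α j x hx w hw w' hw' hww => hd α j x hx w hw w' hw' (hww.trans (min_le_left _ _))) hx
      have h5 : P * (L * min d μ + T * (μ * ((1 + K) * C))) * C
          ≤ P * (L * μ + T * (μ * ((1 + K) * C))) * C := by
        gcongr
        exact min_le_right _ _
      linarith)
    (u₀ := fun _ => c)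
    ⟨contDiffOn_const, fun x _ => Metric.mem_closedBall_self S.pos_ρ.le, fun x _ => by
      rw [fderiv_fun_const]; simpa using hK0.le⟩
  exact ⟨u, h1, h2, ⟨K, h3⟩, h4⟩

/-- A contraction has at most one bounded fixed point. -/
theorem PicardSetting.fixedPoint_unique (S : PicardSetting X U ξ Θ D ψ φ G F Υ c ρ P T M L C)
    (hu : ContinuousOn u D) (hu' : MapsTo u D Υ) (hv : ContinuousOn v D) (hv' : MapsTo v D Υ)
    (hufix : ∀ x ∈ D, picard ψ φ G F u x = u x) (hvfix : ∀ x ∈ D, picard ψ φ G F v x = v x) :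
    EqOn v u D := by
  have hball : ∀ w : (Fin n → ℝ) → (Fin m → ℝ), MapsTo w D Υ →
      (∀ x ∈ D, picard ψ φ G F w x = w x) → ∀ x ∈ D, w x ∈ Metric.closedBall c ρ :=
    fun w hw hfix x hx => hfix x hx ▸ S.picard_mem hw hx
  have key : ∀ i : ℕ, ∀ x ∈ D, ‖v x - u x‖ ≤ (ρ + ρ) * (1 / 2) ^ i := by
    intro i
    induction i with
    | zero =>
      intro x hx
      rw [← dist_eq_norm, pow_zero, mul_one]
      exact (dist_triangle_right _ _ c).trans
        (add_le_add (hball v hv' hvfix x hx) (hball u hu' hufix x hx))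
    | succ i ih =>
      intro x hx
      have := S.norm_picard_sub_le hv hv' hu hu' ih hx
      rw [hufix x hx, hvfix x hx] at this
      rw [pow_succ]
      linarith
  intro x hx
  have h0 : Tendsto (fun i : ℕ => (ρ + ρ) * (1 / 2 : ℝ) ^ i) atTop (𝓝 ((ρ + ρ) * 0)) :=
    (tendsto_pow_atTop_nhds_zero_of_lt_one (by norm_num) (by norm_num)).const_mul _
  rw [mul_zero] at h0
  have := ge_of_tendsto h0 (Eventually.of_forall fun i => key i x hx)
  exact sub_eq_zero.1 (norm_le_zero_iff.1 this)

/-- In the charts, a fixed point has the prescribed derivatives on the slices. -/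
theorem PicardSetting.fderiv_fixedPoint_axis
    (S : PicardSetting X U ξ Θ D ψ φ G F Υ c ρ P T M L C) (hu : ContDiffOn ℝ 1 u D)
    (hu' : MapsTo u D Υ) (hufix : ∀ x ∈ D, picard ψ φ G F u x = u x) (α : Fin m) (j : Fin (p α))
    {t : Params n (p α)} (ht : t ∈ Θ α) (h0 : ∀ l, j < l → t.1 l = 0) :
    fderiv ℝ (fun t => u (ψ α t) α) t (axis n j) = F α j (ψ α t, u (ψ α t)) := by
  have hev : (fun t => u (ψ α t) α) =ᶠ[𝓝 t]
      picardScalar (G α) fun j t => F α j (ψ α t, u (ψ α t)) := by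
    filter_upwards [(S.chart α).accessible.1.mem_nhds ht] with t ht
    rw [← hufix _ ((S.chart α).mapsTo ht)]
    unfold picard
    rw [(S.chart α).invOn.1 ht]
  rw [hev.fderiv_eq]
  exact fderiv_picardScalar_axis (S.chart α).accessible (S.isOpen_U α) (S.contDiffOn_G α)
    (fun t ht => ((S.chart α).base_mem ht).1) (S.contDiffOn_integrand hu hu' α) ht h0

/-- A solution of the system is a fixed point of the integral operator. -/
theorem PicardSetting.picard_eq_of_solution
    (S : PicardSetting X U ξ Θ D ψ φ G F Υ c ρ P T M L C) (hv : ContDiffOn ℝ 1 v D)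
    (hv' : MapsTo v D Υ)
    (heq : ∀ α j, ∀ x ∈ D, fderiv ℝ (fun y => v y α) x (X α j x) = F α j (x, v x))
    (hdata : ∀ α, ∀ t ∈ Θ α, v (ξ α t.2) α = G α t.2) {x : Fin n → ℝ} (hx : x ∈ D) :
    picard ψ φ G F v x = v x := by
  ext α
  have ht := (S.chart α).mapsTo_inv hx
  have hvα : ContDiffOn ℝ 1 (fun y => v y α) D := contDiffOn_pi.1 hv α
  have := picardScalar_eq (G := G α) (h := fun j t => F α j (ψ α t, v (ψ α t)))
    (S.chart α).accessible (H := fun t => v (ψ α t) α)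
    (((S.chart α).contDiffOn_comp hvα).differentiableOn one_ne_zero)
    (S.continuousOn_integrand hv.continuousOn hv' α) (fun j t ht h0 => by
      rw [(S.chart α).fderiv_comp hvα ht, ContinuousLinearMap.comp_apply,
        (S.chart α).flow t ht j h0]
      exact heq α j _ ((S.chart α).mapsTo ht)) ht (by
      rw [((S.chart α).base_mem ht).2]
      exact hdata α _ ht)
  unfold picard
  rw [this]
  rw [(S.chart α).invOn.2 hx]

end Picard

/-! ### Coordinates with respect to a frame -/

section Frame

variable {n : ℕ} {Ω : Set (Fin n → ℝ)} {r : Fin n → (Fin n → ℝ) → (Fin n → ℝ)} {x : Fin n → ℝ}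

/-- The linear map that sends coefficients `a` to `∑ l, a l • r l x`. -/
noncomputable def frameMap (r : Fin n → (Fin n → ℝ) → (Fin n → ℝ)) (x : Fin n → ℝ) :
    (Fin n → ℝ) →L[ℝ] (Fin n → ℝ) :=
  ∑ l, (ContinuousLinearMap.proj l : (Fin n → ℝ) →L[ℝ] ℝ).smulRight (r l x)

/-- The coefficients of a vector with respect to the frame at `x`. -/
noncomputable def coframe (r : Fin n → (Fin n → ℝ) → (Fin n → ℝ)) (x : Fin n → ℝ) :
    (Fin n → ℝ) →L[ℝ] (Fin n → ℝ) :=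
  Ring.inverse (frameMap r x)

theorem frameMap_apply (a : Fin n → ℝ) : frameMap r x a = ∑ l, a l • r l x := by
  simp [frameMap]

theorem IsC1Frame.isUnit_frameMap (hr : IsC1Frame Ω r) (hx : x ∈ Ω) : IsUnit (frameMap r x) := by
  have hinj : Function.Injective (frameMap r x) := by
    rw [injective_iff_map_eq_zero]
    intro a ha
    rw [frameMap_apply] at ha
    exact funext (Fintype.linearIndependent_iff.1 (hr.2 x hx) a ha)
  rw [ContinuousLinearMap.isUnit_iff_bijective]
  exact ⟨hinj, LinearMap.injective_iff_surjective.1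
    (show Function.Injective (frameMap r x : (Fin n → ℝ) →ₗ[ℝ] (Fin n → ℝ)) from hinj)⟩

theorem IsC1Frame.coframe_frameMap (hr : IsC1Frame Ω r) (hx : x ∈ Ω) (a : Fin n → ℝ) :
    coframe r x (frameMap r x a) = a := by
  have := Ring.inverse_mul_cancel _ (hr.isUnit_frameMap hx)
  exact congrArg (fun A : (Fin n → ℝ) →L[ℝ] (Fin n → ℝ) => A a) this

theorem IsC1Frame.frameMap_coframe (hr : IsC1Frame Ω r) (hx : x ∈ Ω) (v : Fin n → ℝ) :
    frameMap r x (coframe r x v) = v := by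
  have := Ring.mul_inverse_cancel _ (hr.isUnit_frameMap hx)
  exact congrArg (fun A : (Fin n → ℝ) →L[ℝ] (Fin n → ℝ) => A v) this

theorem IsC1Frame.coframe_apply_frame (hr : IsC1Frame Ω r) (hx : x ∈ Ω) (l : Fin n) :
    coframe r x (r l x) = Pi.single l 1 := by
  rw [← hr.coframe_frameMap hx (Pi.single l 1), frameMap_apply]
  simp [Pi.single_apply]

theorem IsC1Frame.contDiffOn_frameMap (hr : IsC1Frame Ω r) : ContDiffOn ℝ 1 (frameMap r) Ω := by
  unfold frameMap
  refine ContDiffOn.sum fun l _ => ?_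
  exact ((ContinuousLinearMap.smulRightL ℝ (Fin n → ℝ) (Fin n → ℝ)
    (ContinuousLinearMap.proj l)).contDiff.comp_contDiffOn (hr.1 l))

theorem IsC1Frame.contDiffAt_coframe (hr : IsC1Frame Ω r) (hΩ : IsOpen Ω) (hx : x ∈ Ω) :
    ContDiffAt ℝ 1 (coframe r) x := by
  obtain ⟨A, hA⟩ := hr.isUnit_frameMap hx
  have h1 : ContDiffAt ℝ 1 Ring.inverse (frameMap r x) := hA ▸ contDiffAt_ringInverse ℝ A
  exact h1.comp x (hr.contDiffOn_frameMap.contDiffAt (hΩ.mem_nhds hx))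

theorem IsC1Frame.structureCoeff_eq (hr : IsC1Frame Ω r) (hx : x ∈ Ω) (i j k : Fin n) :
    structureCoeff r i j k x = coframe r x (VectorField.lieBracket ℝ (r i) (r j) x) k := by
  rw [lieBracket_eq_sum_structureCoeff hr hx, ← frameMap_apply (fun k => structureCoeff r i j k x),
    hr.coframe_frameMap hx]

theorem IsC1Frame.continuousAt_structureCoeff (hr : IsC1Frame Ω r) (hΩ : IsOpen Ω) (hx : x ∈ Ω)
    (i j k : Fin n) : ContinuousAt (structureCoeff r i j k) x := by
  have hev : structureCoeff r i j k =ᶠ[𝓝 x]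
      fun x => coframe r x (VectorField.lieBracket ℝ (r i) (r j) x) k := by
    filter_upwards [hΩ.mem_nhds hx] with y hy
    exact hr.structureCoeff_eq hy i j k
  rw [continuousAt_congr hev]
  have hd : ∀ l, ContinuousAt (fderiv ℝ (r l)) x := fun l =>
    ((hr.1 l).continuousOn_fderiv_of_isOpen hΩ le_rfl).continuousAt (hΩ.mem_nhds hx)
  have hc : ∀ l, ContinuousAt (r l) x := fun l => (hr.1 l).continuousOn.continuousAt
    (hΩ.mem_nhds hx)
  have hb : ContinuousAt (VectorField.lieBracket ℝ (r i) (r j)) x :=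
    ((hd j).clm_apply (hc i)).sub ((hd i).clm_apply (hc j))
  exact (continuous_apply k).continuousAt.comp
    (f := fun x => coframe r x (VectorField.lieBracket ℝ (r i) (r j) x))
    ((hr.contDiffAt_coframe hΩ hx).continuousAt.clm_apply hb)

/-- This turns involutivity into the vanishing of `c_{jl}^k` for `j, l ∈ I` and `k ∉ I`. -/
theorem IsC1Frame.coframe_eq_zero_of_mem_span (hr : IsC1Frame Ω r) (hx : x ∈ Ω)
    {I : Finset (Fin n)} {v : Fin n → ℝ}
    (hv : v ∈ Submodule.span ℝ ((fun i => r i x) '' (I : Set (Fin n)))) {k : Fin n} (hk : k ∉ I) :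
    coframe r x v k = 0 := by
  have hle : Submodule.span ℝ ((fun i => r i x) '' (I : Set (Fin n)))
      ≤ LinearMap.ker (((ContinuousLinearMap.proj k : (Fin n → ℝ) →L[ℝ] ℝ).comp (coframe r x) :
        (Fin n → ℝ) →L[ℝ] ℝ) : (Fin n → ℝ) →ₗ[ℝ] ℝ) := by
    refine Submodule.span_le.2 ?_
    rintro _ ⟨i, hi, rfl⟩
    have hne : k ≠ i := fun h => hk (h ▸ hi)
    simp [hr.coframe_apply_frame hx, hne]
  exact hle hv

end Frame

/-! ### Transport of the chart derivatives in frame coordinates -/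

section FrameChart

variable {n p : ℕ} {X : Fin p → (Fin n → ℝ) → (Fin n → ℝ)} {U : Set (Fin (n - p) → ℝ)}
  {ξ : (Fin (n - p) → ℝ) → (Fin n → ℝ)} {Θ : Set (Params n p)} {D Ω : Set (Fin n → ℝ)}
  {ψ : Params n p → (Fin n → ℝ)} {φ : (Fin n → ℝ) → Params n p}
  {r : Fin n → (Fin n → ℝ) → (Fin n → ℝ)}

/-- The coefficients of `∂ψ` in the direction `v` with respect to the frame. -/
noncomputable def chartCoeff (r : Fin n → (Fin n → ℝ) → (Fin n → ℝ))
    (ψ : Params n p → (Fin n → ℝ)) (v q : Params n p) : Fin n → ℝ :=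
  coframe r (ψ q) (fderiv ℝ ψ q v)

/-- Along the segments, the coefficients of `∂ψ` solve a linear equation whose coefficients are the
structure coefficients of the frame. -/
theorem AdaptedChart.hasDerivAt_chartCoeff (h : AdaptedChart X U ξ Θ D ψ φ)
    (hr : IsC1Frame Ω r) (hΩ : IsOpen Ω) (hDΩ : D ⊆ Ω) {j : Fin p} {i : Fin n} (hX : X j = r i)
    {v : Params n p} (hv : ∀ l, j < l → v.1 l = 0) {t : Params n p} (ht : t ∈ Θ) {s : ℝ}
    (hs : s ∈ Icc (0 : ℝ) 1) :
    HasDerivAt (fun s => chartCoeff r ψ v (seg n j s t))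
      (-(t.1 j • fun k => ∑ l, chartCoeff r ψ v (seg n j s t) l *
        structureCoeff r i l k (ψ (seg n j s t)))) s := by
  have hq := h.accessible.seg_mem ht j hs
  have hxD := h.mapsTo hq
  have hx := hDΩ hxD
  set x := ψ (seg n j s t) with hxdef
  set a := chartCoeff r ψ v (seg n j s t) with ha
  have hψ := h.hasDerivAt_seg ht j hs
  rw [hX] at hψ
  have hy := h.hasDerivAt_fderiv (j := j) (by rw [hX]; exact (hr.1 i).mono hDΩ) hv ht hs
  rw [hX] at hy
  have hB : HasDerivAt (fun s => coframe r (ψ (seg n j s t)))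
      (fderiv ℝ (coframe r) x (t.1 j • r i x)) s := by
    have hd : HasFDerivAt (coframe r) (fderiv ℝ (coframe r) x) (ψ (seg n j s t)) :=
      ((hr.contDiffAt_coframe hΩ hx).differentiableAt one_ne_zero).hasFDerivAt
    exact HasFDerivAt.comp_hasDerivAt (f := fun s => ψ (seg n j s t)) s hd hψ
  have hrl : ∀ l, HasDerivAt (fun s => r l (ψ (seg n j s t)))
      (fderiv ℝ (r l) x (t.1 j • r i x)) s := fun l =>
    (((hr.1 l).differentiableOn one_ne_zero).differentiableAt
      (hΩ.mem_nhds hx)).hasFDerivAt.comp_hasDerivAt s hψ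
  have hA' : HasDerivAt (fun s => chartCoeff r ψ v (seg n j s t)) _ s := hB.clm_apply hy
  set a' := (fderiv ℝ (coframe r) x (t.1 j • r i x)) (fderiv ℝ ψ (seg n j s t) v)
    + coframe r (ψ (seg n j s t)) (t.1 j • fderiv ℝ (r i) x (fderiv ℝ ψ (seg n j s t) v)) with ha'
  have hal : ∀ l, HasDerivAt (fun s => chartCoeff r ψ v (seg n j s t) l) (a' l) s :=
    hasDerivAt_pi.1 hA'
  -- The coefficients are differentiable because the coframe is `C¹`. Their derivative is identified
  -- without differentiating an inverse: differentiate `∂ψ · v = ∑ a_l r_l` and compare with the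
  -- linearized flow equation, which leaves the brackets `[r_i, r_l]`.
  have hprod : HasDerivAt (fun s => ∑ l, chartCoeff r ψ v (seg n j s t) l • r l (ψ (seg n j s t)))
      (∑ l, (a l • fderiv ℝ (r l) x (t.1 j • r i x) + a' l • r l x)) s :=
    HasDerivAt.fun_sum fun l _ => (hal l).smul (hrl l)
  have hyeq : (fun s => ∑ l, chartCoeff r ψ v (seg n j s t) l • r l (ψ (seg n j s t)))
      =ᶠ[𝓝[Icc 0 1] s] fun s => fderiv ℝ ψ (seg n j s t) v := by
    filter_upwards [self_mem_nhdsWithin] with σ hσ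
    rw [← frameMap_apply]
    exact hr.frameMap_coframe (hDΩ (h.mapsTo (h.accessible.seg_mem ht j hσ))) _
  have hat : fderiv ℝ ψ (seg n j s t) v = ∑ l, a l • r l x := by
    rw [← frameMap_apply]
    exact (hr.frameMap_coframe hx _).symm
  have hun : UniqueDiffWithinAt ℝ (Icc (0 : ℝ) 1) s := uniqueDiffOn_Icc zero_lt_one s hs
  have heq := hun.eq_deriv _ hprod.hasDerivWithinAt
    ((hy.hasDerivWithinAt (s := Icc 0 1)).congr_of_eventuallyEq hyeq
      (by rw [← frameMap_apply]; exact hr.frameMap_coframe hx _))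
  rw [hat, map_sum, Finset.sum_add_distrib] at heq
  have hframe : frameMap r x a' = frameMap r x
      (-(t.1 j • fun k => ∑ l, a l * structureCoeff r i l k x)) := by
    rw [frameMap_apply, eq_sub_of_add_eq' heq, map_neg, map_smul, frameMap_apply]
    have : ∑ k, (∑ l, a l * structureCoeff r i l k x) • r k x
        = ∑ l, a l • (fderiv ℝ (r l) x (r i x) - fderiv ℝ (r i) x (r l x)) := by
      simp only [Finset.sum_smul]
      rw [Finset.sum_comm]
      refine Finset.sum_congr rfl fun l _ => ?_
      have hb := lieBracket_eq_sum_structureCoeff hr hx i l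
      rw [VectorField.lieBracket] at hb
      rw [hb, Finset.smul_sum]
      exact Finset.sum_congr rfl fun k _ => by rw [smul_smul]
    rw [this, Finset.smul_sum, Finset.smul_sum, ← Finset.sum_sub_distrib, ← Finset.sum_neg_distrib]
    refine Finset.sum_congr rfl fun l _ => ?_
    rw [map_smul, map_smul]
    module
  have := congrArg (coframe r x) hframe
  rw [hr.coframe_frameMap hx, hr.coframe_frameMap hx] at this
  rw [← this]
  exact hA'

/-- By involutivity, `∂ψ/∂t_k` remains in the span of the vector fields of the flows. -/
theorem AdaptedChart.chartCoeff_eq_zero (h : AdaptedChart X U ξ Θ D ψ φ)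
    (hr : IsC1Frame Ω r) (hΩ : IsOpen Ω) (hDΩ : D ⊆ Ω) {I : Finset (Fin n)} {ι : Fin p → Fin n}
    (hι : ∀ j, ι j ∈ I) (hX : ∀ j, X j = r (ι j))
    (hinv : ∀ j ∈ I, ∀ k ∈ I, ∀ x ∈ Ω, VectorField.lieBracket ℝ (r j) (r k) x ∈
        Submodule.span ℝ ((fun i => r i x) '' (I : Set (Fin n))))
    {C T : ℝ} (hC : ∀ i l k, ∀ x ∈ D, |structureCoeff r i l k x| ≤ C) (hC0 : 0 ≤ C)
    (hT : ∀ t ∈ Θ, ‖t‖ ≤ T) (hT0 : 0 ≤ T) (hsmall : T * (n * C) ≤ 1 / 2)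
    {t : Params n p} (ht : t ∈ Θ) (k₀ : Fin p) {i : ℕ} (hi : (k₀ : ℕ) + 1 ≤ i) :
    i ≤ p → ∀ k ∉ I, chartCoeff r ψ (axis n k₀) (vertex t i) k = 0 := by
  induction i, hi using Nat.le_induction with
  | base =>
    intro hp k hk
    have hm := h.accessible.vertex_mem ht hp
    unfold chartCoeff
    rw [h.flow _ hm k₀ fun l hl => vertex_fst_of_le t (by simpa using Fin.lt_def.1 hl), hX,
      hr.coframe_apply_frame (hDΩ (h.mapsTo hm))]
    have : k ≠ ι k₀ := fun e => hk (e ▸ hι k₀)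
    simp [this]
  | succ i hi ih =>
    intro hp
    set j : Fin p := ⟨i, hp⟩ with hj
    have hv : ∀ l, j < l → (axis n k₀).1 l = 0 := by
      intro l hl
      have : l ≠ k₀ := by
        rintro rfl
        have := Fin.lt_def.1 hl
        simp only [hj] at this
        omega
      simp [axis, this]
    set a : ℝ → Fin n → ℝ := fun s => chartCoeff r ψ (axis n k₀) (seg n j s t) with ha
    -- By involutivity the components outside `I` satisfy a closed homogeneous linear equation, so
    -- they remain zero along the segment.
    set b : ℝ → Fin n → ℝ := fun s k => if k ∈ I then 0 else a s k with hb
    set b' : ℝ → Fin n → ℝ := fun s k => if k ∈ I then 0 else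
      -(t.1 j * ∑ l, b s l * structureCoeff r (ι j) l k (ψ (seg n j s t))) with hb'
    have hbd : ∀ s ∈ Icc (0 : ℝ) 1, HasDerivAt b (b' s) s := by
      intro s hs
      rw [hasDerivAt_pi]
      intro k
      by_cases hk : k ∈ I
      · simp only [hb, hb', if_pos hk]
        exact hasDerivAt_const s 0
      · simp only [hb, hb', if_neg hk]
        have := hasDerivAt_pi.1 (h.hasDerivAt_chartCoeff hr hΩ hDΩ (hX j) hv ht hs) k
        refine this.congr_deriv ?_
        have hx := hDΩ (h.mapsTo (h.accessible.seg_mem ht j hs))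
        simp only [Pi.neg_apply, Pi.smul_apply, smul_eq_mul]
        congr 2
        refine Finset.sum_congr rfl fun l _ => ?_
        by_cases hl : l ∈ I
        · rw [hr.structureCoeff_eq hx,
            hr.coframe_eq_zero_of_mem_span hx (hinv _ (hι j) _ hl _ hx) hk]
          simp
        · simp [hl, ha]
    have hbound : ∀ s ∈ Icc (0 : ℝ) 1, ‖b' s‖ ≤ T * (n * C) * ‖b s‖ := by
      intro s hs
      rw [pi_norm_le_iff_of_nonneg (by positivity)]
      intro k
      by_cases hk : k ∈ I
      · simp only [hb', if_pos hk, norm_zero]; positivity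
      · simp only [hb', if_neg hk, norm_neg, norm_mul]
        have htj : ‖t.1 j‖ ≤ T := ((norm_le_pi_norm t.1 j).trans (norm_fst_le t)).trans (hT t ht)
        have hsum : ‖∑ l, b s l * structureCoeff r (ι j) l k (ψ (seg n j s t))‖
            ≤ ∑ _l : Fin n, ‖b s‖ * C := by
          refine norm_sum_le_of_le _ fun l _ => ?_
          rw [norm_mul]
          exact mul_le_mul (norm_le_pi_norm _ l)
            (hC _ _ _ _ (h.mapsTo (h.accessible.seg_mem ht j hs))) (norm_nonneg _) (norm_nonneg _)
        simp only [Finset.sum_const, Finset.card_univ, Fintype.card_fin, nsmul_eq_mul] at hsum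
        calc _ ≤ T * (n * (‖b s‖ * C)) := mul_le_mul htj hsum (norm_nonneg _) hT0
          _ = _ := by ring
    have h0 : b 0 = 0 := by
      ext k
      by_cases hk : k ∈ I
      · simp [hb, hk]
      · simp only [hb, if_neg hk, ha, seg_zero]
        exact ih (by omega) k hk
    have h1 := norm_sub_le_of_norm_deriv_le_mul (by positivity) hsmall hbd hbound
    rw [h0, sub_zero, norm_zero, mul_zero] at h1
    have h2 : b 1 = 0 := norm_le_zero_iff.1 h1
    intro k hk
    have := congrFun h2 k
    simp only [hb, if_neg hk, ha, seg_one] at this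
    exact this

end FrameChart

/-! ### The defect of a fixed point -/

section Partial

variable {n m : ℕ} {f : (Fin n → ℝ) → (Fin m → ℝ) → ℝ} {x : Fin n → ℝ} {w : Fin m → ℝ}

theorem partialU_eq
    (hf : DifferentiableAt ℝ (fun q : (Fin n → ℝ) × (Fin m → ℝ) => f q.1 q.2) (x, w)) (β : Fin m) :
    partialU f β x w
      = fderiv ℝ (fun q : (Fin n → ℝ) × (Fin m → ℝ) => f q.1 q.2) (x, w) (0, Pi.single β 1) := by
  have : HasFDerivAt (fun w => f x w)
      ((fderiv ℝ (fun q : (Fin n → ℝ) × (Fin m → ℝ) => f q.1 q.2) (x, w)).comp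
        (ContinuousLinearMap.inr ℝ (Fin n → ℝ) (Fin m → ℝ))) w :=
    hf.hasFDerivAt.comp w (hasFDerivAt_prodMk_right x w)
  rw [partialU, this.fderiv]
  rfl

theorem abs_partialU_le
    (hf : DifferentiableAt ℝ (fun q : (Fin n → ℝ) × (Fin m → ℝ) => f q.1 q.2) (x, w)) (β : Fin m) :
    |partialU f β x w|
      ≤ ‖fderiv ℝ (fun q : (Fin n → ℝ) × (Fin m → ℝ) => f q.1 q.2) (x, w)‖ := by
  rw [partialU_eq hf]
  refine ((fderiv ℝ (fun q : (Fin n → ℝ) × (Fin m → ℝ) => f q.1 q.2) (x, w)).le_opNorm _).trans ?_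
  have : ‖((0 : Fin n → ℝ), (Pi.single β 1 : Fin m → ℝ))‖ = 1 := by
    simp [Prod.norm_def, Pi.norm_single]
  rw [this, mul_one]

theorem fderiv_uncurry_apply
    (hf : DifferentiableAt ℝ (fun q : (Fin n → ℝ) × (Fin m → ℝ) => f q.1 q.2) (x, w))
    (v : Fin n → ℝ) (z : Fin m → ℝ) :
    fderiv ℝ (fun q : (Fin n → ℝ) × (Fin m → ℝ) => f q.1 q.2) (x, w) (v, z)
      = fderiv ℝ (fun y => f y w) x v + ∑ β, partialU f β x w * z β := by
  have h1 : HasFDerivAt (fun y => f y w)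
      ((fderiv ℝ (fun q : (Fin n → ℝ) × (Fin m → ℝ) => f q.1 q.2) (x, w)).comp
        (ContinuousLinearMap.inl ℝ (Fin n → ℝ) (Fin m → ℝ))) x :=
    HasFDerivAt.comp (g := fun q : (Fin n → ℝ) × (Fin m → ℝ) => f q.1 q.2)
      (f := fun y => (y, w)) x hf.hasFDerivAt (hasFDerivAt_prodMk_left x w)
  have hz : (v, z) = (v, (0 : Fin m → ℝ)) + ∑ β, z β • ((0 : Fin n → ℝ), Pi.single β (1 : ℝ)) := by
    refine Prod.ext ?_ (funext fun γ => ?_)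
    · simp [Prod.fst_sum]
    · simp [Prod.snd_sum, Finset.sum_apply, Pi.single_apply]
  rw [h1.fderiv, hz, map_add, map_sum]
  congr 1
  refine Finset.sum_congr rfl fun β _ => ?_
  rw [map_smul, partialU_eq hf, smul_eq_mul, mul_comm]

end Partial

/-- The failure of `u` to solve the equation for `u_β` and `r_i`. -/
noncomputable def defect {n m : ℕ} (r : Fin n → (Fin n → ℝ) → (Fin n → ℝ))
    (f : Fin m → Fin n → (Fin n → ℝ) → (Fin m → ℝ) → ℝ) (u : (Fin n → ℝ) → (Fin m → ℝ))
    (β : Fin m) (i : Fin n) (x : Fin n → ℝ) : ℝ :=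
  dirDeriv (r i) (fun y => u y β) x - f β i x (u x)

section Defect

variable {n m : ℕ} {Ω D : Set (Fin n → ℝ)} {Υ : Set (Fin m → ℝ)} {I : Fin m → Finset (Fin n)}
  {r : Fin n → (Fin n → ℝ) → (Fin n → ℝ)}
  {f : Fin m → Fin n → (Fin n → ℝ) → (Fin m → ℝ) → ℝ} {u : (Fin n → ℝ) → (Fin m → ℝ)}

/-- The derivative of `x ↦ f α j x (u x)`, in terms of the partial derivatives of `f α j`. -/
theorem fderiv_along_apply {α : Fin m} {i j : Fin n} {x : Fin n → ℝ}
    (hf : DifferentiableAt ℝ (fun q : (Fin n → ℝ) × (Fin m → ℝ) => f α j q.1 q.2) (x, u x))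
    (hu : DifferentiableAt ℝ u x)
    (hstruct : ∀ β, i ∉ I β → partialU (f α j) β x (u x) = 0) :
    fderiv ℝ (fun q : (Fin n → ℝ) × (Fin m → ℝ) => f α j q.1 q.2) (x, u x)
        (r i x, fderiv ℝ u x (r i x))
      = (dirDeriv (r i) (fun y => f α j y (u x)) x
          + ∑ β with i ∈ I β, partialU (f α j) β x (u x) * f β i x (u x))
        + ∑ β with i ∈ I β, partialU (f α j) β x (u x) * defect r f u β i x := by
  rw [fderiv_uncurry_apply hf, add_assoc, ← Finset.sum_add_distrib, Finset.sum_filter]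
  congr 1
  refine Finset.sum_congr rfl fun β _ => ?_
  by_cases hβ : i ∈ I β
  · have hpi : fderiv ℝ (fun y => u y β) x (r i x) = fderiv ℝ u x (r i x) β := by
      rw [(hasFDerivAt_pi'.1 hu.hasFDerivAt β).fderiv]
      rfl
    rw [if_pos hβ, ← mul_add, defect, dirDeriv, hpi]
    ring
  -- The system says nothing about `r_i(u_β)` when `i ∉ I_β`; the structural condition removes
  -- exactly these terms.
  · rw [if_neg hβ, hstruct β hβ, zero_mul]

theorem abs_sum_partialU_mul_le {α : Fin m} {i j : Fin n} {x : Fin n → ℝ} {C M₀ : ℝ}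
    (hf : DifferentiableAt ℝ (fun q : (Fin n → ℝ) × (Fin m → ℝ) => f α j q.1 q.2) (x, u x))
    (hC : ‖fderiv ℝ (fun q : (Fin n → ℝ) × (Fin m → ℝ) => f α j q.1 q.2) (x, u x)‖ ≤ C)
    (hM₀ : 0 ≤ M₀) (hdef : ∀ β, i ∈ I β → |defect r f u β i x| ≤ M₀) :
    |∑ β with i ∈ I β, partialU (f α j) β x (u x) * defect r f u β i x| ≤ m * (C * M₀) := by
  have hC0 : 0 ≤ C := (norm_nonneg _).trans hC
  have h1 : |∑ β with i ∈ I β, partialU (f α j) β x (u x) * defect r f u β i x|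
      ≤ ∑ _β : Fin m, C * M₀ := by
    refine (Finset.abs_sum_le_sum_abs _ _).trans ?_
    rw [Finset.sum_filter]
    refine Finset.sum_le_sum fun β _ => ?_
    split_ifs with hβ
    · rw [abs_mul]
      exact mul_le_mul ((abs_partialU_le hf β).trans hC) (hdef β hβ) (abs_nonneg _) hC0
    · positivity
  simpa using h1

/-- The integrability condition, in terms of the defect. -/
theorem abs_integrability_defect_le {α : Fin m} {i j : Fin n} {x : Fin n → ℝ} {C M₀ : ℝ}
    (hr : IsC1Frame Ω r) (hx : x ∈ Ω)
    (hfi : DifferentiableAt ℝ (fun q : (Fin n → ℝ) × (Fin m → ℝ) => f α i q.1 q.2) (x, u x))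
    (hfj : DifferentiableAt ℝ (fun q : (Fin n → ℝ) × (Fin m → ℝ) => f α j q.1 q.2) (x, u x))
    (hCi : ‖fderiv ℝ (fun q : (Fin n → ℝ) × (Fin m → ℝ) => f α i q.1 q.2) (x, u x)‖ ≤ C)
    (hCj : ‖fderiv ℝ (fun q : (Fin n → ℝ) × (Fin m → ℝ) => f α j q.1 q.2) (x, u x)‖ ≤ C)
    (hu : DifferentiableAt ℝ u x)
    (hstructij : i ≠ j → ∀ β, i ∉ I β → partialU (f α j) β x (u x) = 0)
    (hstructji : j ≠ i → ∀ β, j ∉ I β → partialU (f α i) β x (u x) = 0)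
    (hint : i ≠ j → mixedDefect r I f α i j x (u x) =
        ∑ k ∈ I α, structureCoeff r i j k x * f α k x (u x))
    (hM₀ : 0 ≤ M₀) (hdef : ∀ β, ∀ i ∈ I β, |defect r f u β i x| ≤ M₀) :
    |fderiv ℝ (fun q : (Fin n → ℝ) × (Fin m → ℝ) => f α j q.1 q.2) (x, u x)
        (r i x, fderiv ℝ u x (r i x))
      - fderiv ℝ (fun q : (Fin n → ℝ) × (Fin m → ℝ) => f α i q.1 q.2) (x, u x)
        (r j x, fderiv ℝ u x (r j x))
      + ∑ k ∈ I α, f α k x (u x) * structureCoeff r j i k x| ≤ 2 * (m * (C * M₀)) := by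
  have hC0 : 0 ≤ C := (norm_nonneg _).trans hCi
  have hanti : ∀ k, structureCoeff r j i k x = - structureCoeff r i j k x := by
    intro k
    rw [hr.structureCoeff_eq hx, hr.structureCoeff_eq hx, VectorField.lieBracket_swap]
    simp
  -- The integrability condition excludes `i = j`, where antisymmetry of the structure coefficients
  -- makes everything vanish.
  by_cases hij : i = j
  · subst hij
    have h0 : ∀ k, structureCoeff r i i k x = 0 := fun k => by linarith [hanti k]
    simp only [sub_self, h0, mul_zero, Finset.sum_const_zero, add_zero, abs_zero]
    positivity
  · have h1 := abs_sum_partialU_mul_le (I := I) (i := i) hfj hCj hM₀ fun β hβ => hdef β i hβ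
    have h2 := abs_sum_partialU_mul_le (I := I) (i := j) hfi hCi hM₀ fun β hβ => hdef β j hβ
    have h3 := hint hij
    rw [fderiv_along_apply hfj hu (hstructij hij), fderiv_along_apply hfi hu (hstructji (Ne.symm hij))]
    have h4 : ∑ k ∈ I α, f α k x (u x) * structureCoeff r j i k x
        = - ∑ k ∈ I α, structureCoeff r i j k x * f α k x (u x) := by
      rw [← Finset.sum_neg_distrib]
      exact Finset.sum_congr rfl fun k _ => by rw [hanti]; ring
    -- The integrability identity cancels all terms except two sums of `∂f/∂u_β` times a defect.
    rw [h4, ← h3, mixedDefect]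
    rw [abs_le] at h1 h2 ⊢
    constructor <;> linarith [h1.1, h1.2, h2.1, h2.2]

variable {U : ∀ α, Set (Fin (n - (I α).card) → ℝ)}
  {ξ : ∀ α, (Fin (n - (I α).card) → ℝ) → (Fin n → ℝ)} {Θ : ∀ α, Set (Params n (I α).card)}
  {ψ : ∀ α, Params n (I α).card → (Fin n → ℝ)} {φ : ∀ α, (Fin n → ℝ) → Params n (I α).card}
  {G : ∀ α, (Fin (n - (I α).card) → ℝ) → ℝ} {c : Fin m → ℝ} {ρ P T M L C Cs : ℝ}

theorem exists_orderEmbOfFin_eq {I : Finset (Fin n)} {k : Fin n} (hk : k ∈ I) :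
    ∃ l, I.orderEmbOfFin rfl l = k := by
  have := I.range_orderEmbOfFin rfl
  have hk' : k ∈ (I : Set (Fin n)) := hk
  rw [← this] at hk'
  exact hk'

/-- If the defects of a fixed point of the integral operator are bounded by `M₀`, then they are
bounded by `M₀ / 2`. -/
theorem PicardSetting.abs_defect_le_half
    (S : PicardSetting (p := fun α => (I α).card) (fun α j => r ((I α).orderEmbOfFin rfl j))
      U ξ Θ D ψ φ G (fun α j q => f α ((I α).orderEmbOfFin rfl j) q.1 q.2) Υ c ρ P T M L C)
    (hΩ : IsOpen Ω) (hDΩ : D ⊆ Ω) (hr : IsC1Frame Ω r)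
    (hfC1 : ∀ α, ∀ i ∈ I α,
      ContDiffOn ℝ 1 (fun q : (Fin n → ℝ) × (Fin m → ℝ) => f α i q.1 q.2) (Ω ×ˢ Υ))
    (hstruct : ∀ α, ∀ i ∈ I α, ∀ j ∈ I α, i ≠ j → ∀ β, i ∉ I β →
      ∀ x ∈ Ω, ∀ u ∈ Υ, partialU (f α j) β x u = 0)
    (hinv : ∀ α, ∀ j ∈ I α, ∀ k ∈ I α, ∀ x ∈ Ω, VectorField.lieBracket ℝ (r j) (r k) x ∈
        Submodule.span ℝ ((fun i => r i x) '' (I α : Set (Fin n))))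
    (hint : ∀ α, ∀ i ∈ I α, ∀ j ∈ I α, i ≠ j → ∀ x ∈ Ω, ∀ u ∈ Υ,
      mixedDefect r I f α i j x u = ∑ k ∈ I α, structureCoeff r i j k x * f α k x u)
    (hCs : ∀ i l k, ∀ x ∈ D, |structureCoeff r i l k x| ≤ Cs) (hCs0 : 0 ≤ Cs)
    (hsmall : T * (n * Cs) ≤ 1 / 2) (hsmall' : P * (T * (n * (2 * (2 * (m * C))))) ≤ 1 / 4)
    {δ : ℝ} (hδ0 : 0 ≤ δ) (hδ1 : δ ≤ 1) (hδn : n * δ ≤ 1 / 4)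
    (hδ : ∀ α k, ∀ t ∈ Θ α, ‖chartCoeff r (ψ α) (axis n k) t
      - Pi.single ((I α).orderEmbOfFin rfl k) 1‖ ≤ δ)
    (hu : ContDiffOn ℝ 1 u D) (hu' : MapsTo u D (Metric.closedBall c ρ))
    (hufix : ∀ x ∈ D, picard ψ φ G (fun α j q => f α ((I α).orderEmbOfFin rfl j) q.1 q.2) u x = u x)
    {M₀ : ℝ} (hM₀ : 0 ≤ M₀) (hdef : ∀ β, ∀ i ∈ I β, ∀ x ∈ D, |defect r f u β i x| ≤ M₀) :
    ∀ β, ∀ i ∈ I β, ∀ x ∈ D, |defect r f u β i x| ≤ M₀ / 2 := by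
  intro α i₀ hi₀ x₀ hx₀
  obtain ⟨k₀, rfl⟩ := exists_orderEmbOfFin_eq hi₀
  have huΥ : MapsTo u D Υ := hu'.mono_right S.closedBall_subset
  have hT0 := S.pos_T
  have hC0 := S.pos_C
  have h := S.chart α
  set v : Params n (I α).card := axis n k₀ with hv
  have hD : IsOpen D := h.isOpen_image
  have hdu : ∀ x ∈ D, DifferentiableAt ℝ u x := fun x hx =>
    (hu.differentiableOn one_ne_zero).differentiableAt (hD.mem_nhds hx)
  have huα : ContDiffOn ℝ 1 (fun y => u y α) D := contDiffOn_pi.1 hu α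
  have hdf : ∀ k ∈ I α, ∀ x ∈ D, DifferentiableAt ℝ
      (fun q : (Fin n → ℝ) × (Fin m → ℝ) => f α k q.1 q.2) (x, u x) := fun k hk x hx =>
    ((hfC1 α k hk).differentiableOn one_ne_zero).differentiableAt
      ((hΩ.prod S.isOpen_Υ).mem_nhds ⟨hDΩ hx, huΥ hx⟩)
  have hdfC : ∀ k ∈ I α, ∀ x ∈ D,
      ‖fderiv ℝ (fun q : (Fin n → ℝ) × (Fin m → ℝ) => f α k q.1 q.2) (x, u x)‖ ≤ C := by
    intro k hk x hx
    obtain ⟨l, rfl⟩ := exists_orderEmbOfFin_eq hk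
    exact S.norm_fderiv_F_le α l x hx _ (hu' hx)
  have hcard : ((I α).card : ℝ) ≤ n := by
    have := Finset.card_le_univ (I α)
    simp only [Fintype.card_fin] at this
    exact_mod_cast this
  have hzero : ∀ t ∈ Θ α, ∀ i : ℕ, (k₀ : ℕ) + 1 ≤ i → i ≤ (I α).card → ∀ k ∉ I α,
      chartCoeff r (ψ α) v (vertex t i) k = 0 := fun t ht i hi hip =>
    h.chartCoeff_eq_zero hr hΩ hDΩ (fun j => (I α).orderEmbOfFin_mem rfl j) (fun _ => rfl)
      (hinv α) hCs hCs0 (S.norm_le α) hT0.le hsmall ht k₀ hi hip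
  have hexp : ∀ q ∈ Θ α, (∀ k ∉ I α, chartCoeff r (ψ α) v q k = 0) →
      fderiv ℝ (ψ α) q v = ∑ k ∈ I α, chartCoeff r (ψ α) v q k • r k (ψ α q) := by
    intro q hq hz
    rw [← hr.frameMap_coframe (hDΩ (h.mapsTo hq)) (fderiv ℝ (ψ α) q v), frameMap_apply]
    refine (Finset.sum_subset (Finset.subset_univ _) fun k _ hk => ?_).symm
    have := hz k hk
    rw [chartCoeff] at this
    rw [this, zero_smul]
  have hcoef : ∀ q ∈ Θ α, ∀ k, |chartCoeff r (ψ α) v q k| ≤ 2 := by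
    intro q hq k
    have h1 := (norm_le_pi_norm _ k).trans (hδ α k₀ q hq)
    rw [Pi.sub_apply, Real.norm_eq_abs] at h1
    have h2 : |(Pi.single ((I α).orderEmbOfFin rfl k₀) 1 : Fin n → ℝ) k| ≤ 1 := by
      rw [Pi.single_apply]; split_ifs <;> simp
    have h3 := abs_add_le (chartCoeff r (ψ α) v q k
      - (Pi.single ((I α).orderEmbOfFin rfl k₀) 1 : Fin n → ℝ) k)
      ((Pi.single ((I α).orderEmbOfFin rfl k₀) 1 : Fin n → ℝ) k)
    rw [sub_add_cancel] at h3
    linarith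
  -- On the vertices and segments considered below this is `∑ a_k` times the defect for `r_k`. It is
  -- written with the derivative of `u ∘ ψ` because that form can be differentiated along a segment
  -- although `u` is only `C¹`.
  set Et : Params n (I α).card → ℝ := fun q => fderiv ℝ (fun t => u (ψ α t) α) q v
    - ∑ k ∈ I α, f α k (ψ α q) (u (ψ α q)) * chartCoeff r (ψ α) v q k with hEt
  -- the change of `Et` along a segment
  have hstep : ∀ t ∈ Θ α, ∀ j : Fin (I α).card, k₀ < j →
      |Et (vertex t (j + 1)) - Et (vertex t j)| ≤ T * (n * (2 * (2 * (m * (C * M₀))))) := by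
    intro t ht j hj
    have hvj : ∀ l, j < l → v.1 l = 0 := by
      intro l hl
      have : l ≠ k₀ := (hj.trans hl).ne'
      simp [hv, axis, this]
    set i := (I α).orderEmbOfFin rfl j with hi
    have hiI : i ∈ I α := (I α).orderEmbOfFin_mem rfl j
    set Q : Fin n → Params n (I α).card → ℝ := fun l q =>
      fderiv ℝ (fun q : (Fin n → ℝ) × (Fin m → ℝ) => f α i q.1 q.2) (ψ α q, u (ψ α q))
        (r l (ψ α q), fderiv ℝ u (ψ α q) (r l (ψ α q)))
      - fderiv ℝ (fun q : (Fin n → ℝ) × (Fin m → ℝ) => f α l q.1 q.2) (ψ α q, u (ψ α q))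
        (r i (ψ α q), fderiv ℝ u (ψ α q) (r i (ψ α q)))
      + ∑ k ∈ I α, f α k (ψ α q) (u (ψ α q)) * structureCoeff r i l k (ψ α q) with hQ
    have hder : ∀ s ∈ Icc (0 : ℝ) 1, HasDerivAt (fun s => Et (seg n j s t))
        (t.1 j * ∑ l ∈ I α, chartCoeff r (ψ α) v (seg n j s t) l * Q l (seg n j s t)) s := by
      intro s hs
      have hq := h.accessible.seg_mem ht j hs
      have hz : ∀ k ∉ I α, chartCoeff r (ψ α) v (seg n j s t) k = 0 := by
        have := hzero _ hq (j + 1) (by have := Fin.lt_def.1 hj; omega) j.2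
        rwa [vertex_seg] at this
      have hJ := hexp _ hq hz
      have hxD := h.mapsTo hq
      have hψd := h.hasDerivAt_seg ht j hs
      have hud : HasDerivAt (fun s => u (ψ α (seg n j s t)))
          (fderiv ℝ u (ψ α (seg n j s t)) (t.1 j • r i (ψ α (seg n j s t)))) s :=
        (hdu _ hxD).hasFDerivAt.comp_hasDerivAt s hψd
      -- On the slice, `∂(u_α ∘ ψ)/∂t_j` is the `C¹` function `f_i^α(ψ, u ∘ ψ)`; symmetry of mixed
      -- derivatives then differentiates `∂_v(u_α ∘ ψ)` in `t_j`.
      have d1 := hasDerivAt_fderiv_seg h.accessible (H := fun t => u (ψ α t) α)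
        ((h.contDiffOn_comp huα).differentiableOn one_ne_zero)
        (S.contDiffOn_integrand hu huΥ α j)
        (fun t ht h0 => S.fderiv_fixedPoint_axis hu huΥ hufix α j ht h0) hvj ht hs
      rw [S.fderiv_integrand hu huΥ α j hq] at d1
      have d2 : ∀ k ∈ I α, HasDerivAt (fun s => f α k (ψ α (seg n j s t)) (u (ψ α (seg n j s t))))
          (t.1 j * fderiv ℝ (fun q : (Fin n → ℝ) × (Fin m → ℝ) => f α k q.1 q.2)
            (ψ α (seg n j s t), u (ψ α (seg n j s t)))
            (r i (ψ α (seg n j s t)), fderiv ℝ u (ψ α (seg n j s t)) (r i (ψ α (seg n j s t))))) s := by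
        intro k hk
        have := (hdf k hk _ hxD).hasFDerivAt.comp_hasDerivAt s (hψd.prodMk hud)
        rw [map_smul, ← Prod.smul_mk, map_smul] at this
        exact this
      have d3 := hasDerivAt_pi.1 (h.hasDerivAt_chartCoeff hr hΩ hDΩ (i := i) rfl hvj ht hs)
      have d4 := d1.sub (HasDerivAt.fun_sum fun k hk => (d2 k hk).mul (d3 k))
      refine d4.congr_deriv ?_
      set q := seg n j s t with hqdef
      set a := chartCoeff r (ψ α) v q with ha
      have e1 : ((fderiv ℝ (fun q : (Fin n → ℝ) × (Fin m → ℝ) => f α i q.1 q.2)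
          (ψ α q, u (ψ α q))).comp ((fderiv ℝ (ψ α) q).prod
            ((fderiv ℝ u (ψ α q)).comp (fderiv ℝ (ψ α) q)))) v
          = ∑ l ∈ I α, a l *
            fderiv ℝ (fun q : (Fin n → ℝ) × (Fin m → ℝ) => f α i q.1 q.2) (ψ α q, u (ψ α q))
              (r l (ψ α q), fderiv ℝ u (ψ α q) (r l (ψ α q))) := by
        have e2 : ((fderiv ℝ (ψ α) q).prod ((fderiv ℝ u (ψ α q)).comp (fderiv ℝ (ψ α) q))) v
            = ∑ l ∈ I α, a l • (r l (ψ α q), fderiv ℝ u (ψ α q) (r l (ψ α q))) := by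
          simp only [ContinuousLinearMap.prod_apply, ContinuousLinearMap.comp_apply]
          rw [hJ, map_sum]
          refine Prod.ext ?_ ?_
          · simp [Prod.fst_sum]
          · simp [Prod.snd_sum]
        rw [ContinuousLinearMap.comp_apply, e2, map_sum]
        exact Finset.sum_congr rfl fun l _ => by rw [map_smul, smul_eq_mul]
      have e3 : ∀ k, ∑ l, a l * structureCoeff r i l k (ψ α q)
          = ∑ l ∈ I α, a l * structureCoeff r i l k (ψ α q) := by
        intro k
        refine (Finset.sum_subset (Finset.subset_univ _) fun l _ hl => ?_).symm
        rw [hz l hl, zero_mul]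
      have e4 : ∑ k ∈ I α, f α k (ψ α q) (u (ψ α q)) *
            ∑ l ∈ I α, a l * structureCoeff r i l k (ψ α q)
          = ∑ l ∈ I α, a l * ∑ k ∈ I α, f α k (ψ α q) (u (ψ α q)) *
            structureCoeff r i l k (ψ α q) := by
        simp only [Finset.mul_sum]
        rw [Finset.sum_comm]
        exact Finset.sum_congr rfl fun l _ => Finset.sum_congr rfl fun k _ => by ring
      rw [smul_eq_mul]
      refine (congrArg₂ (· - ·) (congrArg (t.1 j * ·) e1) (Finset.sum_congr rfl fun k hk => by
        rw [Pi.neg_apply, Pi.smul_apply, smul_eq_mul, e3 k])).trans ?_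
      simp only [hQ]
      simp only [mul_add, mul_sub, Finset.sum_add_distrib, Finset.sum_sub_distrib]
      rw [← e4]
      simp only [Finset.mul_sum]
      rw [sub_add_eq_sub_sub, sub_eq_add_neg, ← Finset.sum_neg_distrib]
      congr 1
      · congr 1
        exact Finset.sum_congr rfl fun k _ => by ring
      · exact Finset.sum_congr rfl fun k _ => by
          rw [mul_neg, neg_neg, Finset.mul_sum]
          exact Finset.sum_congr rfl fun l _ => by ring
    have hbound : ∀ s ∈ Ico (0 : ℝ) 1,
        ‖t.1 j * ∑ l ∈ I α, chartCoeff r (ψ α) v (seg n j s t) l * Q l (seg n j s t)‖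
          ≤ T * (n * (2 * (2 * (m * (C * M₀))))) := by
      intro s hs
      have hq := h.accessible.seg_mem ht j (Ico_subset_Icc_self hs)
      have hxD := h.mapsTo hq
      have htj : ‖t.1 j‖ ≤ T := ((norm_le_pi_norm t.1 j).trans (norm_fst_le t)).trans
        (S.norm_le α t ht)
      -- Each of the at most `n` terms is bounded by `2` for the coefficient times `2 m C M₀` for
      -- the integrability expression.
      have hsum : ‖∑ l ∈ I α, chartCoeff r (ψ α) v (seg n j s t) l * Q l (seg n j s t)‖
          ≤ ∑ _l ∈ I α, 2 * (2 * (m * (C * M₀))) := by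
        refine norm_sum_le_of_le _ fun l hl => ?_
        rw [norm_mul]
        refine mul_le_mul (hcoef _ hq l) ?_ (norm_nonneg _) zero_le_two
        exact abs_integrability_defect_le (I := I) hr (hDΩ hxD) (hdf l hl _ hxD) (hdf i hiI _ hxD)
          (hdfC l hl _ hxD) (hdfC i hiI _ hxD) (hdu _ hxD)
          (fun hne β hβ => hstruct α l hl i hiI hne β hβ _ (hDΩ hxD) _ (huΥ hxD))
          (fun hne β hβ => hstruct α i hiI l hl hne β hβ _ (hDΩ hxD) _ (huΥ hxD))
          (fun hne => hint α l hl i hiI hne _ (hDΩ hxD) _ (huΥ hxD)) hM₀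
          (fun β k hk => hdef β k hk _ hxD)
      rw [Finset.sum_const, nsmul_eq_mul] at hsum
      rw [norm_mul]
      refine mul_le_mul htj (hsum.trans ?_) (norm_nonneg _) hT0.le
      gcongr
    have := norm_image_sub_le_of_norm_deriv_le_segment_01'
      (fun s hs => (hder s hs).hasDerivWithinAt) hbound
    rwa [seg_one, seg_zero] at this
  have hchain : ∀ t ∈ Θ α, ∀ i : ℕ, (k₀ : ℕ) + 1 ≤ i → i ≤ (I α).card →
      |Et (vertex t i)| ≤ i * (T * (n * (2 * (2 * (m * (C * M₀)))))) := by
    intro t ht i hi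
    induction i, hi using Nat.le_induction with
    | base =>
      intro hp
      have hm := h.accessible.vertex_mem ht hp
      have h0 : ∀ l, k₀ < l → (vertex t (k₀ + 1)).1 l = 0 :=
        fun l hl => vertex_fst_of_le t (by simpa using Fin.lt_def.1 hl)
      have hx := h.mapsTo hm
      -- At this vertex `∂ψ/∂t_{k₀}` is the frame vector itself and the fixed point satisfies its
      -- equation exactly.
      have hE0 : Et (vertex t (k₀ + 1)) = 0 := by
        simp only [hEt]
        rw [S.fderiv_fixedPoint_axis hu huΥ hufix α k₀ hm h0]
        have : chartCoeff r (ψ α) v (vertex t (k₀ + 1))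
            = Pi.single ((I α).orderEmbOfFin rfl k₀) 1 := by
          rw [chartCoeff, h.flow _ hm k₀ h0, hr.coframe_apply_frame (hDΩ hx)]
        rw [this, Finset.sum_eq_single_of_mem _ hi₀]
        · simp
        · intro k _ hk
          simp [hk]
      rw [hE0, abs_zero]
      positivity
    | succ i hi ih =>
      intro hp
      have h1 := hstep t ht ⟨i, hp⟩ (Fin.lt_def.2 hi)
      have h2 := ih (by omega)
      have h3 := abs_add_le (Et (vertex t (i + 1)) - Et (vertex t i)) (Et (vertex t i))
      rw [sub_add_cancel] at h3
      push_cast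
      simp only at h1
      linarith
  -- the defect at the end point of the path
  set t₀ := φ α x₀ with ht₀
  have ht₀Θ : t₀ ∈ Θ α := h.mapsTo_inv hx₀
  have hψt₀ : ψ α t₀ = x₀ := h.invOn.2 hx₀
  have hEt₀ := hchain t₀ ht₀Θ (I α).card k₀.2 le_rfl
  have hz₀ := hzero t₀ ht₀Θ (I α).card k₀.2 le_rfl
  rw [vertex_last] at hEt₀ hz₀
  have hEsum : Et t₀ = ∑ k ∈ I α, chartCoeff r (ψ α) v t₀ k * defect r f u α k x₀ := by
    simp only [hEt]
    rw [h.fderiv_comp huα ht₀Θ, ContinuousLinearMap.comp_apply, hexp _ ht₀Θ hz₀, hψt₀, map_sum,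
      ← Finset.sum_sub_distrib]
    refine Finset.sum_congr rfl fun k _ => ?_
    rw [map_smul, defect, dirDeriv, smul_eq_mul]
    ring
  -- The coefficients at `t₀` are `δ`-close to a unit vector, so `Et` and the single defect differ
  -- by at most `n δ M₀ ≤ M₀/4`. Together with `|Et| ≤ M₀/4` this gives the half.
  have hdiff : defect r f u α ((I α).orderEmbOfFin rfl k₀) x₀ - Et t₀
      = ∑ k ∈ I α, ((Pi.single ((I α).orderEmbOfFin rfl k₀) 1 : Fin n → ℝ) k
        - chartCoeff r (ψ α) v t₀ k) * defect r f u α k x₀ := by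
    simp only [sub_mul, Finset.sum_sub_distrib]
    rw [hEsum]
    congr 1
    rw [Finset.sum_eq_single_of_mem _ hi₀ fun k _ hk => by simp [hk]]
    simp
  have hdiffle : |defect r f u α ((I α).orderEmbOfFin rfl k₀) x₀ - Et t₀| ≤ n * (δ * M₀) := by
    rw [hdiff]
    refine (Finset.abs_sum_le_sum_abs _ _).trans ?_
    have : ∑ k ∈ I α, |((Pi.single ((I α).orderEmbOfFin rfl k₀) 1 : Fin n → ℝ) k
        - chartCoeff r (ψ α) v t₀ k) * defect r f u α k x₀| ≤ ∑ _k ∈ I α, δ * M₀ := by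
      refine Finset.sum_le_sum fun k hk => ?_
      rw [abs_mul, abs_sub_comm]
      exact mul_le_mul ((norm_le_pi_norm _ k).trans (hδ α k₀ t₀ ht₀Θ)) (hdef α k hk x₀ hx₀)
        (abs_nonneg _) hδ0
    rw [Finset.sum_const, nsmul_eq_mul] at this
    exact this.trans (by gcongr)
  have hE1 : |Et t₀| ≤ 1 / 4 * M₀ := by
    refine hEt₀.trans ?_
    have h1 : ((I α).card : ℝ) * (T * (n * (2 * (2 * (m * (C * M₀))))))
        ≤ P * (T * (n * (2 * (2 * (m * (C * M₀)))))) := by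
      gcongr
      exact S.le_P α
    have h2 := mul_le_mul_of_nonneg_right hsmall' hM₀
    linarith
  have hE2 : n * (δ * M₀) ≤ 1 / 4 * M₀ := by
    rw [← mul_assoc]
    exact mul_le_mul_of_nonneg_right hδn hM₀
  have h3 := abs_add_le (defect r f u α ((I α).orderEmbOfFin rfl k₀) x₀ - Et t₀) (Et t₀)
  rw [sub_add_cancel] at h3
  linarith

end Defect

/-! ### Choice of the constants -/

/-- The added one makes the bound positive, even for an empty index type. -/
theorem exists_common_bound {ι : Type*} [Fintype ι] {Q : ι → ℝ → Prop}
    (hmono : ∀ i a b, a ≤ b → Q i a → Q i b) (h : ∀ i, ∃ a, Q i a) : ∃ a > 0, ∀ i, Q i a := by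
  choose a ha using h
  refine ⟨∑ i, |a i| + 1, by positivity, fun i => hmono i _ _ ?_ (ha i)⟩
  have := Finset.single_le_sum (f := fun i => |a i|) (fun i _ => abs_nonneg _) (Finset.mem_univ i)
  linarith [le_abs_self (a i)]

theorem eventually_mul_le (k : ℝ) {b : ℝ} (hb : 0 < b) : ∀ᶠ T in 𝓝[>] (0 : ℝ), k * T ≤ b := by
  have hc : ContinuousAt (fun T : ℝ => k * T) 0 := by fun_prop
  have : ∀ᶠ T in 𝓝 (0 : ℝ), k * T < b := hc.eventually_lt continuousAt_const (by simpa using hb)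
  exact (this.filter_mono nhdsWithin_le_nhds).mono fun T hT => hT.le

theorem eventually_of_exists_pos {Q : ℝ → Prop} (hmono : ∀ a b, 0 < a → a ≤ b → Q b → Q a)
    (h : ∃ b > 0, Q b) : ∀ᶠ a in 𝓝[>] (0 : ℝ), Q a := by
  obtain ⟨b, hb, hQ⟩ := h
  filter_upwards [Ioo_mem_nhdsGT hb] with a ha
  exact hmono a b ha.1 ha.2.le hQ

/-- A `C¹` function has a bounded and uniformly continuous derivative on compact sets. -/
theorem exists_fderiv_bounds {E F ι : Type*} [Fintype ι] [NormedAddCommGroup E] [NormedSpace ℝ E]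
    [NormedAddCommGroup F] [NormedSpace ℝ F] {O K : Set E} (hO : IsOpen O) (hK : IsCompact K)
    (hKO : K ⊆ O) {F' : ι → E → F} (hF : ∀ i, ContDiffOn ℝ 1 (F' i) O) :
    (∃ C > 0, ∀ i, ∀ x ∈ K, ‖fderiv ℝ (F' i) x‖ ≤ C) ∧
      ∀ η > 0, ∃ d > 0, ∀ i, ∀ x ∈ K, ∀ y ∈ K, ‖x - y‖ ≤ d →
        ‖fderiv ℝ (F' i) x - fderiv ℝ (F' i) y‖ ≤ η := by
  have hc : ∀ i, ContinuousOn (fderiv ℝ (F' i)) K := fun i =>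
    ((hF i).continuousOn_fderiv_of_isOpen hO le_rfl).mono hKO
  refine ⟨exists_common_bound (fun i a b hab h x hx => (h x hx).trans hab)
    fun i => hK.exists_bound_of_continuousOn (hc i), fun η hη => ?_⟩
  have hev : ∀ᶠ d in 𝓝[>] (0 : ℝ), ∀ i, ∀ x ∈ K, ∀ y ∈ K, ‖x - y‖ ≤ d →
      ‖fderiv ℝ (F' i) x - fderiv ℝ (F' i) y‖ ≤ η := by
    refine eventually_all.2 fun i => eventually_of_exists_pos
      (fun a b _ hab h x hx y hy hxy => h x hx y hy (hxy.trans hab)) ?_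
    obtain ⟨d, hd, h⟩ := Metric.uniformContinuousOn_iff_le.1
      (hK.uniformContinuousOn_of_continuous (hc i)) η hη
    exact ⟨d, hd, fun x hx y hy hxy => by
      simpa [dist_eq_norm] using h x hx y hy (by rwa [dist_eq_norm])⟩
  obtain ⟨d, h1, h2⟩ := (hev.and self_mem_nhdsWithin).exists
  exact ⟨d, h2, h1⟩

section Estimates

variable {n p : ℕ} {X : Fin p → (Fin n → ℝ) → (Fin n → ℝ)} {U : Set (Fin (n - p) → ℝ)}
  {ξ : (Fin (n - p) → ℝ) → (Fin n → ℝ)} {Θ : Set (Params n p)} {D Ω Ξ : Set (Fin n → ℝ)}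
  {ψ : Params n p → (Fin n → ℝ)} {φ : (Fin n → ℝ) → Params n p} {xbar : Fin n → ℝ}
  {r : Fin n → (Fin n → ℝ) → (Fin n → ℝ)}

/-- With `w = dφ v` and `dψ w = v`, the lower bound for `A` gives `‖w‖ ≤ c (‖v‖ + δ ‖w‖) ≤ c ‖v‖ +
‖w‖ / 2`. -/
theorem AdaptedChart.norm_fderiv_inv_le (h : AdaptedChart X U ξ Θ D ψ φ)
    {A : Params n p →L[ℝ] (Fin n → ℝ)} {c δ : ℝ} (hc : 0 < c) (hA : ∀ t, ‖t‖ ≤ c * ‖A t‖)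
    (hδ : c * δ ≤ 1 / 2) (hψ : ∀ t ∈ Θ, ‖fderiv ℝ ψ t - A‖ ≤ δ) {x : Fin n → ℝ} (hx : x ∈ D) :
    ‖fderiv ℝ φ x‖ ≤ 2 * c := by
  refine ContinuousLinearMap.opNorm_le_bound _ (by positivity) fun v => ?_
  have ht := h.mapsTo_inv hx
  have hd : HasFDerivAt (fun y => ψ (φ y)) ((fderiv ℝ ψ (φ x)).comp (fderiv ℝ φ x)) x :=
    (h.differentiableAt ht).hasFDerivAt.comp x
      ((h.contDiffOn_inv.differentiableOn one_ne_zero).differentiableAt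
        (h.isOpen_image.mem_nhds hx)).hasFDerivAt
  have hev : (fun y => ψ (φ y)) =ᶠ[𝓝 x] id := by
    filter_upwards [h.isOpen_image.mem_nhds hx] with y hy
    exact h.invOn.2 hy
  have hid := hd.unique ((hasFDerivAt_id x).congr_of_eventuallyEq hev)
  have hv : fderiv ℝ ψ (φ x) (fderiv ℝ φ x v) = v :=
    congrArg (fun B : (Fin n → ℝ) →L[ℝ] (Fin n → ℝ) => B v) hid
  set w := fderiv ℝ φ x v with hw
  have h1 := hA w
  have h2 := (fderiv ℝ ψ (φ x) - A).le_of_opNorm_le (hψ _ ht) w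
  rw [_root_.sub_apply, hv] at h2
  have h3 : ‖A w‖ ≤ ‖v‖ + δ * ‖w‖ := by
    have := norm_sub_le v (v - A w)
    rw [sub_sub_cancel] at this
    linarith
  have h4 : c * ‖A w‖ ≤ c * (‖v‖ + δ * ‖w‖) := by gcongr
  nlinarith [norm_nonneg w]

theorem norm_axis_le (k : Fin p) : ‖axis n k‖ ≤ 1 := by
  simp [axis, Prod.norm_def, Pi.norm_single]

/-- In a small chart, the coefficients of `∂ψ/∂t_k` are close to those at the origin. -/
theorem eventually_chartCoeff_close (hr : IsC1Frame Ω r) (hΩ : IsOpen Ω) (hxbar : xbar ∈ Ω)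
    {ι : Fin p → Fin n} (hX0 : ∀ j, r (ι j) xbar ≠ 0) (hξ : IsC1Chart Ω Ξ xbar U ξ) {δ : ℝ}
    (hδ : 0 < δ) :
    ∀ᶠ ε in 𝓝[>] (0 : ℝ), ∀ Θ D ψ φ, AdaptedChart (fun j => r (ι j)) U ξ Θ D ψ φ →
      D ⊆ Metric.ball xbar ε → ∀ k, ∀ t ∈ Θ,
        ‖chartCoeff r ψ (axis n k) t - Pi.single (ι k) 1‖ ≤ δ := by
  have hnear : ∀ᶠ ρ in 𝓝[>] (0 : ℝ), ∀ i, ∀ x ∈ Metric.ball xbar ρ,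
      ∀ v ∈ Metric.ball (r i xbar) ρ, ‖coframe r x v - Pi.single i 1‖ ≤ δ := by
    refine eventually_all.2 fun i => ?_
    have hc : ContinuousAt (fun z : (Fin n → ℝ) × (Fin n → ℝ) => coframe r z.1 z.2)
        (xbar, r i xbar) :=
      (ContinuousAt.comp (f := Prod.fst) (x := (xbar, r i xbar))
        (hr.contDiffAt_coframe hΩ hxbar).continuousAt continuousAt_fst).clm_apply continuousAt_snd
    have hval : coframe r xbar (r i xbar) = Pi.single i 1 := hr.coframe_apply_frame hxbar i
    have hev := hc.eventually (Metric.closedBall_mem_nhds _ hδ)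
    filter_upwards [eventually_forall_mem_ball hev] with ρ hρ x hx v hv
    have := hρ (x, v) (by rw [← ball_prod_same]; exact ⟨hx, hv⟩)
    rw [dist_eq_norm, hval] at this
    exact this
  obtain ⟨ρ, hρ, hρ0⟩ := (hnear.and self_mem_nhdsWithin).exists
  have hρ0' : 0 < ρ := hρ0
  filter_upwards [eventually_norm_fderiv_sub_baseMap_le hΩ hxbar (fun j => hr.1 (ι j)) hX0 hξ
    (half_pos hρ0'), Ioo_mem_nhdsGT hρ0'] with ε h1 h2 Θ D ψ φ h hD k t ht
  have h3 := (fderiv ℝ ψ t - baseMap (fun j => r (ι j)) ξ xbar).le_of_opNorm_le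
    (h1 Θ D ψ φ h hD t ht) (axis n k)
  rw [_root_.sub_apply, baseMap_axis] at h3
  refine hρ (ι k) _ (Metric.ball_subset_ball h2.2.le (hD (h.mapsTo ht))) _ ?_
  rw [mem_ball_iff_norm]
  have h4 := mul_le_mul_of_nonneg_left (norm_axis_le (n := n) k) (half_pos hρ0').le
  linarith

end Estimates

/-! ### Fixed points, solutions and the vanishing of the defects -/

section Solution

variable {n m : ℕ} {I : Fin m → Finset (Fin n)} {r : Fin n → (Fin n → ℝ) → (Fin n → ℝ)}
  {f : Fin m → Fin n → (Fin n → ℝ) → (Fin m → ℝ) → ℝ}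
  {U : ∀ α, Set (Fin (n - (I α).card) → ℝ)} {ξ : ∀ α, (Fin (n - (I α).card) → ℝ) → (Fin n → ℝ)}
  {Θ : ∀ α, Set (Params n (I α).card)} {D : Set (Fin n → ℝ)}
  {ψ : ∀ α, Params n (I α).card → (Fin n → ℝ)} {φ : ∀ α, (Fin n → ℝ) → Params n (I α).card}
  {Ξ : Fin m → Set (Fin n → ℝ)} {g : Fin m → (Fin n → ℝ) → ℝ} {Υ : Set (Fin m → ℝ)}
  {c : Fin m → ℝ} {ρ P T M L C : ℝ} {u v : (Fin n → ℝ) → (Fin m → ℝ)}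

/-- The Picard operator reproduces the data on the manifolds. -/
theorem PicardSetting.data_of_fixedPoint
    (S : PicardSetting (p := fun α => (I α).card) (fun α j => r ((I α).orderEmbOfFin rfl j))
      U ξ Θ D ψ φ (fun α s => g α (ξ α s))
      (fun α j q => f α ((I α).orderEmbOfFin rfl j) q.1 q.2) Υ c ρ P T M L C)
    (h0 : ∀ α, ∀ x ∈ Ξ α ∩ D, (φ α x).1 = 0)
    (hufix : ∀ x ∈ D, picard ψ φ (fun α s => g α (ξ α s))
      (fun α j q => f α ((I α).orderEmbOfFin rfl j) q.1 q.2) u x = u x)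
    (α : Fin m) {x : Fin n → ℝ} (hx : x ∈ Ξ α ∩ D) : u x α = g α x := by
  have hφ := h0 α x hx
  have hb := (S.chart α).base _ ((S.chart α).mapsTo_inv hx.2) hφ
  rw [(S.chart α).invOn.2 hx.2] at hb
  rw [← hufix x hx.2, picard, picardScalar_of_fst_eq_zero hφ, ← hb.2]

/-- A solution of the system is a fixed point of the Picard operator. -/
theorem PicardSetting.picard_eq_of_isSolution
    (S : PicardSetting (p := fun α => (I α).card) (fun α j => r ((I α).orderEmbOfFin rfl j))
      U ξ Θ D ψ φ (fun α s => g α (ξ α s))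
      (fun α j q => f α ((I α).orderEmbOfFin rfl j) q.1 q.2) Υ c ρ P T M L C)
    (hξ : ∀ α, ξ α '' U α = Ξ α) (hv : IsSolution Υ r I f Ξ g D v) {x : Fin n → ℝ} (hx : x ∈ D) :
    picard ψ φ (fun α s => g α (ξ α s))
      (fun α j q => f α ((I α).orderEmbOfFin rfl j) q.1 q.2) v x = v x := by
  refine S.picard_eq_of_solution hv.contDiffOn hv.mapsTo
    (fun α j x hx => hv.equation α _ ((I α).orderEmbOfFin_mem rfl j) x hx) (fun α t ht => ?_) hx
  have hb := (S.chart α).base_mem ht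
  refine hv.data α _ ⟨hξ α ▸ mem_image_of_mem _ hb.1, ?_⟩
  rw [← hb.2]
  exact (S.chart α).mapsTo ((S.chart α).accessible.vertex_mem ht (Nat.zero_le _))

/-- The halving can be iterated only from a finite bound; for the defects this is provided by the
bounded derivative of the fixed point. -/
theorem eq_zero_of_abs_le_half {ι : Type*} {e : ι → ℝ} {M₀ : ℝ} (hM₀ : 0 ≤ M₀)
    (h0 : ∀ i, |e i| ≤ M₀)
    (hstep : ∀ M : ℝ, 0 ≤ M → (∀ i, |e i| ≤ M) → ∀ i, |e i| ≤ M / 2) (i : ι) : e i = 0 := by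
  have key : ∀ k : ℕ, ∀ i, |e i| ≤ M₀ * (1 / 2) ^ k := by
    intro k
    induction k with
    | zero => simpa using h0
    | succ k ih =>
      intro i
      have := hstep _ (by positivity) ih i
      rw [pow_succ]
      linarith
  have hlim : Tendsto (fun k : ℕ => M₀ * (1 / 2 : ℝ) ^ k) atTop (𝓝 (M₀ * 0)) :=
    (tendsto_pow_atTop_nhds_zero_of_lt_one (by norm_num) (by norm_num)).const_mul _
  rw [mul_zero] at hlim
  exact abs_nonpos_iff.1 (ge_of_tendsto' hlim fun k => key k i)

end Solution

end Darboux

/-! ### The main theorem -/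

open Darboux

theorem theorem3p1 {n m : ℕ} (Ω : Set (Fin n → ℝ)) (hΩ : IsOpen Ω)
    (Υ : Set (Fin m → ℝ)) (hΥ : IsOpen Υ) (xbar : Fin n → ℝ) (hxbar : xbar ∈ Ω)
    (I : Fin m → Finset (Fin n))
    -- the frame
    (r : Fin n → (Fin n → ℝ) → (Fin n → ℝ)) (hr : Darboux.IsC1Frame Ω r)
    -- the data manifolds with their charts
    (Ξ : Fin m → Set (Fin n → ℝ)) (U : ∀ α, Set (Fin (n - (I α).card) → ℝ))
    (ξ : ∀ α, (Fin (n - (I α).card) → ℝ) → (Fin n → ℝ))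
    (hξ : ∀ α, Darboux.IsC1Chart Ω (Ξ α) xbar (U α) (ξ α))
    (htrans : ∀ α, Darboux.IsTransverse r (I α) (U α) (ξ α))
    (hstable : Darboux.StableConfiguration Ω r I U ξ xbar)
    -- the data: `C¹` and bounded on the manifolds
    (g : Fin m → (Fin n → ℝ) → ℝ)
    (hgC1 : ∀ α, ContDiffOn ℝ 1 (fun s => g α (ξ α s)) (U α))
    (hgbdd : ∀ α, ∃ C : ℝ, ∀ x ∈ Ξ α, |g α x| ≤ C)
    (hgΥ : (fun α => g α xbar) ∈ Υ)
    -- the right-hand sides: `C¹`, bounded, uniformly Lipschitz in `u`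
    (f : Fin m → Fin n → (Fin n → ℝ) → (Fin m → ℝ) → ℝ)
    (hfC1 : ∀ α, ∀ i ∈ I α,
      ContDiffOn ℝ 1 (fun q : (Fin n → ℝ) × (Fin m → ℝ) => f α i q.1 q.2) (Ω ×ˢ Υ))
    (hfbdd : ∀ α, ∀ i ∈ I α, ∃ M : ℝ, ∀ x ∈ Ω, ∀ u ∈ Υ, |f α i x u| ≤ M)
    (hfLip : ∀ α, ∀ i ∈ I α, ∃ L : ℝ, ∀ x ∈ Ω, ∀ u ∈ Υ, ∀ v ∈ Υ,
      |f α i x u - f α i x v| ≤ L * ‖u - v‖)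
    -- the structural condition
    (hstruct : ∀ α, ∀ i ∈ I α, ∀ j ∈ I α, i ≠ j → ∀ β, i ∉ I β →
      ∀ x ∈ Ω, ∀ u ∈ Υ, Darboux.partialU (f α j) β x u = 0)
    -- involutivity
    (hinv : ∀ α, ∀ j ∈ I α, ∀ k ∈ I α, ∀ x ∈ Ω,
      VectorField.lieBracket ℝ (r j) (r k) x ∈
        Submodule.span ℝ ((fun i => r i x) '' (I α : Set (Fin n))))
    -- the integrability conditions
    (hint : ∀ α, ∀ i ∈ I α, ∀ j ∈ I α, i ≠ j → ∀ x ∈ Ω, ∀ u ∈ Υ,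
      Darboux.mixedDefect r I f α i j x u =
        ∑ k ∈ I α, Darboux.structureCoeff r i j k x * f α k x u)
    -- bounded structure coefficients
    (hcbdd : ∀ α, ∀ i ∈ I α, ∀ j ∈ I α, ∀ k ∈ I α,
      ∃ C : ℝ, ∀ x ∈ Ω, |Darboux.structureCoeff r i j k x| ≤ C) :
    ∃ D : Set (Fin n → ℝ), IsOpen D ∧ xbar ∈ D ∧ D ⊆ Ω ∧
      ∃ u : (Fin n → ℝ) → (Fin m → ℝ), Darboux.IsSolution Υ r I f Ξ g D u ∧
        ∀ v : (Fin n → ℝ) → (Fin m → ℝ), Darboux.IsSolution Υ r I f Ξ g D v → Set.EqOn v u D := by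
  set c : Fin m → ℝ := fun α => g α xbar with hc
  set F : ∀ α, Fin (I α).card → (Fin n → ℝ) × (Fin m → ℝ) → ℝ :=
    fun α j q => f α ((I α).orderEmbOfFin rfl j) q.1 q.2 with hF
  set G : ∀ α, (Fin (n - (I α).card) → ℝ) → ℝ := fun α s => g α (ξ α s) with hG
  have hmem : ∀ α j, (I α).orderEmbOfFin rfl j ∈ I α := fun α j => (I α).orderEmbOfFin_mem rfl j
  obtain ⟨ρ, hρ0, hρ⟩ := Metric.nhds_basis_closedBall.mem_iff.1 (hΥ.mem_nhds hgΥ)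
  obtain ⟨ε₀, hε₀, hε₀Ω⟩ := Metric.nhds_basis_closedBall.mem_iff.1 (hΩ.mem_nhds hxbar)
  obtain ⟨M, hM0, hM⟩ := exists_common_bound (ι := Σ α, Fin (I α).card)
    (Q := fun a M => ∀ x ∈ Ω, ∀ w ∈ Υ, |F a.1 a.2 (x, w)| ≤ M)
    (fun i a b hab h x hx w hw => (h x hx w hw).trans hab) fun a => hfbdd _ _ (hmem a.1 a.2)
  obtain ⟨L, hL0, hL⟩ := exists_common_bound (ι := Σ α, Fin (I α).card)
    (Q := fun a L => ∀ x ∈ Ω, ∀ w ∈ Υ, ∀ w' ∈ Υ,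
      |F a.1 a.2 (x, w) - F a.1 a.2 (x, w')| ≤ L * ‖w - w'‖)
    (fun i a b hab h x hx w hw w' hw' => (h x hx w hw w' hw').trans (by gcongr))
    fun a => hfLip _ _ (hmem a.1 a.2)
  obtain ⟨⟨C₁, hC₁0, hC₁⟩, hmod⟩ := exists_fderiv_bounds (ι := Σ α, Fin (I α).card)
    (hΩ.prod hΥ) ((isCompact_closedBall xbar ε₀).prod (isCompact_closedBall c ρ))
    (prod_mono hε₀Ω hρ) (F' := fun a => F a.1 a.2) fun a => hfC1 _ _ (hmem a.1 a.2)
  choose κ hκ0 hκ using fun α => exists_norm_le_baseMap (hξ α) (htrans α)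
  -- The added ones leave room for the variation of `dG` and `dψ` near the origin; `2 κ` is the
  -- bound for the derivative of the inverse chart.
  obtain ⟨C, hC0, hC⟩ := exists_common_bound (ι := Fin m)
    (Q := fun α C => C₁ ≤ C ∧ 2 * κ α ≤ C ∧ ‖fderiv ℝ (G α) 0‖ + 1 ≤ C ∧
      ‖baseMap (fun j => r ((I α).orderEmbOfFin rfl j)) (ξ α) xbar‖ + 1 ≤ C)
    (fun i a b hab h => ⟨h.1.trans hab, h.2.1.trans hab, h.2.2.1.trans hab, h.2.2.2.trans hab⟩)
    fun α => ⟨max (max C₁ (2 * κ α)) (max (‖fderiv ℝ (G α) 0‖ + 1)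
      (‖baseMap (fun j => r ((I α).orderEmbOfFin rfl j)) (ξ α) xbar‖ + 1)), by simp⟩
  obtain ⟨Cs, hCs0, hCs⟩ : ∃ Cs > 0, ∀ᶠ ε in 𝓝[>] (0 : ℝ), ∀ i l k, ∀ x ∈ Metric.ball xbar ε,
      |structureCoeff r i l k x| ≤ Cs := by
    obtain ⟨Cs, hCs0, h⟩ := exists_common_bound (ι := Fin n × Fin n × Fin n)
      (Q := fun a C => |structureCoeff r a.1 a.2.1 a.2.2 xbar| < C)
      (fun i a b hab h => h.trans_le hab) fun a => exists_gt _
    refine ⟨Cs, hCs0, eventually_all.2 fun i => eventually_all.2 fun l => eventually_all.2 fun k =>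
      eventually_forall_mem_ball ?_⟩
    exact ((hr.continuousAt_structureCoeff hΩ hxbar i l k).abs.eventually_lt
      continuousAt_const (h (i, l, k))).mono fun x hx => hx.le
  -- `P` bounds every `p_α` and is positive even if `n = 0`; `δ = 1 / (4 P)` then gives `n δ ≤ 1/4`.
  set P : ℝ := n + 1 with hP
  have hP0 : 0 < P := by positivity
  set δ : ℝ := 1 / (4 * P) with hδ
  have hδ0 : 0 < δ := by positivity
  have hδ1 : δ ≤ 1 := by
    rw [hδ, div_le_one (by positivity)]
    have : (0 : ℝ) ≤ n := Nat.cast_nonneg n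
    linarith
  have hδn : n * δ ≤ 1 / 4 := by
    rw [hδ, mul_one_div, div_le_div_iff₀ (by positivity) (by norm_num)]
    linarith
  have hGev : ∀ᶠ T in 𝓝[>] (0 : ℝ), ∀ α, ∀ s ∈ Metric.ball (0 : Fin (n - (I α).card) → ℝ) T,
      ‖fderiv ℝ (G α) s‖ ≤ C ∧ |G α s - c α| ≤ ρ / 2 := by
    refine eventually_all.2 fun α => eventually_forall_mem_ball ?_
    have hU := (hξ α).isOpen.mem_nhds (hξ α).zero_mem
    have h1 : ContinuousAt (fun s => ‖fderiv ℝ (G α) s‖) 0 :=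
      (((hgC1 α).continuousOn_fderiv_of_isOpen (hξ α).isOpen le_rfl).continuousAt hU).norm
    have h2 : ContinuousAt (fun s => |G α s - c α|) 0 :=
      (((hgC1 α).continuousOn.continuousAt hU).sub continuousAt_const).abs
    filter_upwards [h1.eventually_lt (continuousAt_const (y := C)) (by linarith [(hC α).2.2.1]),
      h2.eventually_lt (continuousAt_const (y := ρ / 2)) (by
        simpa [hG, hc, (hξ α).map_zero] using hρ0)] with s h3 h4
    exact ⟨h3.le, h4.le⟩
  -- The other constants do not depend on `T`, so each contraction condition is a linear bound on
  -- `T`. The neighbourhood is shrunk only afterwards, to make the parameter domains that small.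
  obtain ⟨T, ⟨⟨⟨⟨⟨⟨hTG, hT1⟩, hT2⟩, hT3⟩, hT4⟩, hT5⟩, hT0⟩⟩ :=
    ((((((hGev.and (eventually_mul_le (P * M) (half_pos hρ0))).and
      (eventually_mul_le (P * L) one_half_pos)).and
      (eventually_mul_le (P * (C * C) * C) one_half_pos)).and
      (eventually_mul_le (n * Cs) one_half_pos)).and
      (eventually_mul_le (P * (n * (2 * (2 * (m * C))))) (by norm_num : (0 : ℝ) < 1 / 4))).and
      self_mem_nhdsWithin).exists
  replace hT0 : 0 < T := hT0
  have hX1 : ∀ i, ContDiffOn ℝ 1 (r i) Ω := hr.1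
  have hX0 : ∀ i, r i xbar ≠ 0 := fun i => (hr.2 xbar hxbar).ne_zero i
  have hXc : ∀ i, ContinuousAt (r i) xbar := fun i =>
    (hX1 i).continuousOn.continuousAt (hΩ.mem_nhds hxbar)
  have hev : ∀ᶠ ε in 𝓝[>] (0 : ℝ), ∀ α, ∀ Θ D ψ φ,
      AdaptedChart (fun j => r ((I α).orderEmbOfFin rfl j)) (U α) (ξ α) Θ D ψ φ →
      D ⊆ Metric.ball xbar ε →
      -- Half of `T`, so that `t.2` lies in the open ball on which the estimates for `G` hold.
      (∀ t ∈ Θ, ‖t‖ ≤ T / 2) ∧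
      (∀ t ∈ Θ, ‖fderiv ℝ ψ t - baseMap (fun j => r ((I α).orderEmbOfFin rfl j)) (ξ α) xbar‖
        ≤ min 1 (1 / (2 * κ α))) ∧
      (∀ x ∈ Ξ α ∩ D, (φ x).1 = 0) ∧
      ∀ k, ∀ t ∈ Θ, ‖chartCoeff r ψ (axis n k) t - Pi.single ((I α).orderEmbOfFin rfl k) 1‖ ≤ δ := by
    refine eventually_all.2 fun α => ?_
    have hκα := hκ0 α
    filter_upwards [eventually_params_small (fun j => hXc ((I α).orderEmbOfFin rfl j))
        (fun j => hX0 _) (hξ α) (half_pos hT0),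
      eventually_norm_fderiv_sub_baseMap_le hΩ hxbar (fun j => hX1 ((I α).orderEmbOfFin rfl j))
        (fun j => hX0 _) (hξ α) (δ := min 1 (1 / (2 * κ α))) (by positivity),
      eventually_fst_eq_zero hΩ hxbar (fun j => hX1 ((I α).orderEmbOfFin rfl j)) (hξ α)
        (hκ0 α) (hκ α),
      eventually_chartCoeff_close hr hΩ hxbar (ι := (I α).orderEmbOfFin rfl) (fun j => hX0 _) (hξ α)
        hδ0] with ε h1 h2 h3 h4 Θ D ψ φ h hD
    exact ⟨h1 Θ D ψ φ h hD, h2 Θ D ψ φ h hD, h3 Θ D ψ φ h hD, h4 Θ D ψ φ h hD⟩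
  obtain ⟨ε, ⟨⟨hε, hεs⟩, hε1⟩⟩ := ((hev.and hCs).and (Ioo_mem_nhdsGT hε₀)).exists
  obtain ⟨D, hD, hxD, hDε, hcharts⟩ := hstable ε hε1.1
  have hDε₀ : D ⊆ Metric.closedBall xbar ε₀ :=
    (hDε.trans (Metric.ball_subset_ball hε1.2.le)).trans Metric.ball_subset_closedBall
  have hDΩ : D ⊆ Ω := hDε₀.trans hε₀Ω
  choose Θ ψ hΘ hflow hψ using hcharts
  choose φ hφ using fun α => adaptedChart_of_isFlowImage hΩ hX1 (hΘ α) hD hDΩ (hflow α) (hψ α)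
  choose hε₁ hε₂ hε₃ hε₄ using fun α => hε α _ _ _ _ (hφ α) hDε
  have hball : ∀ α, ∀ t ∈ Θ α, t.2 ∈ Metric.ball (0 : Fin (n - (I α).card) → ℝ) T := by
    intro α t ht
    rw [mem_ball_zero_iff]
    linarith [hε₁ α t ht, norm_snd_le t]
  have S : PicardSetting (p := fun α => (I α).card) (fun α j => r ((I α).orderEmbOfFin rfl j))
      U ξ Θ D ψ φ G F Υ c ρ P T M L C :=
    { chart := hφ
      isOpen_U := fun α => (hξ α).isOpen
      isOpen_Υ := hΥ
      contDiffOn_G := hgC1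
      contDiffOn_F := fun α j => (hfC1 α _ (hmem α j)).mono (prod_mono hDΩ subset_rfl)
      closedBall_subset := hρ
      abs_F_le := fun α j x hx w hw => hM ⟨α, j⟩ x (hDΩ hx) w hw
      abs_F_sub_le := fun α j x hx w hw w' hw' => hL ⟨α, j⟩ x (hDΩ hx) w hw w' hw'
      norm_fderiv_F_le := fun α j x hx w hw =>
        (hC₁ ⟨α, j⟩ (x, w) ⟨hDε₀ hx, hw⟩).trans (hC α).1
      modulus := fun η hη => by
        obtain ⟨d, hd, h⟩ := hmod η hη
        exact ⟨d, hd, fun α j x hx w hw w' hw' hww => h ⟨α, j⟩ (x, w) ⟨hDε₀ hx, hw⟩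
          (x, w') ⟨hDε₀ hx, hw'⟩ (by simpa [Prod.norm_def] using hww)⟩
      norm_le := fun α t ht => by linarith [hε₁ α t ht]
      norm_fderiv_ψ_le := fun α t ht => by
        have h1 := norm_sub_norm_le (fderiv ℝ (ψ α) t)
          (baseMap (fun j => r ((I α).orderEmbOfFin rfl j)) (ξ α) xbar)
        linarith [(hC α).2.2.2, (hε₂ α t ht).trans (min_le_left _ _)]
      norm_fderiv_φ_le := fun α x hx => by
        have hκα := hκ0 α
        refine ((hφ α).norm_fderiv_inv_le (hκ0 α) (hκ α) (δ := 1 / (2 * κ α)) (le_of_eq ?_)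
          (fun t ht => (hε₂ α t ht).trans (min_le_right _ _)) hx).trans (hC α).2.1
        field_simp
      norm_fderiv_G_le := fun α t ht => (hTG α _ (hball α t ht)).1
      abs_G_sub_le := fun α t ht => (hTG α _ (hball α t ht)).2
      le_P := fun α => by
        have : ((I α).card : ℝ) ≤ n := by
          exact_mod_cast (Finset.card_le_univ (I α)).trans_eq (Fintype.card_fin n)
        linarith
      pos_P := hP0
      pos_ρ := hρ0
      pos_T := hT0
      pos_M := hM0
      pos_L := hL0
      pos_C := hC0
      small_M := by linarith
      small_L := by linarith
      small_C := by linarith }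
  obtain ⟨u, hu, hu', ⟨K, hK⟩, hufix⟩ := S.exists_fixedPoint hD
  have huΥ : MapsTo u D Υ := hu'.mono_right hρ
  obtain ⟨R, hR0, hR⟩ := exists_common_bound (ι := Fin n)
    (Q := fun i R => ∀ x ∈ Metric.closedBall xbar ε₀, ‖r i x‖ ≤ R)
    (fun i a b hab h x hx => (h x hx).trans hab) fun i =>
      (isCompact_closedBall xbar ε₀).exists_bound_of_continuousOn
        ((hX1 i).continuousOn.mono hε₀Ω)
  have hbound : ∀ β, ∀ i ∈ I β, ∀ x ∈ D, |defect r f u β i x| ≤ K * R + M := by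
    intro β i hi x hx
    obtain ⟨l, rfl⟩ := exists_orderEmbOfFin_eq hi
    have hux := (hu.differentiableOn one_ne_zero).differentiableAt (hD.mem_nhds hx)
    have h1 : dirDeriv (r ((I β).orderEmbOfFin rfl l)) (fun y => u y β) x
        = fderiv ℝ u x (r ((I β).orderEmbOfFin rfl l) x) β := by
      rw [dirDeriv, (hasFDerivAt_pi'.1 hux.hasFDerivAt β).fderiv]
      rfl
    have h2 := (norm_le_pi_norm (fderiv ℝ u x (r ((I β).orderEmbOfFin rfl l) x)) β).trans
      ((fderiv ℝ u x).le_of_opNorm_le_of_le (hK x hx) (hR ((I β).orderEmbOfFin rfl l) x (hDε₀ hx)))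
    rw [Real.norm_eq_abs, ← h1] at h2
    exact (abs_sub _ _).trans (add_le_add h2 (hM ⟨β, l⟩ x (hDΩ hx) (u x) (huΥ hx)))
  -- The defects for all `α`, `i` and `x` form one family, since the estimate for one of them
  -- involves the others.
  have hzero := eq_zero_of_abs_le_half
    (e := fun a : {a : Fin m × Fin n × (Fin n → ℝ) // a.2.1 ∈ I a.1 ∧ a.2.2 ∈ D} =>
      defect r f u a.1.1 a.1.2.1 a.1.2.2) (M₀ := |K * R + M|) (abs_nonneg _)
    (fun a => (hbound _ _ a.2.1 _ a.2.2).trans (le_abs_self _))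
    (fun M₀ hM₀ h a => S.abs_defect_le_half hΩ hDΩ hr hfC1 hstruct hinv hint
      (fun i l k x hx => hεs i l k x (hDε hx)) hCs0.le (by linarith) (by linarith) hδ0.le hδ1 hδn
      hε₄ hu hu' hufix hM₀ (fun β i hi x hx => h ⟨(β, i, x), hi, hx⟩) _ _ a.2.1 _ a.2.2)
  refine ⟨D, hD, hxD, hDΩ, u, ⟨hu, huΥ, fun α i hi x hx => sub_eq_zero.1 (hzero ⟨(α, i, x), hi, hx⟩),
    fun α x hx => S.data_of_fixedPoint hε₃ hufix α hx⟩, fun v hv => ?_⟩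
  -- The uniform contraction suffices here, so the competitor `v` needs no bound on its derivative.
  exact S.fixedPoint_unique hu.continuousOn huΥ hv.contDiffOn.continuousOn hv.mapsTo hufix
    fun x hx => S.picard_eq_of_isSolution (fun α => (hξ α).image_eq) hv hx
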